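/- **Model.** Servers are FIFO fluid servers. If a server has service rate $\mu$, class-$i$ arrival and departure rates $a_i(t),d_i(t)$ and height (queued fluid divided by $\mu$) $h(t)$, then $d_i(t+h(t))=a_i(t)/(\dot h(t)+1)$, with $\dot h=\frac1\mu\sum_i a_i-1$ when $h>0$ and $\dot h=\max\{\frac1\mu\sum_i a_i-1,0\}$ when $h=0$ (for almost all $t$; equivalently in integrated form). The all-FIFO *basic gadget* has four such servers $Q_1,Q_2,Q_3,Q_4$ of service rates $1,\,1-\mu_2,\,1-\mu_3,\,1$. A session $H$ passes $K$ times through the big loop $Q_1Q_2Q_3Q_4$ and then $K'$ more times through $Q_4$ alone; a session $S$ passes through $Q_4$ only; $L\ge 0$ vertical sessions pass through $Q_2$, arriving there at nonnegative measurable rates $f_1(t),\dots,f_L(t)$. There are no propagation delays, and no fluid is injected into $H$. The injection rate $\varepsilon(t)$ of $S$ is continuous with $0\le\varepsilon(t)\le\varepsilon_s$. When $S$ becomes blocked ($Q_4$ stores $S$-fluid) at rate $\varepsilon$, after being blocked for time $t$ its rate is $f_\delta(\varepsilon,t)$, with $\delta=\delta_s$; the rate does not decrease while $S$ is happy ($Q_4$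 stores no $S$-fluid and offers $S$ a bandwidth larger than its rate) and is constant while $S$ is neither blocked nor happy. Here $\delta_s$ is taken from a set $S_{\rm del}\subset\mathbb R$, and $f_\delta(\varepsilon,t)$ ($\delta\in S_{\rm del}$, $\varepsilon,t\ge0$) is any given family such that: $f_\delta(\varepsilon,0)=\varepsilon$; $f_\delta(\varepsilon,\cdot)$ is $0$ from some positive time on; $f_\delta(\varepsilon,t)$ is nondecreasing in $\varepsilon$, nonincreasing in $\delta$ and in $t$, and jointly continuous in $(\varepsilon,t)$; and for all $0<\varepsilon'<\varepsilon$ and $t>0$ some $\delta$ has $f_\delta(\varepsilon,t)>\varepsilon'$ and some $\delta$ has $f_\delta(\varepsilon,t)<\varepsilon'$. At time $0$, $Q_1$ holds one unit of $H$-fluid that has not yet made any loop, the other servers are empty, and $\varepsilon(0)=\varepsilon_s$. **Lemma.** For every integer $K\ge20$ there are $\varepsilon_s\in\left(\frac{5}{3K},\frac{20}{K}\right)$, $\delta_s\in S_{\rm del}$, $K'\in\mathbb N$, $\mu_3=\frac{2\varepsilon_s}{5}$ and times $T_1,T_3,P$, with $\left(1+\frac{3\varepsilon_s}5\right)\varepsilon_s^2<\mu_3$,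 such that the following hold. (a), (b) For every $L$, every $\mu_2$ with $0<\mu_2<\mu_3-\varepsilon_s^2$ and all vertical arrivals with $\sum_i f_i(t)\le\varepsilon_s^2$ for all $t$, the gadget has at least one evolution, and for every evolution there is $T_2$ with $0<T_1<T_2<T_3=\frac{K}{1-\mu_3}<P$ such that, with $h_i$ the height of $Q_i$: * at $t=0$: $(h_1,h_2,h_3,h_4)=(1,0,0,0)$, the fluid in $Q_1$ is $H$-fluid before its first loop, and $\varepsilon(0)=\varepsilon_s$; * on $[0,T_1]$: $h_1$ is strictly decreasing and $h_2,h_3,h_4$ are strictly increasing; * on $[T_1,T_2]$: $h_1=0$, $h_2$ is strictly decreasing and $h_4$ is strictly increasing; if moreover $\mu_2<\mu_3-\left(1+\frac{3\varepsilon_s}5\right)\varepsilon_s^2$, then $h_3$ is strictly increasing. In every case $h_3>0$ on $(0,T_3)$; * on $[T_2,T_3]$: $h_1=h_2=0$, $h_3$ is strictly decreasing and $h_4$ is strictly increasing; and $\varepsilon(T_3)\ge\varepsilon_s/2$; * on $[T_3,P]$: $h_1=h_2=h_3=0$ and $h_4\ge1$; * at $t=P$: $h_4=1$, the fluid in $Q_4$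 is one unit of $H$-fluid that leaves the gadget after its current visit to $Q_4$, there is no $S$-fluid, and $\varepsilon(P)=0$; * $H$-fluid arrives at $Q_2$ at rate at most $1-\mu_3$ for almost all times in $[T_1,T_3]$ and at rate $0$ for almost all times in $[T_3,P]$. (c) If moreover $K\ge100$, then for every $L$ and all vertical arrival rates $f_i(t)=f_i^{(\mu_2)}(t)$ which may depend on $\mu_2\in\left[\frac{\varepsilon_s}{60},\frac{\varepsilon_s}{5}\right]$ and satisfy, for $\mu_2$ in this interval, $\sum_i f_i\le\varepsilon_s^2$ at all times, with $\int_0^T\sum_i f_i(t)\,dt$ continuous in $\mu_2$ for each fixed $T\ge0$, there is $\mu_2\in\left[\frac{\varepsilon_s}{60},\frac{\varepsilon_s}{5}\right]$ with $\mu_2<\mu_3-\left(1+\frac{3\varepsilon_s}5\right)\varepsilon_s^2$ (so that all of the above applies) for which the maximal height of $Q_2$ during $[0,P]$ equals $P/\lceil 5P\rceil$. -/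

import Mathlib

open Set MeasureTheory

/-- A parameterized flow decrease function `f δ ε t` (the injection rate at time `t` of a session
that became blocked at time `0`, when its rate was `ε`, and has stayed blocked since), where the
damping parameter `δ` ranges over `S`. The fields are: the meaning of `ε`, decrease to `0`,
monotonicity (three fields), damping, and continuity. -/
structure IsFlowDecrease (S : Set ℝ) (f : ℝ → ℝ → ℝ → ℝ) : Prop where
  start : ∀ δ ∈ S, ∀ ε, 0 ≤ ε → f δ ε 0 = ε
  to_zero : ∀ δ ∈ S, ∀ ε, 0 ≤ ε → ∃ t₀, 0 < t₀ ∧ ∀ t, t₀ ≤ t → f δ ε t = 0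
  mono_rate : ∀ δ ∈ S, ∀ t, 0 ≤ t → MonotoneOn (fun ε => f δ ε t) (Ici 0)
  anti_time : ∀ δ ∈ S, ∀ ε, 0 ≤ ε → AntitoneOn (fun t => f δ ε t) (Ici 0)
  anti_damping : ∀ ε, 0 ≤ ε → ∀ t, 0 ≤ t → AntitoneOn (fun δ => f δ ε t) S
  damping : ∀ ε' ε t, 0 < ε' → ε' < ε → 0 < t →
    (∃ δ ∈ S, ε' < f δ ε t) ∧ (∃ δ ∈ S, f δ ε t < ε')
  cont : ∀ δ ∈ S, ContinuousOn (fun p : ℝ × ℝ => f δ p.1 p.2) (Ici 0 ×ˢ Ici 0)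

/-- A FIFO fluid server with service rate `μ`, observed from time `0` on.
`a i` and `d i` are the arrival and departure rates of fluid of class `i`, and `h` is the height
(queued fluid divided by `μ`). Initially the height is `h₀`, and `c i y` is the density of class `i`
at height `y`, i.e. the rate at which that class leaves `y` time units later.

`height` is the integrated form of `h' = (∑ a) / μ - 1` when `h > 0` and
`h' = max ((∑ a) / μ - 1) 0` when `h = 0`; `fifo` is the integrated form of
`d i (t + h t) = a i t / (h' t + 1)`. -/
structure IsFIFOServer {ι : Type} [Fintype ι] (μ h₀ : ℝ) (c a d : ι → ℝ → ℝ) (h : ℝ → ℝ) :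
    Prop where
  arr_nonneg : ∀ i t, 0 ≤ t → 0 ≤ a i t
  dep_nonneg : ∀ i t, 0 ≤ t → 0 ≤ d i t
  arr_integrable : ∀ i t, 0 ≤ t → IntervalIntegrable (a i) volume 0 t
  dep_integrable : ∀ i t, 0 ≤ t → IntervalIntegrable (d i) volume 0 t
  height_cont : ContinuousOn h (Ici 0)
  height : ∀ t, 0 ≤ t → h t = h₀ + ∫ s in (0 : ℝ)..t,
    if 0 < h s then (∑ i, a i s) / μ - 1 else max ((∑ i, a i s) / μ - 1) 0
  initial : ∀ i, ∀ᵐ t : ℝ, 0 ≤ t → t < h₀ → d i t = c i t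
  fifo : ∀ i t, 0 ≤ t → ∫ u in h₀..(t + h t), d i u = ∫ s in (0 : ℝ)..t, a i s

/-- Amount of a class stored at time `t` in a FIFO server of height `h` from which that class
departs at rate `d`: the part of it that leaves during the next `h t` time units. -/
noncomputable def stored (d h : ℝ → ℝ) (t : ℝ) : ℝ := ∫ u in t..(t + h t), d u

/-- The quantities evolving in the basic gadget with `L` vertical sessions. Heights of the four
servers; `dⱼ k`: departure rate from server `Qⱼ` of the session `H` fluid making its visit
number `k` (counted from `0`) to `Qⱼ`; departure rates of the vertical sessions from `Q₂` and of
the simple session `S` from `Q₄`; injection rate of session `S`. -/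
structure GadgetTrajectory (L : ℕ) where
  h₁ : ℝ → ℝ
  h₂ : ℝ → ℝ
  h₃ : ℝ → ℝ
  h₄ : ℝ → ℝ
  d₁ : ℕ → ℝ → ℝ
  d₂ : ℕ → ℝ → ℝ
  d₃ : ℕ → ℝ → ℝ
  d₄ : ℕ → ℝ → ℝ
  dV : Fin L → ℝ → ℝ
  dS : ℝ → ℝ
  rate : ℝ → ℝ

namespace GadgetTrajectory

variable {L : ℕ} (R : GadgetTrajectory L)

/-- Session `H` arrivals at `Q₁`, by visit: no fluid is injected into session `H` from outside, and
the fluid that leaves `Q₄` at the end of big loop `k` starts big loop `k + 1`. -/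
def arrivalH₁ : ℕ → ℝ → ℝ
  | 0 => fun _ => 0
  | k + 1 => R.d₄ k

/-- Session `H` arrivals at `Q₄`, by visit: the first `K` visits come from `Q₃` (big loops), the
later ones from `Q₄` itself (small loops). -/
def arrivalH₄ (K k : ℕ) : ℝ → ℝ := if k < K then R.d₃ k else R.d₄ (k - 1)

/-- Session `S` is blocked: its path (just `Q₄`, where it is not subject to priorities) stores
session `S` fluid. -/
def Blocked (t : ℝ) : Prop := 0 < stored R.dS R.h₄ t

/-- Bandwidth available to session `S` at `Q₄` (service rate `1`): none when there is a queue,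
otherwise what the session `H` arrivals leave. -/
noncomputable def available (K K' : ℕ) (t : ℝ) : ℝ :=
  if 0 < R.h₄ t then 0 else 1 - ∑ k : Fin (K + K'), R.arrivalH₄ K k t

/-- Session `S` is happy. -/
def Happy (K K' : ℕ) (t : ℝ) : Prop :=
  stored R.dS R.h₄ t = 0 ∧ R.rate t < R.available K K' t

/-- Session `S` is stable: neither blocked nor happy. -/
def Stable (K K' : ℕ) (t : ℝ) : Prop := ¬ R.Blocked t ∧ ¬ R.Happy K K' t

end GadgetTrajectory

/-- Injection rate of session `S` with maximal rate `ε` and decrease function `f` (the damping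
parameter being fixed): it follows `f` from the moment the session becomes blocked and as long as it
stays blocked, is constant while the session is stable, and does not decrease while it is happy. -/
structure ObeysFlowControl {L : ℕ} (f : ℝ → ℝ → ℝ) (ε : ℝ) (K K' : ℕ) (R : GadgetTrajectory L) :
    Prop where
  cont : ContinuousOn R.rate (Ici 0)
  nonneg : ∀ t, 0 ≤ t → 0 ≤ R.rate t
  le_max : ∀ t, 0 ≤ t → R.rate t ≤ ε
  blocked : ∀ a b, 0 ≤ a → a < b → ¬ R.Blocked a → (∀ t ∈ Ioo a b, R.Blocked t) →
    ∀ t ∈ Icc a b, R.rate t = f (R.rate a) (t - a)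
  stable : ∀ a b, 0 ≤ a → a < b → (∀ t ∈ Ioo a b, R.Stable K K' t) →
    ∀ t ∈ Icc a b, R.rate t = R.rate a
  happy : ∀ a b, 0 ≤ a → a < b → (∀ t ∈ Ioo a b, R.Happy K K' t) → MonotoneOn R.rate (Icc a b)

/-- A run of the all-FIFO basic gadget. Service rates are `1`, `1 - μ₂`, `1 - μ₃`, `1`; session `H`
makes `K` big loops `Q₁ Q₂ Q₃ Q₄` and then `K'` small loops through `Q₄`; the vertical sessions
arrive at `Q₂` at rates `v i`. At time `0` there is one unit of fresh session `H` fluid in `Q₁`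
(about to make visit `0`), the other servers are empty, and session `S` is injecting at its maximal
rate `ε`. The injection rate into session `H` is `0` at all times. -/
structure IsGadgetRun {L : ℕ} (f : ℝ → ℝ → ℝ) (ε μ₂ μ₃ : ℝ) (K K' : ℕ) (v : Fin L → ℝ → ℝ)
    (R : GadgetTrajectory L) : Prop where
  server₁ : IsFIFOServer (ι := Fin K) 1 1 (fun k _ => if (k : ℕ) = 0 then 1 else 0)
    (fun k => R.arrivalH₁ k) (fun k => R.d₁ k) R.h₁
  server₂ : IsFIFOServer (ι := Fin K ⊕ Fin L) (1 - μ₂) 0 (fun _ _ => 0)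
    (Sum.elim (fun k => R.d₁ k) v) (Sum.elim (fun k => R.d₂ k) R.dV) R.h₂
  server₃ : IsFIFOServer (ι := Fin K) (1 - μ₃) 0 (fun _ _ => 0)
    (fun k => R.d₂ k) (fun k => R.d₃ k) R.h₃
  server₄ : IsFIFOServer (ι := Fin (K + K') ⊕ Unit) 1 0 (fun _ _ => 0)
    (Sum.elim (fun k => R.arrivalH₄ K k) (fun _ => R.rate))
    (Sum.elim (fun k => R.d₄ k) (fun _ => R.dS)) R.h₄
  rate_zero : R.rate 0 = ε
  flow_control : ObeysFlowControl f ε K K' R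

/-- Arrival rates of the vertical sessions: nonnegative and of total at most `B` at all times. -/
structure IsVerticalArrivals {L : ℕ} (B : ℝ) (v : Fin L → ℝ → ℝ) : Prop where
  meas : ∀ i, Measurable (v i)
  nonneg : ∀ i t, 0 ≤ t → 0 ≤ v i t
  bound : ∀ t, 0 ≤ t → ∑ i, v i t ≤ B

/-- The course of one phase `[0, P]`, row by row, except for the strict increase of `h₃` on
`[T₁, T₂]`, instead of which positivity of `h₃` on `(0, T₃)` is recorded. -/
structure FollowsPhase {L : ℕ} (ε μ₃ : ℝ) (K K' : ℕ) (R : GadgetTrajectory L)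
    (T₁ T₂ T₃ P : ℝ) : Prop where
  times : 0 < T₁ ∧ T₁ < T₂ ∧ T₂ < T₃ ∧ T₃ < P
  -- at time `0`: one unit of fresh fluid in `Q₁`
  start_heights : R.h₁ 0 = 1 ∧ R.h₂ 0 = 0 ∧ R.h₃ 0 = 0 ∧ R.h₄ 0 = 0
  start_fresh : stored (R.d₁ 0) R.h₁ 0 = 1 ∧ ∀ k, 0 < k → k < K → stored (R.d₁ k) R.h₁ 0 = 0
  start_rate : R.rate 0 = ε
  -- on `[0, T₁]`
  fst_h₁ : StrictAntiOn R.h₁ (Icc 0 T₁)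
  fst_h₂ : StrictMonoOn R.h₂ (Icc 0 T₁)
  fst_h₃ : StrictMonoOn R.h₃ (Icc 0 T₁)
  fst_h₄ : StrictMonoOn R.h₄ (Icc 0 T₁)
  -- on `[T₁, T₂]`
  snd_h₁ : ∀ t ∈ Icc T₁ T₂, R.h₁ t = 0
  snd_h₂ : StrictAntiOn R.h₂ (Icc T₁ T₂)
  h₃_pos : ∀ t ∈ Ioo 0 T₃, 0 < R.h₃ t
  snd_h₄ : StrictMonoOn R.h₄ (Icc T₁ T₂)
  -- on `[T₂, T₃]`
  trd_h₁₂ : ∀ t ∈ Icc T₂ T₃, R.h₁ t = 0 ∧ R.h₂ t = 0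
  trd_h₃ : StrictAntiOn R.h₃ (Icc T₂ T₃)
  trd_h₄ : StrictMonoOn R.h₄ (Icc T₂ T₃)
  time_T₃ : T₃ = K / (1 - μ₃)
  rate_T₃ : ε / 2 ≤ R.rate T₃
  -- on `[T₃, P]`
  fth : ∀ t ∈ Icc T₃ P, R.h₁ t = 0 ∧ R.h₂ t = 0 ∧ R.h₃ t = 0 ∧ 1 ≤ R.h₄ t
  -- at time `P`: `Q₄` holds one unit of fluid, all of it session `H` fluid on its last visit
  end_height : R.h₄ P = 1
  end_processed : stored (R.d₄ (K + K' - 1)) R.h₄ P = 1 ∧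
    (∀ k, k < K + K' - 1 → stored (R.d₄ k) R.h₄ P = 0) ∧ stored R.dS R.h₄ P = 0
  end_rate : R.rate P = 0
  -- session `H` arrivals at `Q₂`
  arrivals₂ : ∀ᵐ t : ℝ, t ∈ Icc T₁ T₃ → ∑ k : Fin K, R.d₁ k t ≤ 1 - μ₃
  no_arrivals₂ : ∀ᵐ t : ℝ, t ∈ Icc T₃ P → ∑ k : Fin K, R.d₁ k t = 0

/-! The argument works with cumulative arrivals and departures. A FIFO server is then governed by
one continuous nondecreasing map, the exit time `t + h t`: along it, the cumulative departures of
each class equal its cumulative arrivals plus initial content. The total of arrivals determines the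
exit time exactly as long as the server stays busy (`exit_eq_of_busy`), and bounds it from below
always (`le_exit`).

Put m = 1 - 2ε/5 and T = K/m, and suppose that Q₃ does not idle on (0, T). It then feeds H-fluid to
Q₄ at rate m, the session S stays behind a queue and injects g = f δ ε, and fluid entering Q₄ at
time x leaves it at φ(x) = m x + ∫₀ˣ g. The departures E of H from Q₄ are therefore given by E(φ(x))
= m x, and Q₁ has put out min(t, 1 + E(t)) by time t. Since 9ε/10 ≤ g ≤ ε on [0, T], the slope of φ
lies between 1 + ε/2 and 1 + 3ε/5, so E increases more slowly than m t. Hence Q₁ drains at a time T₁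
that depends on g alone; from then on the inflow of Q₂ is at most m + ε² < 1 - μ₂, and Q₂ drains
too.

The pair (ε, δ) is chosen by the intermediate value theorem (`exists_isTuned`) so that the tip of H,
which enters Q₄ for its K-th visit at time (K-1)/m, leaves it exactly at T, when the last H-fluid
arrives from Q₃. Equivalently 1 + E(t) - m t decreases to the value 0 at T, so it is positive
before. The bound ε² on the vertical traffic lets this survive the passage through Q₂
(`service_mul_exit_lt`), which says that Q₃ is not empty. The circularity of this reasoning is
broken in `third_server_pos`: up to the first time at which Q₃ is empty all formulas hold, and they
exclude that time. The same device shows that Q₄ stays busy (`fourth_server_busy`).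

After T the unit of H-fluid circulates through Q₄ alone, class after class. The successive arrival
times of its tip obey a recursion involving only g (`iterExit_eq_tipArrival`). Once g has died out,
one more turn flushes the remaining S-fluid, and exactly one unit of H-fluid is left
(`end_of_phase`).

For existence the formulas are read in the other direction. A delay equation yields the cumulative
arrivals B and departures E at Q₄ of an H-session that never leaves (`exists_isCirculation`).
Cutting these curves into unit pieces, one per visit, defines the rates, and each server is checked
through its single busy period (`IsFIFOServer.of_busy_period`).

For the fine-tuning, the largest height of Q₂ is its height at T₁, namely (T₁ + V(T₁))/(1 - μ₂) - T₁
with V the cumulative vertical arrivals. As T₁ does not depend on μ₂, this is continuous in μ₂, and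
it passes through every value in [1/10, 1/5]. -/

/-! ### Rates and their cumulative amounts -/

/-- The cumulative amount of a rate since time `0`. -/
noncomputable def cum (g : ℝ → ℝ) (t : ℝ) : ℝ := ∫ s in (0 : ℝ)..t, g s

/-- A nonnegative rate that is integrable over bounded intervals of nonnegative times. -/
structure IsRate (g : ℝ → ℝ) : Prop where
  nonneg : ∀ t, 0 ≤ t → 0 ≤ g t
  int : ∀ t, 0 ≤ t → IntervalIntegrable g volume 0 t

theorem cum_zero (g : ℝ → ℝ) : cum g 0 = 0 := by simp [cum]

namespace IsRate

variable {g : ℝ → ℝ} {s t : ℝ}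

theorem intervalIntegrable (hg : IsRate g) (hs : 0 ≤ s) (ht : 0 ≤ t) :
    IntervalIntegrable g volume s t :=
  (hg.int s hs).symm.trans (hg.int t ht)

theorem cum_sub (hg : IsRate g) (hs : 0 ≤ s) (ht : 0 ≤ t) :
    cum g t - cum g s = ∫ x in s..t, g x :=
  intervalIntegral.integral_interval_sub_left (hg.int t ht) (hg.int s hs)

theorem cum_mono (hg : IsRate g) (hs : 0 ≤ s) (hst : s ≤ t) : cum g s ≤ cum g t := by
  have := hg.cum_sub hs (hs.trans hst)
  have h2 : 0 ≤ ∫ x in s..t, g x :=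
    intervalIntegral.integral_nonneg hst fun x hx => hg.nonneg x (hs.trans hx.1)
  linarith

theorem cum_nonneg (hg : IsRate g) (ht : 0 ≤ t) : 0 ≤ cum g t := by
  have := hg.cum_mono le_rfl ht
  rwa [cum_zero] at this

theorem cum_sub_le {C : ℝ} (hg : IsRate g) (hs : 0 ≤ s) (hst : s ≤ t)
    (h : ∀ x ∈ Ioo s t, g x ≤ C) : cum g t - cum g s ≤ C * (t - s) := by
  rw [hg.cum_sub hs (hs.trans hst)]
  have := intervalIntegral.integral_mono_on_of_le_Ioo hst
    (hg.intervalIntegrable hs (hs.trans hst)) intervalIntegrable_const h (μ := volume)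
  simpa [mul_comm] using this

theorem le_cum_sub {C : ℝ} (hg : IsRate g) (hs : 0 ≤ s) (hst : s ≤ t)
    (h : ∀ x ∈ Ioo s t, C ≤ g x) : C * (t - s) ≤ cum g t - cum g s := by
  rw [hg.cum_sub hs (hs.trans hst)]
  have := intervalIntegral.integral_mono_on_of_le_Ioo hst intervalIntegrable_const
    (hg.intervalIntegrable hs (hs.trans hst)) h (μ := volume)
  simpa [mul_comm] using this

theorem continuousOn_cum (hg : IsRate g) : ContinuousOn (cum g) (Ici 0) := by
  intro t ht
  have h1 : ContinuousOn (cum g) (Icc 0 (t + 1)) := by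
    have := intervalIntegral.continuousOn_primitive_interval'
      (hg.int (t + 1) (by linarith [mem_Ici.1 ht])) (left_mem_uIcc)
    rwa [uIcc_of_le (by linarith [mem_Ici.1 ht])] at this
  refine (h1 t ⟨ht, by linarith⟩).mono_of_mem_nhdsWithin ?_
  filter_upwards [self_mem_nhdsWithin, mem_nhdsWithin_of_mem_nhds (Iic_mem_nhds (lt_add_one t))]
    with x hx hx' using ⟨hx, hx'⟩

theorem sum {ι : Type*} {u : Finset ι} {a : ι → ℝ → ℝ} (ha : ∀ i ∈ u, IsRate (a i)) :
    IsRate fun s => ∑ i ∈ u, a i s where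
  nonneg t ht := Finset.sum_nonneg fun i hi => (ha i hi).nonneg t ht
  int t ht := by
    have := IntervalIntegrable.sum u fun i hi => (ha i hi).int t ht
    rwa [show ∑ i ∈ u, a i = fun s => ∑ i ∈ u, a i s by ext x; simp] at this

theorem cum_sum {ι : Type*} {u : Finset ι} {a : ι → ℝ → ℝ} (ha : ∀ i ∈ u, IsRate (a i))
    (ht : 0 ≤ t) : cum (fun s => ∑ i ∈ u, a i s) t = ∑ i ∈ u, cum (a i) t :=
  intervalIntegral.integral_finsetSum fun i hi => (ha i hi).int t ht

theorem zero : IsRate fun _ => 0 := ⟨fun _ _ => le_rfl, fun _ _ => intervalIntegrable_const⟩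

theorem of_continuousOn (hc : ContinuousOn g (Ici 0)) (h0 : ∀ t, 0 ≤ t → 0 ≤ g t) : IsRate g :=
  ⟨h0, fun t ht => (hc.mono (by rw [uIcc_of_le ht]; exact Icc_subset_Ici_self)).intervalIntegrable⟩

/-- A rate whose integrals over subintervals are at most `C` times the length is almost everywhere
at most `C`. -/
theorem ae_le_of_cum_sub_le {C : ℝ} (hg : IsRate g) (hs : 0 ≤ s) (hst : s ≤ t)
    (h : ∀ x y, s ≤ x → x ≤ y → y ≤ t → cum g y - cum g x ≤ C * (y - x)) :
    ∀ᵐ x : ℝ, x ∈ Icc s t → g x ≤ C := by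
  have h1 := (hg.intervalIntegrable hs (hs.trans hst)).ae_hasDerivAt_integral
  have h2 : ∀ᵐ x : ℝ, x ≠ t := by simp [ae_iff, measure_singleton]
  filter_upwards [h1, h2] with x hx hxt hxI
  rw [uIcc_of_le hst] at hx
  have hd := hx hxI s ⟨le_rfl, hst⟩
  have hd' := hd.hasDerivWithinAt (s := Ioi x)
  rw [hasDerivWithinAt_iff_tendsto_slope' (by simp)] at hd'
  refine le_of_tendsto hd' ?_
  have hlt : x < t := lt_of_le_of_ne hxI.2 hxt
  filter_upwards [Ioo_mem_nhdsGT hlt] with y hy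
  have e1 := h x y hxI.1 hy.1.le hy.2.le
  have e2 : (∫ u in s..y, g u) - ∫ u in s..x, g u = cum g y - cum g x := by
    rw [← hg.cum_sub hs (hs.trans (hxI.1.trans hy.1.le)), ← hg.cum_sub hs (hs.trans hxI.1)]; ring
  rw [slope_def_field, e2, div_le_iff₀ (by linarith [hy.1])]
  exact e1

/-- A positive value at `t` would persist on a short interval to the left of `t`, by continuity, and
contribute to the integral. This turns "no S-fluid is stored" into a statement about the current
rate of S. -/
theorem eq_zero_of_cum_sub_eq_zero (hg : IsRate g) (hc : ContinuousOn g (Ici 0)) (hs : 0 ≤ s)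
    (hst : s < t) (h : cum g t = cum g s) : g t = 0 := by
  by_contra hne
  have hpos : 0 < g t := lt_of_le_of_ne (hg.nonneg t (by linarith)) (Ne.symm hne)
  have hct : ContinuousWithinAt g (Icc s t) t :=
    (hc t (by simp; linarith)).mono fun x hx => hs.trans hx.1
  have hev : ∀ᶠ x in nhdsWithin t (Iio t), g t / 2 < g x := by
    have h1 : ContinuousWithinAt g (Iio t) t :=
      hct.mono_of_mem_nhdsWithin (by
        filter_upwards [Ioo_mem_nhdsLT hst] with x hx using ⟨hx.1.le, hx.2.le⟩)
    exact h1.eventually (lt_mem_nhds (by linarith))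
  obtain ⟨l, hl, hlt⟩ := (mem_nhdsLT_iff_exists_Ioo_subset' hst).1 hev
  have hm : max l s < t := max_lt hl hst
  have e := hg.le_cum_sub (C := g t / 2) (hs.trans (le_max_right l s)) hm.le
    fun x hx => (hlt ⟨(le_max_left _ _).trans_lt hx.1, hx.2⟩ : g t / 2 < g x).le
  have e2 := hg.cum_mono hs (le_max_right l s)
  have : 0 < g t / 2 * (t - max l s) := mul_pos (by linarith) (by linarith)
  linarith

end IsRate

/-! ### Last and first zeros of a continuous height -/

theorem exists_last_nonpos {h : ℝ → ℝ} {s t : ℝ} (hc : ContinuousOn h (Icc s t)) (hst : s ≤ t)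
    (hs : h s ≤ 0) (ht : 0 < h t) :
    ∃ r, s ≤ r ∧ r < t ∧ h r ≤ 0 ∧ ∀ x, r < x → x ≤ t → 0 < h x := by
  have hK : IsCompact (Icc s t ∩ h ⁻¹' Iic 0) :=
    isCompact_Icc.of_isClosed_subset
      (hc.preimage_isClosed_of_isClosed isClosed_Icc isClosed_Iic) inter_subset_left
  obtain ⟨r, hr, hmax⟩ := hK.exists_isGreatest ⟨s, ⟨le_rfl, hst⟩, hs⟩
  have hr0 : h r ≤ 0 := hr.2
  refine ⟨r, hr.1.1, lt_of_le_of_ne hr.1.2 (by rintro rfl; linarith), hr.2, fun x hx hxt => ?_⟩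
  by_contra hn
  exact absurd (hmax ⟨⟨hr.1.1.trans hx.le, hxt⟩, not_lt.1 hn⟩) (not_le.2 hx)

theorem exists_first_nonpos {h : ℝ → ℝ} {s t : ℝ} (hc : ContinuousOn h (Icc s t)) (hst : s ≤ t)
    (hs : 0 < h s) (ht : h t ≤ 0) :
    ∃ r, s < r ∧ r ≤ t ∧ h r = 0 ∧ ∀ x, s ≤ x → x < r → 0 < h x := by
  have hK : IsCompact (Icc s t ∩ h ⁻¹' Iic 0) :=
    isCompact_Icc.of_isClosed_subset
      (hc.preimage_isClosed_of_isClosed isClosed_Icc isClosed_Iic) inter_subset_left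
  obtain ⟨r, hr, hmin⟩ := hK.exists_isLeast ⟨t, ⟨hst, le_rfl⟩, ht⟩
  have hr0 : h r ≤ 0 := hr.2
  have hsr : s < r := lt_of_le_of_ne hr.1.1 (by rintro rfl; linarith)
  have hpos : ∀ x, s ≤ x → x < r → 0 < h x := fun x hx hxt => by
    by_contra hn
    exact absurd (hmin ⟨⟨hx, hxt.le.trans hr.1.2⟩, not_lt.1 hn⟩) (not_le.2 hxt)
  refine ⟨r, hsr, hr.1.2, le_antisymm hr.2 ?_, hpos⟩
  have hcr : ContinuousWithinAt h (Ioo s r) r :=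
    (hc r hr.1).mono fun x hx => ⟨hx.1.le, hx.2.le.trans hr.1.2⟩
  have : (nhdsWithin r (Ioo s r)).NeBot := by
    rw [← mem_closure_iff_nhdsWithin_neBot, closure_Ioo hsr.ne]; exact ⟨hsr.le, le_rfl⟩
  refine ge_of_tendsto hcr ?_
  filter_upwards [self_mem_nhdsWithin] with x hx using (hpos x hx.1.le hx.2).le

/-! ### A single FIFO server in cumulative form -/

namespace IsFIFOServer

variable {ι : Type} [Fintype ι] {μ h₀ : ℝ} {c a d : ι → ℝ → ℝ} {h : ℝ → ℝ}

theorem arr (S : IsFIFOServer μ h₀ c a d h) (i : ι) : IsRate (a i) :=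
  ⟨S.arr_nonneg i, S.arr_integrable i⟩

theorem dep (S : IsFIFOServer μ h₀ c a d h) (i : ι) : IsRate (d i) :=
  ⟨S.dep_nonneg i, S.dep_integrable i⟩

theorem height_zero (S : IsFIFOServer μ h₀ c a d h) : h 0 = h₀ := by
  simpa using S.height 0 le_rfl

theorem continuousOn_Icc (S : IsFIFOServer μ h₀ c a d h) {s t : ℝ} (hs : 0 ≤ s) :
    ContinuousOn h (Icc s t) :=
  S.height_cont.mono fun _ hx => hs.trans hx.1

end IsFIFOServer

/-- The height is controlled only on nonnegative times; replacing `s` by `max s 0` makes the set of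
busy times open, hence measurable, and the integrand splits into two indicators. -/
theorem intervalIntegrable_ite_pos {h q : ℝ → ℝ} (hc : ContinuousOn h (Ici 0)) {t : ℝ} (ht : 0 ≤ t)
    (hq : IntervalIntegrable q volume 0 t) :
    IntervalIntegrable (fun s => if 0 < h s then q s else max (q s) 0) volume 0 t := by
  have hc' : Continuous fun s => h (max s 0) :=
    hc.comp_continuous (continuous_id.max continuous_const) fun x => le_max_right x 0
  have hm : MeasurableSet {s | 0 < h (max s 0)} := (isOpen_lt continuous_const hc').measurableSet
  rw [intervalIntegrable_iff_integrableOn_Ioc_of_le ht] at hq ⊢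
  have h1 : Integrable ({s | 0 < h (max s 0)}.indicator q +
      {s | 0 < h (max s 0)}ᶜ.indicator fun s => max (q s) 0) (volume.restrict (Ioc 0 t)) :=
    (hq.indicator hm).add (hq.pos_part.indicator hm.compl)
  refine h1.congr ?_
  filter_upwards [ae_restrict_mem measurableSet_Ioc] with s hs
  by_cases hp : 0 < h s <;> simp [indicator, max_eq_left hs.1.le, hp]

namespace IsFIFOServer

variable {ι : Type} [Fintype ι] {μ h₀ : ℝ} {c a d : ι → ℝ → ℝ} {h : ℝ → ℝ} {s t : ℝ}

theorem intervalIntegrable_netRate (S : IsFIFOServer μ h₀ c a d h) (hs : 0 ≤ s) (ht : 0 ≤ t) :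
    IntervalIntegrable (fun x => (∑ i, a i x) / μ - 1) volume s t :=
  (((IsRate.sum (u := Finset.univ) fun i _ => S.arr i).intervalIntegrable hs ht).div_const μ).sub
    intervalIntegrable_const

theorem integral_netRate (S : IsFIFOServer μ h₀ c a d h) (hs : 0 ≤ s) (ht : 0 ≤ t) :
    ∫ x in s..t, ((∑ i, a i x) / μ - 1) =
      (∑ i, cum (a i) t - ∑ i, cum (a i) s) / μ - (t - s) := by
  have hr := IsRate.sum (u := Finset.univ) fun i _ => S.arr i
  rw [intervalIntegral.integral_sub ((hr.intervalIntegrable hs ht).div_const μ)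
    intervalIntegrable_const, intervalIntegral.integral_div, ← hr.cum_sub hs ht,
    IsRate.cum_sum (fun i _ => S.arr i) hs, IsRate.cum_sum (fun i _ => S.arr i) ht]
  simp

theorem intervalIntegrable_height (S : IsFIFOServer μ h₀ c a d h) (hs : 0 ≤ s) (ht : 0 ≤ t) :
    IntervalIntegrable (fun x => if 0 < h x then (∑ i, a i x) / μ - 1
      else max ((∑ i, a i x) / μ - 1) 0) volume s t :=
  (intervalIntegrable_ite_pos S.height_cont hs
    (S.intervalIntegrable_netRate le_rfl hs)).symm.trans
  (intervalIntegrable_ite_pos S.height_cont ht (S.intervalIntegrable_netRate le_rfl ht))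

theorem height_sub (S : IsFIFOServer μ h₀ c a d h) (hs : 0 ≤ s) (ht : 0 ≤ t) :
    h t - h s = ∫ x in s..t, if 0 < h x then (∑ i, a i x) / μ - 1
      else max ((∑ i, a i x) / μ - 1) 0 := by
  have h1 := S.height s hs
  have h2 := S.height t ht
  rw [← intervalIntegral.integral_interval_sub_left (S.intervalIntegrable_height le_rfl ht)
    (S.intervalIntegrable_height le_rfl hs)]
  linarith

/-- Idling can only waste service: in the empty state the height changes at rate `max _ 0`, which
dominates the net rate. -/
theorem le_height_sub (S : IsFIFOServer μ h₀ c a d h) (hs : 0 ≤ s) (hst : s ≤ t) :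
    (∑ i, cum (a i) t - ∑ i, cum (a i) s) / μ - (t - s) ≤ h t - h s := by
  have ht := hs.trans hst
  rw [S.height_sub hs ht, ← S.integral_netRate hs ht]
  refine intervalIntegral.integral_mono_on_of_le_Ioo hst (S.intervalIntegrable_netRate hs ht)
    (S.intervalIntegrable_height hs ht) fun x _ => ?_
  split_ifs
  · exact le_rfl
  · exact le_max_left _ _

theorem height_sub_eq (S : IsFIFOServer μ h₀ c a d h) (hs : 0 ≤ s) (hst : s ≤ t)
    (hp : ∀ x, s < x → x < t → 0 < h x) :
    h t - h s = (∑ i, cum (a i) t - ∑ i, cum (a i) s) / μ - (t - s) := by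
  have ht := hs.trans hst
  rw [S.height_sub hs ht, ← S.integral_netRate hs ht]
  refine intervalIntegral.integral_congr_Ioo_of_le hst fun x hx => ?_
  simp [hp x hx.1 hx.2]

/-- After the last time with nonnegative height the integrand is on its `max _ 0` branch, so the
height could not have gone down. -/
theorem height_nonneg (S : IsFIFOServer μ h₀ c a d h) (h0 : 0 ≤ h₀) (ht : 0 ≤ t) : 0 ≤ h t := by
  by_contra hn
  obtain ⟨r, hr0, hrt, hr, hrp⟩ := exists_last_nonpos (h := fun x => -h x) (s := 0) (t := t)
    (S.continuousOn_Icc le_rfl).neg ht (by simpa [S.height_zero] using h0)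
    (by simpa using not_le.1 hn)
  have e := S.height_sub hr0 ht
  have e2 : 0 ≤ ∫ x in r..t, if 0 < h x then (∑ i, a i x) / μ - 1
      else max ((∑ i, a i x) / μ - 1) 0 := by
    have := intervalIntegral.integral_mono_on_of_le_Ioo (μ := volume) (f := fun _ => (0 : ℝ)) hrt.le
      intervalIntegrable_const (S.intervalIntegrable_height hr0 ht) fun x hx => by
        have := hrp x hx.1 hx.2.le
        rw [if_neg (by linarith)]
        exact le_max_right _ _
    simpa using this
  linarith [not_le.1 hn]

theorem eq_zero_of_arrivals_le (S : IsFIFOServer μ h₀ c a d h) (hμ : 0 < μ) (h0 : 0 ≤ h₀)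
    (hs : 0 ≤ s) (hz : h s = 0)
    (hA : ∀ x y, s ≤ x → x ≤ y → y ≤ t → ∑ i, cum (a i) y - ∑ i, cum (a i) x ≤ μ * (y - x)) :
    ∀ x, s ≤ x → x ≤ t → h x = 0 := by
  intro x hsx hxt
  by_contra hne
  have hpos : 0 < h x := lt_of_le_of_ne (S.height_nonneg h0 (hs.trans hsx)) (Ne.symm hne)
  obtain ⟨r, hr0, hrt, hr, hrp⟩ := exists_last_nonpos (S.continuousOn_Icc (t := x) hs) hsx hz.le hpos
  have e := S.height_sub_eq (hs.trans hr0) hrt.le fun y h1 h2 => hrp y h1 h2.le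
  have e2 := hA r x hr0 hrt.le hxt
  have : (∑ i, cum (a i) x - ∑ i, cum (a i) r) / μ ≤ x - r := by
    rw [div_le_iff₀ hμ]; linarith
  linarith

/-- The exit time of the fluid arriving at time `t` is a nondecreasing function of `t`. -/
theorem exit_mono (S : IsFIFOServer μ h₀ c a d h) (hμ : 0 < μ) (hs : 0 ≤ s) (hst : s ≤ t) :
    s + h s ≤ t + h t := by
  have e := S.le_height_sub hs hst
  have : 0 ≤ (∑ i, cum (a i) t - ∑ i, cum (a i) s) / μ :=
    div_nonneg (sub_nonneg.2 (Finset.sum_le_sum fun i _ => (S.arr i).cum_mono hs hst)) hμ.le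
  linarith

/-- The exit map is continuous, starts at `h₀` and is at least `u` at time `u`. Through this,
questions about departures at time `u` are pulled back to arrivals at an earlier time. -/
theorem exists_exit_eq (S : IsFIFOServer μ h₀ c a d h) (h0 : 0 ≤ h₀) {u : ℝ} (hu : h₀ ≤ u) :
    ∃ t, 0 ≤ t ∧ t ≤ u ∧ t + h t = u := by
  have hu0 := h0.trans hu
  have hc : ContinuousOn (fun t => t + h t) (Icc 0 u) :=
    continuousOn_id.add (S.continuousOn_Icc le_rfl)
  obtain ⟨t, ht, e⟩ := intermediate_value_Icc hu0 hc (show u ∈ Icc _ _ from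
    ⟨by simpa [S.height_zero] using hu, by simpa using S.height_nonneg h0 hu0⟩)
  exact ⟨t, ht.1, ht.2, e⟩

theorem cum_dep_exit (S : IsFIFOServer μ h₀ c a d h) (h0 : 0 ≤ h₀) (i : ι) (ht : 0 ≤ t) :
    cum (d i) (t + h t) = cum (d i) h₀ + cum (a i) t := by
  have e := S.fifo i t ht
  rw [← (S.dep i).cum_sub h0 (add_nonneg ht (S.height_nonneg h0 ht))] at e
  have : cum (a i) t = ∫ s in (0 : ℝ)..t, a i s := rfl
  linarith

theorem cum_dep_sub_le (S : IsFIFOServer μ h₀ c a d h) (hμ : 0 < μ) (h0 : 0 ≤ h₀)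
    (hs : h₀ ≤ s) (hst : s ≤ t) :
    ∑ i, cum (d i) t - ∑ i, cum (d i) s ≤ μ * (t - s) := by
  obtain ⟨x, hx0, -, rfl⟩ := S.exists_exit_eq h0 hs
  obtain ⟨y, hy0, -, rfl⟩ := S.exists_exit_eq h0 (hs.trans hst)
  simp only [S.cum_dep_exit h0 _ hx0, S.cum_dep_exit h0 _ hy0, Finset.sum_add_distrib]
  rcases le_total x y with hxy | hxy
  · have e := S.le_height_sub hx0 hxy
    rw [sub_le_iff_le_add, div_le_iff₀ hμ] at e
    linarith
  · have e := S.exit_mono hμ hy0 hxy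
    have e2 := Finset.sum_le_sum fun i (_ : i ∈ Finset.univ) => (S.arr i).cum_mono hy0 hxy
    have e3 : x + h x = y + h y := le_antisymm hst e
    simp only [e3, sub_self, mul_zero]
    linarith

theorem cum_dep_le_cum_arr (S : IsFIFOServer μ 0 c a d h) (i : ι) (ht : 0 ≤ t) :
    cum (d i) t ≤ cum (a i) t := by
  have e := S.cum_dep_exit le_rfl i ht
  have e2 := (S.dep i).cum_mono ht (le_add_of_nonneg_right (S.height_nonneg le_rfl ht))
  rw [cum_zero] at e
  linarith

/-- The amount of a class that is stored is what has arrived, but not yet departed. -/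
theorem stored_eq (S : IsFIFOServer μ h₀ c a d h) (h0 : 0 ≤ h₀) (i : ι) (ht : 0 ≤ t) :
    stored (d i) h t = cum (d i) h₀ + cum (a i) t - cum (d i) t := by
  rw [← S.cum_dep_exit h0 i ht, (S.dep i).cum_sub ht (add_nonneg ht (S.height_nonneg h0 ht))]
  rfl

/-- A server that is busy on `(0, t)` has worked at full rate. -/
theorem exit_eq_of_busy (S : IsFIFOServer μ h₀ c a d h) (ht : 0 ≤ t)
    (hp : ∀ x, 0 < x → x < t → 0 < h x) : t + h t = h₀ + (∑ i, cum (a i) t) / μ := by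
  have e := S.height_sub_eq le_rfl ht hp
  simp only [cum_zero, Finset.sum_const_zero, S.height_zero] at e
  simp only [sub_zero] at e
  linarith

theorem le_exit (S : IsFIFOServer μ h₀ c a d h) (ht : 0 ≤ t) :
    h₀ + (∑ i, cum (a i) t) / μ ≤ t + h t := by
  have e := S.le_height_sub le_rfl ht
  simp only [cum_zero, Finset.sum_const_zero, S.height_zero] at e
  simp only [sub_zero] at e
  linarith

/-- Everything that arrived and did not depart has to be in the queue. -/
theorem sum_sub_le_height (S : IsFIFOServer μ h₀ c a d h) (hμ : 0 < μ) (h0 : 0 ≤ h₀)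
    (ht : h₀ ≤ t) :
    ∑ i, (cum (d i) h₀ + cum (a i) t - cum (d i) t) ≤ μ * h t := by
  have ht0 := h0.trans ht
  have e := S.cum_dep_sub_le hμ h0 ht (le_add_of_nonneg_right (S.height_nonneg h0 ht0))
  simp only [S.cum_dep_exit h0 _ ht0] at e
  rw [← Finset.sum_sub_distrib] at e
  simpa using e

end IsFIFOServer

/-! ### Recovering rates from cumulative flows -/

/-- `G` is, on nonnegative times, nondecreasing with increments at most `C` per unit of time. -/
structure IsFlow (C : ℝ) (G : ℝ → ℝ) : Prop where
  mono : ∀ s t, 0 ≤ s → s ≤ t → G s ≤ G t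
  sub_le : ∀ s t, 0 ≤ s → s ≤ t → G t - G s ≤ C * (t - s)

/-- The rate of a cumulative flow. -/
noncomputable def rateOf (G : ℝ → ℝ) : ℝ → ℝ := deriv fun t => G (max t 0)

namespace IsFlow

variable {C : ℝ} {G : ℝ → ℝ}

theorem monotone_max (hG : IsFlow C G) : Monotone fun t => G (max t 0) :=
  fun _ _ hst => hG.mono _ _ (le_max_right _ _) (max_le_max_right 0 hst)

theorem lipschitz_max (hC : 0 ≤ C) (hG : IsFlow C G) :
    LipschitzWith ⟨C, hC⟩ fun t => G (max t 0) := by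
  refine LipschitzWith.of_le_add_mul _ fun x y => ?_
  rcases le_total x y with hxy | hxy
  · have := hG.monotone_max hxy
    have h2 : 0 ≤ (⟨C, hC⟩ : NNReal) * dist x y := by positivity
    exact this.trans (le_add_of_nonneg_right h2)
  · have := hG.sub_le _ _ (le_max_right y 0) (max_le_max_right 0 hxy)
    have h3 : max x 0 - max y 0 ≤ x - y := by
      rcases le_total x 0 with h | h <;> rcases le_total y 0 with h' | h' <;>
        simp only [max_eq_left, max_eq_right, h, h'] <;> linarith
    have h4 := mul_le_mul_of_nonneg_left h3 hC
    have h5 : dist x y = x - y := by rw [Real.dist_eq, abs_of_nonneg (by linarith)]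
    rw [h5]
    change G (max x 0) ≤ G (max y 0) + C * (x - y)
    linarith

theorem isRate (hC : 0 ≤ C) (hG : IsFlow C G) : IsRate (rateOf G) where
  nonneg _ _ := hG.monotone_max.deriv_nonneg
  int _ _ :=
    ((hG.lipschitz_max hC).lipschitzOnWith).absolutelyContinuousOnInterval.intervalIntegrable_deriv

/-- The flow extended by `max t 0` is Lipschitz, hence absolutely continuous, so the fundamental
theorem of calculus holds for its almost everywhere derivative. -/
theorem cum_rateOf (hC : 0 ≤ C) (hG : IsFlow C G) {t : ℝ} (ht : 0 ≤ t) :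
    cum (rateOf G) t = G t - G 0 := by
  have := ((hG.lipschitz_max hC).lipschitzOnWith
    (s := uIcc 0 t)).absolutelyContinuousOnInterval.integral_deriv_eq_sub
  simpa [max_eq_left ht, cum, rateOf] using this

end IsFlow

/-- Departures are the arrivals after a change of time by a right inverse `σ` of the exit map `φ`.
The choice of `σ` is immaterial: where `φ` is flat, `hinc` bounds the arrivals by zero. The same
hypothesis makes the time-changed arrivals Lipschitz with constant `μ`, so they have a rate. -/
theorem exists_dep_of_exit {ι : Type} {μ : ℝ} {a : ι → ℝ → ℝ} {φ : ℝ → ℝ} (hμ : 0 ≤ μ)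
    (ha : ∀ i, IsRate (a i))
    (hφ : ContinuousOn φ (Ici 0)) (hφ0 : φ 0 = 0) (hle : ∀ t, 0 ≤ t → t ≤ φ t)
    (hinc : ∀ i x y, 0 ≤ x → x ≤ y → cum (a i) y - cum (a i) x ≤ μ * (φ y - φ x))
    (hmono : ∀ x y, 0 ≤ x → x ≤ y → φ x ≤ φ y) :
    ∃ d : ι → ℝ → ℝ, (∀ i, IsRate (d i)) ∧ ∀ i t, 0 ≤ t → cum (d i) (φ t) = cum (a i) t := by
  have hsel : ∀ u, ∃ t, 0 ≤ t ∧ (0 ≤ u → φ t = u) := by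
    intro u
    by_cases hu : 0 ≤ u
    · obtain ⟨t, ht, e⟩ := intermediate_value_Icc hu (hφ.mono Icc_subset_Ici_self)
        (show u ∈ Icc _ _ from ⟨by rwa [hφ0], hle u hu⟩)
      exact ⟨t, ht.1, fun _ => e⟩
    · exact ⟨0, le_rfl, fun h => absurd h hu⟩
  choose σ hσ0 hσ using hsel
  have hcomp : ∀ i x y, 0 ≤ x → 0 ≤ y → φ x ≤ φ y →
      cum (a i) x ≤ cum (a i) y ∧ cum (a i) y - cum (a i) x ≤ μ * (φ y - φ x) := by
    intro i x y hx hy hxy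
    rcases le_total x y with h | h
    · exact ⟨(ha i).cum_mono hx h, hinc i x y hx h⟩
    · have e1 := hmono y x hy h
      have e2 := hinc i y x hy h
      have e3 := (ha i).cum_mono hy h
      have e4 : φ x = φ y := le_antisymm hxy e1
      rw [e4, sub_self, mul_zero] at e2 ⊢
      constructor <;> linarith
  have hflow : ∀ i, IsFlow μ fun u => cum (a i) (σ u) := fun i =>
    ⟨fun s t hs hst => (hcomp i _ _ (hσ0 s) (hσ0 t)
        (by rwa [hσ s hs, hσ t (hs.trans hst)])).1,
      fun s t hs hst => by
        have := (hcomp i _ _ (hσ0 s) (hσ0 t) (by rwa [hσ s hs, hσ t (hs.trans hst)])).2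
        rwa [hσ s hs, hσ t (hs.trans hst)] at this⟩
  have heq : ∀ i t, 0 ≤ t → cum (a i) (σ (φ t)) = cum (a i) t := by
    intro i t ht
    have h1 := hσ (φ t) (ht.trans (hle t ht))
    exact le_antisymm (hcomp i _ _ (hσ0 _) ht h1.le).1 (hcomp i _ _ ht (hσ0 _) h1.ge).1
  refine ⟨fun i => rateOf fun u => cum (a i) (σ u), fun i => (hflow i).isRate hμ, fun i t ht => ?_⟩
  rw [(hflow i).cum_rateOf hμ (ht.trans (hle t ht)), heq i t ht]
  have := heq i 0 le_rfl
  rw [hφ0, cum_zero] at this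
  rw [this, sub_zero]

/-! ### Construction of a server with one busy period -/

section Construction

variable {ι : Type} [Fintype ι] {μ h₀ T : ℝ} {c a d : ι → ℝ → ℝ}

/-- The height of a server that works at full rate. -/
noncomputable def workload (μ h₀ : ℝ) (a : ι → ℝ → ℝ) (t : ℝ) : ℝ :=
  h₀ + (∑ i, cum (a i) t) / μ - t

theorem continuousOn_workload (ha : ∀ i, IsRate (a i)) :
    ContinuousOn (workload μ h₀ a) (Ici 0) :=
  (continuousOn_const.add ((continuousOn_finsetSum _ fun i _ =>
    (ha i).continuousOn_cum).div_const μ)).sub continuousOn_id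

theorem continuousOn_max_workload (ha : ∀ i, IsRate (a i)) :
    ContinuousOn (fun t => max (workload μ h₀ a t) 0) (Ici 0) :=
  ContinuousOn.sup (continuousOn_workload ha) continuousOn_const

theorem workload_nonpos (hμ : 0 < μ) (hXT : workload μ h₀ a T = 0)
    (hA : ∀ x y, T ≤ x → x ≤ y → ∑ i, cum (a i) y - ∑ i, cum (a i) x ≤ μ * (y - x)) {t : ℝ}
    (ht : T ≤ t) : workload μ h₀ a t ≤ 0 := by
  have e := hA T t le_rfl ht
  have e2 : (∑ i, cum (a i) t - ∑ i, cum (a i) T) / μ ≤ t - T := by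
    rw [div_le_iff₀ hμ]; linarith
  rw [sub_div] at e2
  unfold workload at *
  linarith

/-- A server that is busy during `(0, T)` and does not accumulate fluid afterwards. -/
theorem IsFIFOServer.of_busy_period (hμ : 0 < μ) (h0 : 0 ≤ h₀) (hT : 0 ≤ T)
    (ha : ∀ i, IsRate (a i)) (hd : ∀ i, IsRate (d i))
    (hX : ∀ t, 0 < t → t < T → 0 < workload μ h₀ a t) (hXT : workload μ h₀ a T = 0)
    (hA : ∀ x y, T ≤ x → x ≤ y → ∑ i, cum (a i) y - ∑ i, cum (a i) x ≤ μ * (y - x))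
    (hc : ∀ i, ∀ᵐ t : ℝ, 0 ≤ t → t < h₀ → d i t = c i t)
    (hf : ∀ i t, 0 ≤ t →
      cum (d i) (t + max (workload μ h₀ a t) 0) = cum (d i) h₀ + cum (a i) t) :
    IsFIFOServer μ h₀ c a d fun t => max (workload μ h₀ a t) 0 where
  arr_nonneg i := (ha i).nonneg
  dep_nonneg i := (hd i).nonneg
  arr_integrable i := (ha i).int
  dep_integrable i := (hd i).int
  height_cont := continuousOn_max_workload ha
  initial := hc
  fifo i t ht := by
    have e := hf i t ht
    rw [← (hd i).cum_sub h0 (add_nonneg ht (le_max_right _ _)), e]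
    simp [cum]
  height t ht := by
    have hr := IsRate.sum (u := Finset.univ) fun i _ => ha i
    have hqi : ∀ s, 0 ≤ s → IntervalIntegrable (fun x => (∑ i, a i x) / μ - 1) volume 0 s :=
      fun s hs => ((hr.int s hs).div_const μ).sub intervalIntegrable_const
    have hq : ∀ s, 0 ≤ s → ∫ x in (0 : ℝ)..s, ((∑ i, a i x) / μ - 1) = workload μ h₀ a s - h₀ := by
      intro s hs
      rw [intervalIntegral.integral_sub ((hr.int s hs).div_const μ)
        intervalIntegrable_const, intervalIntegral.integral_div]
      have := IsRate.cum_sum (u := Finset.univ) (fun i _ => ha i) hs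
      simp only [cum] at this
      simp only [workload, cum, this]
      simp; ring
    have key : ∀ s, 0 ≤ s → s ≤ T → (∫ x in (0 : ℝ)..s,
        if 0 < max (workload μ h₀ a x) 0 then (∑ i, a i x) / μ - 1
          else max ((∑ i, a i x) / μ - 1) 0) = workload μ h₀ a s - h₀ := by
      intro s hs hsT
      rw [← hq s hs]
      refine intervalIntegral.integral_congr_Ioo_of_le hs fun x hx => ?_
      simp [hX x hx.1 (hx.2.trans_le hsT)]
    rcases le_or_gt t T with htT | htT
    · rw [key t ht htT]
      have : 0 ≤ workload μ h₀ a t := by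
        rcases eq_or_lt_of_le ht with rfl | h1
        · simpa [workload, cum_zero] using h0
        · rcases eq_or_lt_of_le htT with rfl | h2
          · exact hXT.ge
          · exact (hX t h1 h2).le
      rw [max_eq_left this]; ring
    · have hcm : ContinuousOn (fun t => max (workload μ h₀ a t) 0) (Ici 0) :=
        continuousOn_max_workload ha
      have i1 := intervalIntegrable_ite_pos hcm hT (hqi T hT)
      have i2 := intervalIntegrable_ite_pos hcm ht (hqi t ht)
      rw [← intervalIntegral.integral_add_adjacent_intervals i1 (i1.symm.trans i2),
        key T hT le_rfl, hXT]
      have hzero : (∫ x in T..t, if 0 < max (workload μ h₀ a x) 0 then (∑ i, a i x) / μ - 1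
          else max ((∑ i, a i x) / μ - 1) 0) = 0 := by
        -- The bound on cumulative arrivals yields an almost everywhere bound on the rate, so that
        -- after `T` the idle branch `max _ 0` of the integrand vanishes.
        have hb := hr.ae_le_of_cum_sub_le (C := μ) hT htT.le fun x y hx hxy _ => by
          rw [IsRate.cum_sum (fun i _ => ha i) (hT.trans hx),
            IsRate.cum_sum (fun i _ => ha i) (hT.trans (hx.trans hxy))]
          exact hA x y hx hxy
        refine intervalIntegral.integral_zero_ae ?_
        filter_upwards [hb] with x hx hxI
        rw [uIoc_of_le htT.le] at hxI
        have h1 := workload_nonpos hμ hXT hA hxI.1.le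
        have h2 : (∑ i, a i x) / μ - 1 ≤ 0 := by
          have := hx ⟨hxI.1.le, hxI.2⟩
          rw [sub_nonpos, div_le_iff₀ hμ]; linarith
        rw [max_eq_right h1, if_neg (lt_irrefl _), max_eq_right h2]
      rw [hzero, max_eq_right (workload_nonpos hμ hXT hA htT.le)]
      ring

/-- Existence of departure rates for an initially empty server with a single busy period. -/
theorem IsFIFOServer.exists_of_busy_period (hμ : 0 < μ) (hT : 0 ≤ T)
    (ha : ∀ i, IsRate (a i))
    (hX : ∀ t, 0 < t → t < T → 0 < workload μ 0 a t) (hXT : workload μ 0 a T = 0)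
    (hA : ∀ x y, T ≤ x → x ≤ y → ∑ i, cum (a i) y - ∑ i, cum (a i) x ≤ μ * (y - x)) :
    ∃ d, IsFIFOServer μ 0 c a d fun t => max (workload μ 0 a t) 0 := by
  have hsum : ∀ x y, 0 ≤ x → x ≤ y → ∑ i, cum (a i) x ≤ ∑ i, cum (a i) y := fun x y hx hxy =>
    Finset.sum_le_sum fun i _ => (ha i).cum_mono hx hxy
  have hnn : ∀ t, 0 ≤ t → t ≤ T → 0 ≤ workload μ 0 a t := by
    intro t ht htT
    rcases eq_or_lt_of_le ht with rfl | h1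
    · simp [workload, cum_zero]
    · rcases eq_or_lt_of_le htT with rfl | h2
      · exact hXT.ge
      · exact (hX t h1 h2).le
  have hinc : ∀ x y, 0 ≤ x → x ≤ y → ∑ i, cum (a i) y - ∑ i, cum (a i) x ≤
      μ * ((y + max (workload μ 0 a y) 0) - (x + max (workload μ 0 a x) 0)) := by
    intro x y hx hxy
    rcases le_total x T with h | h
    · rw [max_eq_left (hnn x hx h)]
      have e := le_max_left (workload μ 0 a y) 0
      have : (∑ i, cum (a i) y) / μ - (∑ i, cum (a i) x) / μ ≤
          (y + max (workload μ 0 a y) 0) - (x + workload μ 0 a x) := by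
        simp only [workload] at e ⊢; linarith
      rw [← sub_div, div_le_iff₀ hμ] at this
      linarith
    · rw [max_eq_right (workload_nonpos hμ hXT hA h),
        max_eq_right (workload_nonpos hμ hXT hA (h.trans hxy))]
      simpa using hA x y h hxy
  obtain ⟨d, hd, hf⟩ := exists_dep_of_exit (φ := fun t => t + max (workload μ 0 a t) 0) hμ.le ha
    (continuousOn_id.add (continuousOn_max_workload ha))
    (by simp [workload, cum_zero]) (fun t _ => le_add_of_nonneg_right (le_max_right _ _))
    (fun i x y hx hxy => by
      refine le_trans ?_ (hinc x y hx hxy)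
      rw [← Finset.sum_sub_distrib]
      exact Finset.single_le_sum (f := fun i => cum (a i) y - cum (a i) x)
        (fun j _ => sub_nonneg.2 ((ha j).cum_mono hx hxy)) (Finset.mem_univ i))
    (fun x y hx hxy => by
      have e := hinc x y hx hxy
      have e2 := hsum x y hx hxy
      have e3 : 0 ≤ (y + max (workload μ 0 a y) 0) - (x + max (workload μ 0 a x) 0) :=
        nonneg_of_mul_nonneg_right (by linarith) hμ
      linarith)
  exact ⟨d, .of_busy_period hμ le_rfl hT ha hd hX hXT hA
    (fun i => Filter.Eventually.of_forall fun t h1 h2 => absurd h1 (not_le.2 h2))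
    fun i t ht => by rw [hf i t ht, cum_zero, zero_add]⟩

end Construction

/-! ### Tuning the maximal rate and the damping -/

/-- The rate `g` of a session that becomes blocked at time `0` when it is injecting at rate `ε`,
tuned to the gadget with `K` big loops: on the way through `Q₄`, the tip of session `H` takes until
time `K / (1 - 2 * ε / 5)` for its `K`-th visit. -/
structure IsTuned (K : ℕ) (ε : ℝ) (g : ℝ → ℝ) : Prop where
  twenty_le : 20 ≤ K
  lower : 5 / (3 * (K : ℝ)) < ε
  upper : ε < 9 / (5 * (K : ℝ))
  start : g 0 = ε
  anti : AntitoneOn g (Ici 0)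
  cont : ContinuousOn g (Ici 0)
  nonneg : ∀ t, 0 ≤ t → 0 ≤ g t
  large : ∀ t, 0 ≤ t → t ≤ K / (1 - 2 * ε / 5) → 9 / 10 * ε ≤ g t
  to_zero : ∃ t₀, 0 < t₀ ∧ ∀ t, t₀ ≤ t → g t = 0
  tuned : cum g ((K - 1) / (1 - 2 * ε / 5)) + (K - 1) = K / (1 - 2 * ε / 5)

namespace IsFlowDecrease

variable {S : Set ℝ} {f : ℝ → ℝ → ℝ → ℝ} {δ ε t : ℝ}

theorem nonneg (hf : IsFlowDecrease S f) (hδ : δ ∈ S) (hε : 0 ≤ ε) (ht : 0 ≤ t) : 0 ≤ f δ ε t := by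
  obtain ⟨t₀, h0, hz⟩ := hf.to_zero δ hδ ε hε
  rw [← hz (max t t₀) (le_max_right _ _)]
  exact hf.anti_time δ hδ ε hε ht (ht.trans (le_max_left t t₀)) (le_max_left _ _)

theorem le_start (hf : IsFlowDecrease S f) (hδ : δ ∈ S) (hε : 0 ≤ ε) (ht : 0 ≤ t) :
    f δ ε t ≤ ε := by
  conv_rhs => rw [← hf.start δ hδ ε hε]
  exact hf.anti_time δ hδ ε hε (mem_Ici.2 le_rfl) ht ht

theorem zero_rate (hf : IsFlowDecrease S f) (hδ : δ ∈ S) (ht : 0 ≤ t) : f δ 0 t = 0 :=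
  le_antisymm (hf.le_start hδ le_rfl ht) (hf.nonneg hδ le_rfl ht)

theorem continuousOn_time (hf : IsFlowDecrease S f) (hδ : δ ∈ S) (hε : 0 ≤ ε) :
    ContinuousOn (f δ ε) (Ici 0) :=
  (hf.cont δ hδ).comp (continuousOn_const.prodMk continuousOn_id) fun _ hx => ⟨hε, hx⟩

theorem isRate (hf : IsFlowDecrease S f) (hδ : δ ∈ S) (hε : 0 ≤ ε) : IsRate (f δ ε) :=
  .of_continuousOn (hf.continuousOn_time hδ hε) fun _ => hf.nonneg hδ hε

theorem continuousOn_cum (hf : IsFlowDecrease S f) (hδ : δ ∈ S) {s : ℝ → ℝ} {I : Set ℝ}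
    (hs : ContinuousOn s I) (hs0 : ∀ x ∈ I, 0 ≤ s x) (hI : ∀ x ∈ I, 0 ≤ x) :
    ContinuousOn (fun ε => cum (f δ ε) (s ε)) I := by
  rw [continuousOn_iff_continuous_domRestrict] at hs ⊢
  have hc : Continuous (Function.uncurry fun (x : I) t => f δ (max (x : ℝ) 0) (max t 0)) :=
    (hf.cont δ hδ).comp_continuous (f := fun p : I × ℝ => (max (p.1 : ℝ) 0, max p.2 0))
      (by fun_prop) fun p =>
        ⟨le_max_right (p.1 : ℝ) 0, le_max_right p.2 0⟩
  have := intervalIntegral.continuous_parametric_intervalIntegral_of_continuous (a₀ := 0)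
    (μ := volume) hc hs
  refine this.congr fun x => ?_
  refine intervalIntegral.integral_congr fun t ht => ?_
  have h0 : 0 ≤ s x := hs0 x x.2
  rw [domRestrict_apply, uIcc_of_le h0] at ht
  simp only [max_eq_left ht.1, max_eq_left (hI x x.2)]

/-- Damping and maximal rate can be chosen so that the session is tuned to the gadget. -/
theorem exists_isTuned (hf : IsFlowDecrease S f) {K : ℕ} (hK : 20 ≤ K) :
    ∃ ε δ, δ ∈ S ∧ IsTuned K ε (f δ ε) := by
  have hK' : (20 : ℝ) ≤ K := by exact_mod_cast hK
  have hK0 : (0 : ℝ) < K := by linarith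
  obtain ⟨k, hk⟩ : ∃ k : ℝ, k = 1 / K := ⟨_, rfl⟩
  have hkK : k * K = 1 := by rw [hk]; field_simp
  have hk0 : 0 < k := by rw [hk]; positivity
  have hk20 : k ≤ 1 / 20 := by rw [hk]; exact one_div_le_one_div_of_le (by norm_num) hK'
  have hlo : 5 / (3 * (K : ℝ)) = 5 / 3 * k := by rw [hk]; field_simp
  have hhi : 9 / (5 * (K : ℝ)) = 9 / 5 * k := by rw [hk]; field_simp
  -- The endpoints 5/(3K) and 9/(5K) bracket the tuned rate. At the lower one, the tip is too early
  -- by at least (1/K)/(1 - 2ε/5) even if the rate never decays; at the upper one it is too late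
  -- provided at most one percent of the rate is lost. The time 2K exceeds K/(1 - 2ε/5) for all
  -- rates considered.
  obtain ⟨δ₁, h1S, h1⟩ := (hf.damping (99 / 100 * (5 / 3 * k)) (5 / 3 * k) (2 * K) (by positivity)
    (by linarith) (by positivity)).1
  obtain ⟨δ₂, h2S, h2⟩ := (hf.damping (99 / 100 * (9 / 5 * k)) (9 / 5 * k) (2 * K) (by positivity)
    (by linarith) (by positivity)).1
  obtain ⟨δ, hδ, hd1, hd2⟩ : ∃ δ ∈ S, 99 / 100 * (5 / 3 * k) < f δ (5 / 3 * k) (2 * K) ∧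
      99 / 100 * (9 / 5 * k) < f δ (9 / 5 * k) (2 * K) := by
    -- The smaller damping parameter serves both endpoints, since `f` is nonincreasing in it.
    rcases le_total δ₁ δ₂ with h | h
    · exact ⟨δ₁, h1S, h1, h2.trans_le
        (hf.anti_damping _ (by positivity) _ (by positivity) h1S h2S h)⟩
    · exact ⟨δ₂, h2S, h1.trans_le
        (hf.anti_damping _ (by positivity) _ (by positivity) h2S h1S h), h2⟩
  have hm : ∀ x ∈ Icc (5 / 3 * k) (9 / 5 * k), 1 / 2 < 1 - 2 * x / 5 := fun x hx => by
    linarith [hx.2]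
  have hpos : ∀ x ∈ Icc (5 / 3 * k) (9 / 5 * k), 0 < x := fun x hx => by linarith [hx.1]
  have hT : ∀ x ∈ Icc (5 / 3 * k) (9 / 5 * k), K / (1 - 2 * x / 5) ≤ 2 * K := fun x hx => by
    rw [div_le_iff₀ (by linarith [hm x hx])]; nlinarith [hm x hx]
  have hs0 : ∀ x ∈ Icc (5 / 3 * k) (9 / 5 * k), 0 ≤ ((K : ℝ) - 1) / (1 - 2 * x / 5) := fun x hx =>
    div_nonneg (by linarith) (by linarith [hm x hx])
  have hsT : ∀ x ∈ Icc (5 / 3 * k) (9 / 5 * k),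
      ((K : ℝ) - 1) / (1 - 2 * x / 5) ≤ K / (1 - 2 * x / 5) := fun x hx =>
    div_le_div_of_nonneg_right (by linarith) (by linarith [hm x hx])
  have hsc : ContinuousOn (fun x : ℝ => ((K : ℝ) - 1) / (1 - 2 * x / 5))
      (Icc (5 / 3 * k) (9 / 5 * k)) :=
    continuousOn_const.div (by fun_prop) fun x hx => by linarith [hm x hx]
  have hcont : ContinuousOn (fun x => cum (f δ x) ((K - 1) / (1 - 2 * x / 5)) + (K - 1)
      - K / (1 - 2 * x / 5)) (Icc (5 / 3 * k) (9 / 5 * k)) :=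
    ((hf.continuousOn_cum hδ hsc hs0 fun x hx => (hpos x hx).le).add continuousOn_const).sub
      (continuousOn_const.div (by fun_prop) fun x hx => by linarith [hm x hx])
  have hnum : ∀ x m : ℝ, m ≠ 0 → x * ((K - 1) / m) + (K - 1) - K / m =
      (x * (K - 1) + (K - 1) * m - K) / m := fun x m hm => by field_simp
  have hlt : 5 / 3 * k < 9 / 5 * k := by linarith
  have el : cum (f δ (5 / 3 * k)) ((K - 1) / (1 - 2 * (5 / 3 * k) / 5)) + (K - 1)
      - K / (1 - 2 * (5 / 3 * k) / 5) < 0 := by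
    have hx : 5 / 3 * k ∈ Icc (5 / 3 * k) (9 / 5 * k) := left_mem_Icc.2 hlt.le
    have := (hf.isRate hδ (hpos _ hx).le).cum_sub_le le_rfl (hs0 _ hx) fun t ht =>
      hf.le_start hδ (hpos _ hx).le ht.1.le
    rw [cum_zero] at this
    have hmx := hm _ hx
    have e : 5 / 3 * k * ((K - 1) / (1 - 2 * (5 / 3 * k) / 5)) + (K - 1)
      - K / (1 - 2 * (5 / 3 * k) / 5) = (-k) / (1 - 2 * (5 / 3 * k) / 5) := by
      rw [hnum _ _ (by linarith : 1 - 2 * (5 / 3 * k) / 5 ≠ 0)]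
      congr 1
      linear_combination hkK
    have e2 : (-k) / (1 - 2 * (5 / 3 * k) / 5) < 0 := div_neg_of_neg_of_pos (by linarith) (by linarith)
    linarith
  have eh : 0 < cum (f δ (9 / 5 * k)) ((K - 1) / (1 - 2 * (9 / 5 * k) / 5)) + (K - 1)
      - K / (1 - 2 * (9 / 5 * k) / 5) := by
    have hx : 9 / 5 * k ∈ Icc (5 / 3 * k) (9 / 5 * k) := right_mem_Icc.2 hlt.le
    have := (hf.isRate hδ (hpos _ hx).le).le_cum_sub (C := 99 / 100 * (9 / 5 * k)) le_rfl (hs0 _ hx)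
      fun t ht => hd2.le.trans (hf.anti_time δ hδ _ (hpos _ hx).le ht.1.le
        (by positivity : (0 : ℝ) ≤ 2 * K) (ht.2.le.trans ((hsT _ hx).trans (hT _ hx))))
    rw [cum_zero] at this
    have hmx := hm _ hx
    have e : 99 / 100 * (9 / 5 * k) * ((K - 1) / (1 - 2 * (9 / 5 * k) / 5)) + (K - 1)
      - K / (1 - 2 * (9 / 5 * k) / 5) = (31 / 500 - 531 / 500 * k) / (1 - 2 * (9 / 5 * k) / 5) := by
      rw [hnum _ _ (by linarith : 1 - 2 * (9 / 5 * k) / 5 ≠ 0)]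
      congr 1
      linear_combination 531 / 500 * hkK
    have e2 : 0 < (31 / 500 - 531 / 500 * k) / (1 - 2 * (9 / 5 * k) / 5) :=
      div_pos (by linarith) (by linarith)
    linarith
  obtain ⟨ε, hε, e0⟩ := intermediate_value_Ioo hlt.le hcont ⟨el, eh⟩
  have hεI := Ioo_subset_Icc_self hε
  have hε0 := (hpos ε hεI).le
  refine ⟨ε, δ, hδ, hK, by rw [hlo]; exact hε.1, by rw [hhi]; exact hε.2, hf.start δ hδ ε hε0,
    hf.anti_time δ hδ ε hε0, hf.continuousOn_time hδ hε0, fun t => hf.nonneg hδ hε0, ?_,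
    hf.to_zero δ hδ ε hε0, by simp only at e0; linarith⟩
  intro t ht htT
  -- At time 2K the rate is still at least that of the session started at 5/(3K), and 99/100 · 5/3
  -- exceeds 9/10 · 9/5; this is the origin of the factor 9/10.
  have a1 := hf.anti_time δ hδ ε hε0 ht (by positivity : (0 : ℝ) ≤ 2 * K) (htT.trans (hT ε hεI))
  have a2 := hf.mono_rate δ hδ (2 * K) (by positivity) (by positivity : (0 : ℝ) ≤ 5 / 3 * k)
    (hε0 : (0 : ℝ) ≤ ε) hε.1.le
  simp only at a1 a2
  linarith [hε.2]

end IsFlowDecrease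

/-! ### The departure profile of session H from Q₄ -/

/-- What matters about the cumulative departures `E` of session `H` from `Q₄` during the big loops,
and about the time `T₁` at which `Q₁` becomes empty. -/
structure IsTipProfile (K : ℕ) (ε : ℝ) (E : ℝ → ℝ) (T₁ : ℝ) : Prop where
  zero : E 0 = 0
  last : E (K / (1 - 2 * ε / 5)) = K - 1
  sub_le : ∀ s t, 0 ≤ s → s ≤ t → t ≤ K / (1 - 2 * ε / 5) →
    (1 + ε / 2) * (E t - E s) ≤ (1 - 2 * ε / 5) * (t - s)
  le_sub : ∀ s t, 0 ≤ s → s ≤ t → t ≤ K / (1 - 2 * ε / 5) →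
    (1 - 2 * ε / 5) * (t - s) ≤ (1 + 3 * ε / 5) * (E t - E s)
  lt_one_add : ∀ t, 0 ≤ t → t < K / (1 - 2 * ε / 5) → (1 - 2 * ε / 5) * t < 1 + E t
  one_le : 1 ≤ T₁
  lt_last : T₁ < K / (1 - 2 * ε / 5)
  before : ∀ t, 0 ≤ t → t < T₁ → t < 1 + E t
  turn : 1 + E T₁ = T₁
  lower : 1 ≤ ε * T₁
  upper : ε * T₁ ≤ 10 / 9 + ε

namespace IsTuned

variable {K : ℕ} {ε : ℝ} {g : ℝ → ℝ} {s t : ℝ}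

theorem twenty_le_cast (h : IsTuned K ε g) : (20 : ℝ) ≤ K := by exact_mod_cast h.twenty_le

theorem mul_bounds (h : IsTuned K ε g) : 5 / 3 < K * ε ∧ K * ε < 9 / 5 := by
  have hK := h.twenty_le_cast
  have h1 := h.lower
  have h2 := h.upper
  rw [div_lt_iff₀ (by linarith)] at h1
  rw [lt_div_iff₀ (by linarith)] at h2
  constructor <;> linarith

theorem pos (h : IsTuned K ε g) : 0 < ε := by
  have hK := h.twenty_le_cast
  exact lt_trans (by positivity) h.lower

theorem lt (h : IsTuned K ε g) : ε < 9 / 100 := by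
  have hK := h.twenty_le_cast
  have := h.mul_bounds.2
  have := h.pos
  nlinarith

theorem isRate (h : IsTuned K ε g) : IsRate g := .of_continuousOn h.cont h.nonneg

theorem le_max (h : IsTuned K ε g) (ht : 0 ≤ t) : g t ≤ ε := by
  rw [← h.start]; exact h.anti (mem_Ici.2 le_rfl) ht ht

theorem cum_le (h : IsTuned K ε g) (hs : 0 ≤ s) (hst : s ≤ t) :
    cum g t - cum g s ≤ ε * (t - s) :=
  h.isRate.cum_sub_le hs hst fun _ hx => h.le_max (hs.trans hx.1.le)

theorem le_cum (h : IsTuned K ε g) (hs : 0 ≤ s) (hst : s ≤ t) (ht : t ≤ K / (1 - 2 * ε / 5)) :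
    9 / 10 * ε * (t - s) ≤ cum g t - cum g s :=
  h.isRate.le_cum_sub hs hst fun _ hx => h.large _ (hs.trans hx.1.le) (hx.2.le.trans ht)

theorem service_pos (h : IsTuned K ε g) : 0 < 1 - 2 * ε / 5 := by linarith [h.lt]

theorem entry_nonneg (h : IsTuned K ε g) : 0 ≤ ((K : ℝ) - 1) / (1 - 2 * ε / 5) :=
  div_nonneg (by linarith [h.twenty_le_cast]) h.service_pos.le

theorem entry_le (h : IsTuned K ε g) : ((K : ℝ) - 1) / (1 - 2 * ε / 5) ≤ K / (1 - 2 * ε / 5) :=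
  div_le_div_of_nonneg_right (by linarith) h.service_pos.le

/-- The cumulative departures of session `H` from `Q₄`, as a function of time: fluid that arrives at
time `x` departs at time `(1 - 2 * ε / 5) * x + cum g x`. -/
theorem exists_tipProfile (h : IsTuned K ε g) : ∃ (E : ℝ → ℝ) (T₁ : ℝ), IsTipProfile K ε E T₁ ∧
    ∀ x, 0 ≤ x → x ≤ (K - 1) / (1 - 2 * ε / 5) →
      E ((1 - 2 * ε / 5) * x + cum g x) = (1 - 2 * ε / 5) * x := by
  have hK := h.twenty_le_cast
  have hε := h.pos
  have hε' := h.lt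
  have hs0 := h.entry_nonneg
  have hsT := h.entry_le
  have hm := h.service_pos
  obtain ⟨m, hmdef⟩ : ∃ m, m = 1 - 2 * ε / 5 := ⟨_, rfl⟩
  have htuned := h.tuned
  have hle := @IsTuned.le_cum K ε g
  simp only [← hmdef] at hs0 hsT hm htuned hle
  obtain ⟨s₀, hs0def⟩ : ∃ s, s = ((K : ℝ) - 1) / m := ⟨_, rfl⟩
  obtain ⟨T, hTdef⟩ : ∃ s, s = (K : ℝ) / m := ⟨_, rfl⟩
  have es0 : m * s₀ = K - 1 := by rw [hs0def]; field_simp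
  have eT : m * T = K := by rw [hTdef]; field_simp
  simp only [← hs0def, ← hTdef] at hs0 hsT htuned hle
  let φ : ℝ → ℝ := fun x => m * x + cum g x
  have hφ0 : φ 0 = 0 := by simp [φ, cum_zero]
  have hφs : φ s₀ = T := by simp only [φ]; linarith
  -- The slope of `φ` is m + g with m = 1 - 2ε/5 and 9ε/10 ≤ g ≤ ε. The two resulting constants 1 +
  -- ε/2 and 1 + 3ε/5 become, by inversion, the bounds on the increments of the profile.
  have hlow : ∀ x y, 0 ≤ x → x ≤ y → y ≤ s₀ → (1 + ε / 2) * (y - x) ≤ φ y - φ x := by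
    intro x y hx hxy hy
    have := hle h hx hxy (hy.trans hsT)
    simp only [φ]
    rw [hmdef]
    linarith
  have hupp : ∀ x y, 0 ≤ x → x ≤ y → φ y - φ x ≤ (1 + 3 * ε / 5) * (y - x) := by
    intro x y hx hxy
    have := h.cum_le hx hxy
    simp only [φ]
    rw [hmdef]
    linarith
  have hinv : ∀ t, 0 ≤ t → t ≤ T → ∃ x, (0 ≤ x ∧ x ≤ s₀) ∧ φ x = t := by
    intro t ht htT
    have hc : ContinuousOn φ (Icc 0 s₀) :=
      (continuousOn_const.mul continuousOn_id).add
        (h.isRate.continuousOn_cum.mono Icc_subset_Ici_self)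
    obtain ⟨x, hx, e⟩ := intermediate_value_Icc hs0 hc
      (show t ∈ Icc _ _ by rw [hφ0, hφs]; exact ⟨ht, htT⟩)
    exact ⟨x, hx, e⟩
  let θ : ℝ → ℝ := Function.invFunOn φ (Icc 0 s₀)
  have hθ : ∀ x, 0 ≤ x → x ≤ s₀ → θ (φ x) = x := by
    intro x hx hxs
    have hi : InjOn φ (Icc 0 s₀) := by
      intro a ha b hb hab
      rcases le_total a b with h1 | h1
      · have := hlow a b ha.1 h1 hb.2
        rw [hab, sub_self] at this
        nlinarith
      · have := hlow b a hb.1 h1 ha.2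
        rw [hab, sub_self] at this
        nlinarith
    exact hi.leftInvOn_invFunOn ⟨hx, hxs⟩
  have horder : ∀ x y, 0 ≤ x → y ≤ s₀ → 0 ≤ y → x ≤ s₀ → φ x ≤ φ y → x ≤ y := by
    intro x y hx hy hy0 hxs hxy
    by_contra hn
    have := hlow y x hy0 (not_le.1 hn).le hxs
    have : 0 < (1 + ε / 2) * (x - y) := mul_pos (by linarith) (by linarith)
    linarith
  -- Fluid entering Q₄ at `x₁` has exactly one unit of S-fluid ahead of it. When it leaves, at `φ
  -- x₁`, the H-departures amount to `φ x₁ - 1`; with its initial unit, Q₁ has then received just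
  -- what it could serve, so it becomes empty.
  obtain ⟨x₁, hx1, e1⟩ : ∃ x ∈ Icc 0 s₀, cum g x = 1 := by
    have := hle h le_rfl hs0 hsT
    rw [cum_zero] at this
    have h2 : s₀ ≥ K - 1 := by nlinarith
    have h3 := h.mul_bounds.1
    obtain ⟨x, hx, e⟩ := intermediate_value_Icc hs0
      (h.isRate.continuousOn_cum.mono Icc_subset_Ici_self)
      (show (1 : ℝ) ∈ Icc _ _ by rw [cum_zero]; exact ⟨by norm_num, by nlinarith⟩)
    exact ⟨x, hx, e⟩
  have hx1pos : 0 ≤ x₁ := hx1.1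
  have hx1ε : 1 ≤ ε * x₁ := by
    have := h.cum_le le_rfl hx1.1
    rw [cum_zero] at this
    linarith
  have hx1ε' : ε * x₁ ≤ 10 / 9 := by
    have := hle h le_rfl hx1.1 (hx1.2.trans hsT)
    rw [cum_zero] at this
    linarith
  have hx1s : x₁ < s₀ := by
    have h2 : s₀ ≥ K - 1 := by nlinarith
    have h3 := h.mul_bounds.1
    by_contra hn
    nlinarith
  have hφx1 : φ x₁ = m * x₁ + 1 := by simp only [φ]; rw [e1]
  refine ⟨fun t => m * θ t, m * x₁ + 1, ?_, fun x hx hxs => by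
    rw [← hmdef] at hxs ⊢
    rw [← hs0def] at hxs
    exact congrArg (m * ·) (hθ x hx hxs)⟩
  have hmx : 0 ≤ m * x₁ := mul_nonneg hm.le hx1pos
  refine ⟨?_, ?_, ?_, ?_, ?_, ?_, ?_, ?_, ?_, ?_, ?_⟩
  · have := hθ 0 le_rfl hs0
    rw [hφ0] at this
    simp only [this, mul_zero]
  · have := hθ s₀ hs0 le_rfl
    rw [hφs] at this
    rw [← hmdef, ← hTdef, this, es0]
  · intro s t hs hst ht
    rw [← hmdef] at ht ⊢
    rw [← hTdef] at ht
    obtain ⟨x, hx, rfl⟩ := hinv s hs (hst.trans ht)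
    obtain ⟨y, hy, rfl⟩ := hinv t (hs.trans hst) ht
    rw [hθ x hx.1 hx.2, hθ y hy.1 hy.2]
    have := hlow x y hx.1 (horder x y hx.1 hy.2 hy.1 hx.2 hst) hy.2
    have := mul_le_mul_of_nonneg_left this hm.le
    linarith
  · intro s t hs hst ht
    rw [← hmdef] at ht ⊢
    rw [← hTdef] at ht
    obtain ⟨x, hx, rfl⟩ := hinv s hs (hst.trans ht)
    obtain ⟨y, hy, rfl⟩ := hinv t (hs.trans hst) ht
    rw [hθ x hx.1 hx.2, hθ y hy.1 hy.2]
    have := hupp x y hx.1 (horder x y hx.1 hy.2 hy.1 hx.2 hst)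
    have := mul_le_mul_of_nonneg_left this hm.le
    linarith
  · intro t ht htT
    rw [← hmdef] at htT ⊢
    rw [← hTdef] at htT
    obtain ⟨x, hx, rfl⟩ := hinv t ht htT.le
    rw [hθ x hx.1 hx.2]
    have hxs : x < s₀ := lt_of_le_of_ne hx.2 (by rintro rfl; linarith)
    have := hlow x s₀ hx.1 hx.2 le_rfl
    have h2 : m * ((1 + ε / 2) * (s₀ - x)) ≤ m * (T - φ x) := by
      rw [← hφs]; exact mul_le_mul_of_nonneg_left this hm.le
    have h3 : 0 < m * (s₀ - x) := mul_pos hm (by linarith)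
    nlinarith
  · linarith
  · rw [← hmdef, ← hTdef, ← hφx1, ← hφs]
    have := hlow x₁ s₀ hx1.1 hx1.2 le_rfl
    have h2 : 0 < (1 + ε / 2) * (s₀ - x₁) := mul_pos (by linarith) (by linarith)
    linarith
  · intro t ht htT
    have hφle : φ x₁ ≤ T := by
      rw [← hφs]
      have := hlow x₁ s₀ hx1.1 hx1.2 le_rfl
      have h2 : 0 < (1 + ε / 2) * (s₀ - x₁) := mul_pos (by linarith) (by linarith)
      linarith
    rw [← hφx1] at htT
    obtain ⟨x, hx, rfl⟩ := hinv t ht (htT.le.trans hφle)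
    rw [hθ x hx.1 hx.2]
    have hxx : x < x₁ := by
      by_contra hn
      have := hlow x₁ x hx1pos (not_lt.1 hn) hx.2
      have : 0 ≤ (1 + ε / 2) * (x - x₁) := mul_nonneg (by linarith) (by linarith)
      linarith
    have h1 := hle h hx.1 hxx.le (hx1.2.trans hsT)
    have h2 : 0 < 9 / 10 * ε * (x₁ - x) := mul_pos (by linarith) (by linarith)
    simp only [φ]
    linarith
  · rw [← hφx1, hθ x₁ hx1.1 hx1.2, hφx1]; ring
  · have : ε * (m * x₁ + 1) = m * (ε * x₁) + ε := by ring
    rw [this]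
    nlinarith
  · have : ε * (m * x₁ + 1) = m * (ε * x₁) + ε := by ring
    rw [this]
    nlinarith

end IsTuned

/-! ### Consequences of the profile for Q₁, Q₂ and Q₃ -/

/-- The cumulative departures of session `H` from `Q₁`, if those from `Q₄` are given by `E`. -/
noncomputable def tipDep (E : ℝ → ℝ) (t : ℝ) : ℝ := min t (1 + E t)

/-- The time at which fluid that arrives at time `t` leaves `Q₂`, as long as `Q₂` is busy. -/
noncomputable def tipExit (μ : ℝ) (E V : ℝ → ℝ) (t : ℝ) : ℝ := (tipDep E t + V t) / μ

namespace IsTipProfile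

variable {K : ℕ} {ε T₁ μ : ℝ} {E V : ℝ → ℝ} {s t : ℝ}

theorem mono (h : IsTipProfile K ε E T₁) (h0 : 0 < ε) (h1 : ε < 9 / 100) (hs : 0 ≤ s) (hst : s ≤ t)
    (ht : t ≤ K / (1 - 2 * ε / 5)) : E s ≤ E t := by
  have := h.le_sub s t hs hst ht
  have h2 : 0 ≤ (1 - 2 * ε / 5) * (t - s) := mul_nonneg (by linarith) (by linarith)
  nlinarith

theorem sub_le_service (h : IsTipProfile K ε E T₁) (h0 : 0 < ε) (h1 : ε < 9 / 100)
    (hs : 0 ≤ s) (hst : s ≤ t) (ht : t ≤ K / (1 - 2 * ε / 5)) :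
    E t - E s ≤ (1 - 2 * ε / 5) * (t - s) := by
  have := h.sub_le s t hs hst ht
  have := h.mono h0 h1 hs hst ht
  nlinarith

theorem sub_lt_service (h : IsTipProfile K ε E T₁) (h0 : 0 < ε) (h1 : ε < 9 / 100)
    (hs : 0 ≤ s) (hst : s < t) (ht : t ≤ K / (1 - 2 * ε / 5)) :
    E t - E s < (1 - 2 * ε / 5) * (t - s) := by
  have h2 := h.sub_le s t hs hst.le ht
  have h3 := h.mono h0 h1 hs hst.le ht
  have h4 : 0 < (1 - 2 * ε / 5) * (t - s) := mul_pos (by linarith) (by linarith)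
  nlinarith

theorem sub_le_self (h : IsTipProfile K ε E T₁) (h0 : 0 < ε) (h1 : ε < 9 / 100)
    (hs : 0 ≤ s) (hst : s ≤ t) (ht : t ≤ K / (1 - 2 * ε / 5)) : E t - E s ≤ t - s := by
  have := h.sub_le_service h0 h1 hs hst ht
  nlinarith

theorem after (h : IsTipProfile K ε E T₁) (h0 : 0 < ε) (h1 : ε < 9 / 100) (ht : T₁ ≤ t)
    (ht' : t ≤ K / (1 - 2 * ε / 5)) : 1 + E t ≤ t := by
  have := h.sub_le_self h0 h1 (by linarith [h.one_le]) ht ht'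
  linarith [h.turn]

theorem tipDep_eq_self (h : IsTipProfile K ε E T₁) (ht : 0 ≤ t) (htT : t ≤ T₁) :
    tipDep E t = t := by
  rcases eq_or_lt_of_le htT with rfl | h1
  · exact min_eq_left h.turn.ge
  · exact min_eq_left (h.before t ht h1).le

theorem tipDep_eq (h : IsTipProfile K ε E T₁) (h0 : 0 < ε) (h1 : ε < 9 / 100) (ht : T₁ ≤ t)
    (ht' : t ≤ K / (1 - 2 * ε / 5)) : tipDep E t = 1 + E t :=
  min_eq_right (h.after h0 h1 ht ht')

theorem tipDep_zero (h : IsTipProfile K ε E T₁) : tipDep E 0 = 0 := by simp [tipDep, h.zero]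

theorem tipDep_last (h : IsTipProfile K ε E T₁) (h0 : 0 < ε) (h1 : ε < 9 / 100) :
    tipDep E (K / (1 - 2 * ε / 5)) = K := by
  rw [h.tipDep_eq h0 h1 h.lt_last.le le_rfl, h.last]; ring

theorem lt_tipDep (h : IsTipProfile K ε E T₁) (h0 : 0 < ε) (ht : 0 < t)
    (ht' : t < K / (1 - 2 * ε / 5)) : (1 - 2 * ε / 5) * t < tipDep E t :=
  lt_min (by nlinarith) (h.lt_one_add t ht.le ht')

theorem backlog_strictMonoOn (h : IsTipProfile K ε E T₁) (hV : IsFlow (ε ^ 2) V) (hμ : 0 < μ)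
    (hμ1 : μ < 1) (hs : 0 ≤ s) (hst : s < t) (ht : t ≤ T₁) :
    tipExit μ E V s - s < tipExit μ E V t - t := by
  have h2 := hV.mono s t hs hst.le
  have : t - s < tipExit μ E V t - tipExit μ E V s := by
    rw [tipExit, tipExit, ← sub_div, lt_div_iff₀ hμ, h.tipDep_eq_self hs (hst.le.trans ht),
      h.tipDep_eq_self (hs.trans hst.le) ht]
    nlinarith
  linarith

/-- After `T₁` the output of Q₁ grows at rate at most 1 - 2ε/5, and the vertical sessions add at
most ε²; together this is less than `μ`. -/
theorem backlog_strictAntiOn (h : IsTipProfile K ε E T₁) (h0 : 0 < ε) (h1 : ε < 9 / 100)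
    (hV : IsFlow (ε ^ 2) V) (hμ : 1 - 2 * ε / 5 + ε ^ 2 < μ) (hs : T₁ ≤ s) (hst : s < t)
    (ht : t ≤ K / (1 - 2 * ε / 5)) :
    tipExit μ E V t - t < tipExit μ E V s - s := by
  have hs0 : 0 ≤ s := by linarith [h.one_le]
  have h2 := hV.sub_le s t hs0 hst.le
  have h3 := h.sub_le_service h0 h1 hs0 hst.le ht
  have hμ0 : 0 < μ := by nlinarith
  have : tipExit μ E V t - tipExit μ E V s < t - s := by
    rw [tipExit, tipExit, ← sub_div, div_lt_iff₀ hμ0, h.tipDep_eq h0 h1 hs (hst.le.trans ht),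
      h.tipDep_eq h0 h1 (hs.trans hst.le) ht]
    have : (1 - 2 * ε / 5 + ε ^ 2) * (t - s) < μ * (t - s) :=
      mul_lt_mul_of_pos_right hμ (by linarith)
    linarith
  linarith

theorem backlog_zero (h : IsTipProfile K ε E T₁) (hV0 : V 0 = 0) : tipExit μ E V 0 - 0 = 0 := by
  simp [tipExit, h.tipDep_zero, hV0]

/-- At time K/(1 - 2ε/5) only K units of H and at most ε² per unit of time of vertical fluid have
come in, which is less than Q₂ could serve. So the backlog, positive up to `T₁`, vanishes earlier,
and being strictly decreasing it does not return. -/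
theorem exists_end_of_backlog (h : IsTipProfile K ε E T₁) (h0 : 0 < ε) (h1 : ε < 9 / 100)
    (hV : IsFlow (ε ^ 2) V) (hV0 : V 0 = 0) (hμ : 1 - 2 * ε / 5 + ε ^ 2 < μ) (hμ1 : μ < 1) :
    ∃ T₂, T₁ < T₂ ∧ T₂ < K / (1 - 2 * ε / 5) ∧ tipExit μ E V T₂ - T₂ = 0 ∧
      (∀ x, 0 < x → x < T₂ → 0 < tipExit μ E V x - x) ∧
      ∀ x, T₂ ≤ x → x ≤ K / (1 - 2 * ε / 5) → tipExit μ E V x - x ≤ 0 := by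
  have hT1 : 0 < T₁ := by linarith [h.one_le]
  have hμ0 : 0 < μ := by nlinarith
  have hm : 0 < 1 - 2 * ε / 5 := by linarith
  have hT := hT1.trans h.lt_last
  have hpos : ∀ x, 0 < x → x ≤ T₁ → 0 < tipExit μ E V x - x := fun x hx hxT => by
    have := h.backlog_strictMonoOn (μ := μ) hV hμ0 hμ1 le_rfl hx hxT
    rwa [h.backlog_zero hV0] at this
  have hlast : tipExit μ E V (K / (1 - 2 * ε / 5)) - K / (1 - 2 * ε / 5) < 0 := by
    rw [sub_neg, tipExit, div_lt_iff₀ hμ0, h.tipDep_last h0 h1]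
    have h2 := hV.sub_le 0 _ le_rfl hT.le
    rw [hV0] at h2
    have h3 : (1 - 2 * ε / 5) * (K / (1 - 2 * ε / 5)) = K := by
      rw [mul_comm]; exact div_mul_cancel₀ _ hm.ne'
    have := mul_lt_mul_of_pos_right hμ hT
    linarith
  have hc : ContinuousOn (fun x => tipExit μ E V x - x) (Icc T₁ (K / (1 - 2 * ε / 5))) := by
    have hE : LipschitzOnWith 1 E (Icc T₁ (K / (1 - 2 * ε / 5))) := by
      refine LipschitzOnWith.of_dist_le_mul fun x hx y hy => ?_
      rw [NNReal.coe_one, one_mul, Real.dist_eq, Real.dist_eq]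
      rcases le_total x y with hxy | hxy
      · rw [abs_sub_comm, abs_sub_comm x, abs_of_nonneg (sub_nonneg.2 hxy), abs_of_nonneg
          (sub_nonneg.2 (h.mono h0 h1 (hT1.le.trans hx.1) hxy hy.2))]
        exact h.sub_le_self h0 h1 (hT1.le.trans hx.1) hxy hy.2
      · rw [abs_of_nonneg (sub_nonneg.2 hxy), abs_of_nonneg
          (sub_nonneg.2 (h.mono h0 h1 (hT1.le.trans hy.1) hxy hx.2))]
        exact h.sub_le_self h0 h1 (hT1.le.trans hy.1) hxy hx.2
    have hVc : ContinuousOn V (Icc T₁ (K / (1 - 2 * ε / 5))) := by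
      refine (hV.lipschitz_max (sq_nonneg ε)).continuous.continuousOn.congr fun x hx => ?_
      simp only [max_eq_left (hT1.le.trans hx.1)]
    have hmin : ContinuousOn (tipDep E) (Icc T₁ (K / (1 - 2 * ε / 5))) :=
      ContinuousOn.inf continuousOn_id (continuousOn_const.add hE.continuousOn)
    exact ((hmin.add hVc).div_const μ).sub continuousOn_id
  obtain ⟨T₂, h12, h23, hz, hp⟩ := exists_first_nonpos hc h.lt_last.le (hpos T₁ hT1 le_rfl) hlast.le
  refine ⟨T₂, h12, lt_of_le_of_ne h23 (by rintro rfl; linarith), hz, fun x hx hxT => ?_,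
    fun x hx hxT => ?_⟩
  · rcases le_total x T₁ with h' | h'
    · exact hpos x hx h'
    · exact hp x h' hxT
  · rcases eq_or_lt_of_le hx with rfl | h'
    · exact hz.le
    · have := h.backlog_strictAntiOn h0 h1 hV hμ h12.le h' hxT
      linarith

/-- Fluid of session `H` leaves `Q₂` earlier than `Q₃` could process what was there before it. -/
theorem service_mul_exit_lt (h : IsTipProfile K ε E T₁) (h0 : 0 < ε) (h1 : ε < 9 / 100)
    (hV : IsFlow (ε ^ 2) V) (hV0 : V 0 = 0) (hμ : 1 - 2 * ε / 5 + ε ^ 2 < μ) (ht : 0 < t)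
    (ht' : t < K / (1 - 2 * ε / 5)) :
    (1 - 2 * ε / 5) * (t + max (tipExit μ E V t - t) 0) < tipDep E t := by
  have hm : 0 < 1 - 2 * ε / 5 := by linarith
  have hμ0 : 0 < μ := by nlinarith
  have h2 := h.lt_tipDep h0 ht ht'
  rcases le_total (tipExit μ E V t - t) 0 with h3 | h3
  · rwa [max_eq_right h3, add_zero]
  · rw [max_eq_left h3]
    -- The vertical fluid that has arrived by `t` is at most ε² t, hence at most ε² times the exit
    -- time. Charging it against the surplus of `μ` over 1 - 2ε/5 leaves H with rate more than 1 -
    -- 2ε/5 up to the exit time.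
    have h4 := hV.sub_le 0 t le_rfl ht.le
    rw [hV0] at h4
    have h5 : 0 ≤ tipExit μ E V t := by linarith
    have h6 : μ * tipExit μ E V t = tipDep E t + V t := by
      rw [tipExit]; field_simp
    have h7 : (1 - 2 * ε / 5 + ε ^ 2) * tipExit μ E V t ≤ μ * tipExit μ E V t :=
      mul_le_mul_of_nonneg_right hμ.le h5
    have h8 : 0 ≤ ε ^ 2 * (tipExit μ E V t - t) := mul_nonneg (sq_nonneg ε) h3
    rcases eq_or_lt_of_le h3 with h9 | h9
    · have : tipExit μ E V t = t := by linarith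
      rw [this]; linarith
    · have : 0 < ε ^ 2 * (tipExit μ E V t - t) := mul_pos (by positivity) h9
      have e : t + (tipExit μ E V t - t) = tipExit μ E V t := by ring
      rw [e]
      linarith

/-- Before `T₁` Q₁ outputs at rate 1, so the exit time grows at rate at most (1 + ε²)/μ; multiplied
by 1 - 2ε/5 this is below 1. -/
theorem gain_first (h : IsTipProfile K ε E T₁) (h0 : 0 < ε) (h1 : ε < 9 / 100)
    (hV : IsFlow (ε ^ 2) V) (hμ : 1 - 2 * ε / 5 + ε ^ 2 < μ) (hs : 0 ≤ s) (hst : s < t)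
    (ht : t ≤ T₁) :
    (1 - 2 * ε / 5) * (tipExit μ E V t - tipExit μ E V s) < tipDep E t - tipDep E s := by
  have hμ0 : 0 < μ := by nlinarith
  have h2 := hV.sub_le s t hs hst.le
  have h3 := hV.mono s t hs hst.le
  rw [tipExit, tipExit, ← sub_div, ← mul_div_assoc, div_lt_iff₀ hμ0,
    h.tipDep_eq_self hs (hst.le.trans ht), h.tipDep_eq_self (hs.trans hst.le) ht]
  have : (1 - 2 * ε / 5 + ε ^ 2) * (t - s) < μ * (t - s) :=
      mul_lt_mul_of_pos_right hμ (by linarith)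
  nlinarith

/-- This is where the factor 1 + 3ε/5 comes from: the vertical arrivals are bounded per unit of
time, whereas the surplus of `μ` is gained per unit of H-fluid, and `le_sub` converts one into the
other. The inequality says that Q₃ receives H-fluid faster than it serves it. -/
theorem gain_second (h : IsTipProfile K ε E T₁) (h0 : 0 < ε) (h1 : ε < 9 / 100)
    (hV : IsFlow (ε ^ 2) V) (hμ : 1 - 2 * ε / 5 + (1 + 3 * ε / 5) * ε ^ 2 < μ) (hs : T₁ ≤ s)
    (hst : s < t) (ht : t ≤ K / (1 - 2 * ε / 5)) :
    (1 - 2 * ε / 5) * (tipExit μ E V t - tipExit μ E V s) < tipDep E t - tipDep E s := by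
  have hμ0 : 0 < μ := lt_trans (by have : 0 < (1 + 3 * ε / 5) * ε ^ 2 := (by positivity); linarith) hμ
  have hs0 : 0 ≤ s := by linarith [h.one_le]
  have h2 := hV.sub_le s t hs0 hst.le
  have h3 := h.le_sub s t hs0 hst.le ht
  have h4 : 0 < (1 - 2 * ε / 5) * (t - s) := mul_pos (by linarith) (by linarith)
  have h5 : 0 < E t - E s := by
    by_contra hn
    have : (1 + 3 * ε / 5) * (E t - E s) ≤ 0 :=
      mul_nonpos_of_nonneg_of_nonpos (by linarith) (not_lt.1 hn)
    linarith
  rw [tipExit, tipExit, ← sub_div, ← mul_div_assoc, div_lt_iff₀ hμ0,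
    h.tipDep_eq h0 h1 hs (hst.le.trans ht), h.tipDep_eq h0 h1 (hs.trans hst.le) ht]
  have h6 := mul_lt_mul_of_pos_right hμ h5
  have h7 := mul_le_mul_of_nonneg_left h3 (sq_nonneg ε)
  have h8 := mul_le_mul_of_nonneg_left h2 (by linarith : 0 ≤ 1 - 2 * ε / 5)
  nlinarith

end IsTipProfile

/-! ### Q₁ and Q₂ driven by the profile up to a given time -/

namespace IsFIFOServer

/-- `Q₁` during the big loops. -/
theorem first_server {ι : Type} [Fintype ι] {K : ℕ} {ε T₁ τ : ℝ} {E : ℝ → ℝ} {c a d : ι → ℝ → ℝ}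
    {h : ℝ → ℝ} (S : IsFIFOServer 1 1 c a d h) (hE : IsTipProfile K ε E T₁) (h0 : 0 < ε)
    (h1 : ε < 9 / 100) (hinit : ∀ u, 0 ≤ u → u ≤ 1 → ∑ i, cum (d i) u = u)
    (hτ : τ ≤ K / (1 - 2 * ε / 5)) (ha : ∀ t, 0 ≤ t → t ≤ τ → ∑ i, cum (a i) t = E t) {t : ℝ}
    (ht : 0 ≤ t) (htτ : t ≤ τ) :
    h t = max (1 + E t - t) 0 ∧ ∑ i, cum (d i) t = tipDep E t := by
  have hT1 := hE.one_le
  have hbusy : ∀ x, 0 ≤ x → x ≤ τ → x < T₁ → 0 < h x := by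
    intro x hx hxτ hxT
    have := S.le_exit hx
    rw [ha x hx hxτ] at this
    linarith [hE.before x hx hxT]
  have hexit : ∀ x, 0 ≤ x → x ≤ τ → x ≤ T₁ → x + h x = 1 + E x := by
    intro x hx hxτ hxT
    have := S.exit_eq_of_busy hx fun y hy hyx => hbusy y hy.le (hyx.le.trans hxτ) (hyx.trans_le hxT)
    rw [ha x hx hxτ] at this
    linarith
  have hzero : ∀ x, T₁ ≤ x → x ≤ τ → h x = 0 := by
    intro x hx hxτ
    refine S.eq_zero_of_arrivals_le (s := T₁) (t := τ) one_pos zero_le_one (by linarith) ?_ ?_ x hx hxτ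
    · have := hexit T₁ (by linarith) (hx.trans hxτ) le_rfl
      linarith [hE.turn]
    · intro y z hy hyz hz
      rw [ha y (by linarith) (by linarith), ha z (by linarith) hz, one_mul]
      exact hE.sub_le_self h0 h1 (by linarith) hyz (hz.trans hτ)
  refine ⟨?_, ?_⟩
  · rcases le_total t T₁ with h' | h'
    · rw [max_eq_left]
      · linarith [hexit t ht htτ h']
      · rcases eq_or_lt_of_le h' with rfl | h''
        · linarith [hE.turn]
        · linarith [hE.before t ht h'']
    · rw [hzero t h' htτ, max_eq_right]
      linarith [hE.after h0 h1 h' (htτ.trans hτ)]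
  · rcases le_total t 1 with h' | h'
    · rw [hinit t ht h', hE.tipDep_eq_self ht (h'.trans hT1)]
    · obtain ⟨x, hx, hxt, rfl⟩ := S.exists_exit_eq zero_le_one h'
      simp only [S.cum_dep_exit zero_le_one _ hx, Finset.sum_add_distrib,
        hinit 1 zero_le_one le_rfl, ha x hx (hxt.trans htτ)]
      rcases le_total x T₁ with h'' | h''
      · have e := hexit x hx (hxt.trans htτ) h''
        rw [e, hE.tipDep_eq_self (by linarith)]
        have := hE.mono h0 h1 hx h'' hE.lt_last.le
        linarith [hE.turn]
      · have e := hzero x h'' (hxt.trans htτ)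
        rw [e, add_zero] at htτ ⊢
        rw [hE.tipDep_eq h0 h1 h'' (htτ.trans hτ)]

/-- `Q₂` during the big loops. -/
theorem second_server {ι : Type} [Fintype ι] {K : ℕ} {ε T₁ τ μ : ℝ} {E V : ℝ → ℝ}
    {c a d : ι → ℝ → ℝ} {h : ℝ → ℝ} (S : IsFIFOServer μ 0 c a d h) (hE : IsTipProfile K ε E T₁)
    (h0 : 0 < ε) (h1 : ε < 9 / 100) (hV : IsFlow (ε ^ 2) V) (hV0 : V 0 = 0)
    (hμ : 1 - 2 * ε / 5 + ε ^ 2 < μ) (hμ1 : μ < 1) (hτ : τ ≤ K / (1 - 2 * ε / 5))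
    (ha : ∀ t, 0 ≤ t → t ≤ τ → ∑ i, cum (a i) t = tipDep E t + V t) {t : ℝ}
    (ht : 0 ≤ t) (htτ : t ≤ τ) : h t = max (tipExit μ E V t - t) 0 := by
  have hμ0 : 0 < μ := by nlinarith
  obtain ⟨T₂, h12, h23, hz, hp, hn⟩ := hE.exists_end_of_backlog h0 h1 hV hV0 hμ hμ1
  have hT1 := hE.one_le
  have hbusy : ∀ x, 0 < x → x ≤ τ → x < T₂ → 0 < h x := by
    intro x hx hxτ hxT
    have := S.le_exit hx.le
    rw [ha x hx.le hxτ, zero_add] at this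
    have := hp x hx hxT
    rw [tipExit] at this
    linarith
  have hexit : ∀ x, 0 ≤ x → x ≤ τ → x ≤ T₂ → x + h x = tipExit μ E V x := by
    intro x hx hxτ hxT
    have := S.exit_eq_of_busy hx fun y hy hyx => hbusy y hy (hyx.le.trans hxτ) (hyx.trans_le hxT)
    rwa [ha x hx hxτ, zero_add] at this
  rcases le_total t T₂ with h' | h'
  · have e := hexit t ht htτ h'
    rw [← e, add_sub_cancel_left, max_eq_left (S.height_nonneg le_rfl ht)]
  · rw [max_eq_right (hn t h' (htτ.trans hτ))]
    refine S.eq_zero_of_arrivals_le (s := T₂) (t := τ) hμ0 le_rfl (by linarith) ?_ ?_ t h' htτ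
    · have := hexit T₂ (by linarith) (h'.trans htτ) le_rfl
      linarith
    · intro y z hy hyz hz
      rw [ha y (by linarith) (by linarith), ha z (by linarith) hz]
      rcases eq_or_lt_of_le hyz with rfl | hlt
      · simp
      · have := hE.backlog_strictAntiOn h0 h1 hV hμ (by linarith) hlt (hz.trans hτ)
        have h2 : tipExit μ E V z - tipExit μ E V y < z - y := by linarith
        rw [tipExit, tipExit, ← sub_div, div_lt_iff₀ hμ0] at h2
        linarith

end IsFIFOServer

/-! ### The order of the visits -/

/-- Fluid of class `b` appears only after a complete unit of class `a`. -/
def InTurn (a b : ℝ → ℝ) : Prop := ∀ t, 0 ≤ t → 0 < cum b t → cum a t = 1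

theorem cum_congr {g g' : ℝ → ℝ} {t : ℝ} (ht : 0 ≤ t) (h : ∀ s, 0 ≤ s → s ≤ t → g s = g' s) :
    cum g t = cum g' t :=
  intervalIntegral.integral_congr fun s hs => by
    rw [uIcc_of_le ht] at hs; exact h s hs.1 hs.2

/-- A positive last entry propagates downwards: the entry before it equals 1, hence is positive, and
so on. Then the total would exceed `n`. -/
theorem last_eq_zero_of_sum_le {D : ℕ → ℝ} {n : ℕ} (h0 : ∀ k, k ≤ n → 0 ≤ D k)
    (h1 : ∀ k, k < n → 0 < D (k + 1) → D k = 1) (hs : ∑ k ∈ Finset.range (n + 1), D k ≤ n) :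
    D n = 0 := by
  by_contra hne
  have hpos : 0 < D n := lt_of_le_of_ne (h0 n le_rfl) (Ne.symm hne)
  have hall : ∀ i, i ≤ n → 0 < D (n - i) := by
    intro i
    induction i with
    | zero => intro _; exact hpos
    | succ i ih =>
      intro hi
      have h2 := ih (by omega)
      have h3 : n - i = n - (i + 1) + 1 := by omega
      rw [h3] at h2
      rw [h1 _ (by omega) h2]
      exact one_pos
  have hone : ∀ k ∈ Finset.range n, D k = 1 := by
    intro k hk
    have hk' := Finset.mem_range.1 hk
    have := hall (n - (k + 1)) (by omega)
    rw [show n - (n - (k + 1)) = k + 1 by omega] at this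
    exact h1 k hk' this
  rw [Finset.sum_range_succ, Finset.sum_congr rfl hone] at hs
  simp at hs
  linarith

theorem eq_one_of_le_sum {D : ℕ → ℝ} {n : ℕ} (h1 : ∀ k, k < n → D k ≤ 1)
    (hs : n ≤ ∑ k ∈ Finset.range n, D k) {k : ℕ} (hk : k < n) : D k = 1 := by
  by_contra hne
  have := Finset.sum_lt_sum (f := D) (g := fun _ => (1 : ℝ)) (s := Finset.range n)
    (fun i hi => h1 i (Finset.mem_range.1 hi))
    ⟨k, Finset.mem_range.2 hk, lt_of_le_of_ne (h1 k hk) hne⟩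
  simp at this
  linarith

namespace IsFIFOServer

variable {ι : Type} [Fintype ι] {μ : ℝ} {c a d : ι → ℝ → ℝ} {h : ℝ → ℝ} {i j : ι}

/-- In a FIFO server the cumulative departures of both classes are their cumulative arrivals at one
common earlier time. -/
theorem inTurn (S : IsFIFOServer μ 0 c a d h) (hij : InTurn (a i) (a j)) : InTurn (d i) (d j) := by
  intro t ht hp
  obtain ⟨x, hx, -, rfl⟩ := S.exists_exit_eq le_rfl ht
  rw [S.cum_dep_exit le_rfl _ hx, cum_zero, zero_add] at hp ⊢
  exact hij x hx hp

theorem cum_dep_le_one (S : IsFIFOServer μ 0 c a d h) (hi : ∀ t, 0 ≤ t → cum (a i) t ≤ 1) (t : ℝ)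
    (ht : 0 ≤ t) : cum (d i) t ≤ 1 :=
  (S.cum_dep_le_cum_arr i ht).trans (hi t ht)

end IsFIFOServer

/-! ### Class order and the rate of S in an arbitrary run -/

namespace IsGadgetRun

variable {L : ℕ} {R : GadgetTrajectory L} {f : ℝ → ℝ → ℝ} {ε μ₂ μ₃ : ℝ} {K K' : ℕ}
  {v : Fin L → ℝ → ℝ}

theorem cum_first (hR : IsGadgetRun f ε μ₂ μ₃ K K' v R) {k : ℕ} (hk : k < K) {u : ℝ} (hu : 0 ≤ u)
    (hu1 : u ≤ 1) : cum (R.d₁ k) u = if k = 0 then u else 0 := by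
  have h1 : cum (R.d₁ k) u = ∫ _ in (0 : ℝ)..u, if k = 0 then (1 : ℝ) else 0 := by
    refine intervalIntegral.integral_congr_ae ?_
    have h2 : ∀ᵐ x : ℝ, x ≠ u := by simp [ae_iff, measure_singleton]
    filter_upwards [hR.server₁.initial ⟨k, hk⟩, h2] with x hx hxu hxI
    rw [uIoc_of_le hu] at hxI
    exact hx hxI.1.le ((lt_of_le_of_ne hxI.2 hxu).trans_le hu1)
  rw [h1]
  split_ifs <;> simp

theorem cum_exit₁ (hR : IsGadgetRun f ε μ₂ μ₃ K K' v R) {k : ℕ} (hk : k < K) {t : ℝ} (ht : 0 ≤ t) :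
    cum (R.d₁ k) (t + R.h₁ t) = (if k = 0 then 1 else 0) + cum (R.arrivalH₁ k) t := by
  have := hR.server₁.cum_dep_exit zero_le_one ⟨k, hk⟩ ht
  rwa [hR.cum_first hk zero_le_one le_rfl] at this

theorem arrivalH₄_of_lt {k : ℕ} (hk : k < K) : R.arrivalH₄ K k = R.d₃ k := by
  simp [GadgetTrajectory.arrivalH₄, hk]

theorem arrivalH₄_add {j : ℕ} : R.arrivalH₄ K (K + j) = R.d₄ (K + j - 1) := by
  simp [GadgetTrajectory.arrivalH₄]

theorem inTurn₂ (hR : IsGadgetRun f ε μ₂ μ₃ K K' v R) {j k : ℕ} (hj : j < K) (hk : k < K)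
    (h : InTurn (R.d₁ j) (R.d₁ k)) : InTurn (R.d₂ j) (R.d₂ k) :=
  hR.server₂.inTurn (i := Sum.inl (⟨j, hj⟩ : Fin K)) (j := Sum.inl (⟨k, hk⟩ : Fin K)) h

theorem inTurn₃ (hR : IsGadgetRun f ε μ₂ μ₃ K K' v R) {j k : ℕ} (hj : j < K) (hk : k < K)
    (h : InTurn (R.d₁ j) (R.d₁ k)) : InTurn (R.d₃ j) (R.d₃ k) :=
  hR.server₃.inTurn (i := ⟨j, hj⟩) (j := ⟨k, hk⟩) (hR.inTurn₂ hj hk h)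

theorem inTurn₄ (hR : IsGadgetRun f ε μ₂ μ₃ K K' v R) {j k : ℕ} (hj : j < K) (hk : k < K)
    (h : InTurn (R.d₁ j) (R.d₁ k)) : InTurn (R.d₄ j) (R.d₄ k) := by
  refine hR.server₄.inTurn (i := Sum.inl ⟨j, by omega⟩) (j := Sum.inl ⟨k, by omega⟩) ?_
  simp only [Sum.elim_inl]
  rw [arrivalH₄_of_lt hj, arrivalH₄_of_lt hk]
  exact hR.inTurn₃ hj hk h

theorem le_one₂ (hR : IsGadgetRun f ε μ₂ μ₃ K K' v R) {k : ℕ} (hk : k < K)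
    (h : ∀ t, 0 ≤ t → cum (R.d₁ k) t ≤ 1) : ∀ t, 0 ≤ t → cum (R.d₂ k) t ≤ 1 :=
  hR.server₂.cum_dep_le_one (i := Sum.inl (⟨k, hk⟩ : Fin K)) h

theorem le_one₃ (hR : IsGadgetRun f ε μ₂ μ₃ K K' v R) {k : ℕ} (hk : k < K)
    (h : ∀ t, 0 ≤ t → cum (R.d₁ k) t ≤ 1) : ∀ t, 0 ≤ t → cum (R.d₃ k) t ≤ 1 :=
  hR.server₃.cum_dep_le_one (i := ⟨k, hk⟩) (hR.le_one₂ hk h)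

theorem le_one₄ (hR : IsGadgetRun f ε μ₂ μ₃ K K' v R) {k : ℕ} (hk : k < K)
    (h : ∀ t, 0 ≤ t → cum (R.d₁ k) t ≤ 1) : ∀ t, 0 ≤ t → cum (R.d₄ k) t ≤ 1 := by
  refine hR.server₄.cum_dep_le_one (i := Sum.inl ⟨k, by omega⟩) ?_
  simp only [Sum.elim_inl]
  rw [arrivalH₄_of_lt hk]
  exact hR.le_one₃ hk h

/-- Induction on the visit, going once around the big loop: each of the servers Q₂, Q₃, Q₄ preserves
both the unit bound and the order, and Q₁ shifts the class by one. The initial content of Q₁ starts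
the induction. -/
theorem in_turn (hR : IsGadgetRun f ε μ₂ μ₃ K K' v R) : ∀ k, k < K →
    (∀ t, 0 ≤ t → cum (R.d₁ k) t ≤ 1) ∧ (k + 1 < K → InTurn (R.d₁ k) (R.d₁ (k + 1))) := by
  intro k
  induction k with
  | zero =>
    intro hk
    have hz : ∀ t, 1 ≤ t → cum (R.d₁ 0) t = 1 := by
      intro t ht
      obtain ⟨x, hx, -, rfl⟩ := hR.server₁.exists_exit_eq zero_le_one ht
      rw [hR.cum_exit₁ hk hx]
      simp [GadgetTrajectory.arrivalH₁, cum]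
    refine ⟨fun t ht => ?_, fun hk1 t ht hp => ?_⟩
    · rcases le_total t 1 with h | h
      · rw [hR.cum_first hk ht h]; simpa using h
      · rw [hz t h]
    · rcases le_total t 1 with h | h
      · rw [hR.cum_first hk1 ht h] at hp
        simp at hp
      · exact hz t h
  | succ k ih =>
    intro hk
    have hk' : k < K := by omega
    obtain ⟨ih1, ih2⟩ := ih hk'
    refine ⟨fun t ht => ?_, fun hk1 t ht hp => ?_⟩
    · rcases le_total t 1 with h | h
      · rw [hR.cum_first hk ht h]; simp
      · obtain ⟨x, hx, -, rfl⟩ := hR.server₁.exists_exit_eq zero_le_one h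
        rw [hR.cum_exit₁ hk hx]
        simpa [GadgetTrajectory.arrivalH₁] using hR.le_one₄ hk' ih1 x hx
    · rcases le_total t 1 with h | h
      · rw [hR.cum_first hk1 ht h] at hp
        simp at hp
      · obtain ⟨x, hx, -, rfl⟩ := hR.server₁.exists_exit_eq zero_le_one h
        rw [hR.cum_exit₁ hk1 hx] at hp
        rw [hR.cum_exit₁ hk hx]
        simp only [Nat.add_eq_zero_iff, one_ne_zero, and_false, if_false, zero_add,
          GadgetTrajectory.arrivalH₁] at hp ⊢
        exact hR.inTurn₄ hk' hk (ih2 hk) x hx hp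

theorem isRate_d₁ (hR : IsGadgetRun f ε μ₂ μ₃ K K' v R) {k : ℕ} (hk : k < K) : IsRate (R.d₁ k) :=
  hR.server₁.dep ⟨k, hk⟩

theorem isRate_d₂ (hR : IsGadgetRun f ε μ₂ μ₃ K K' v R) {k : ℕ} (hk : k < K) : IsRate (R.d₂ k) :=
  hR.server₂.dep (Sum.inl ⟨k, hk⟩)

theorem isRate_d₃ (hR : IsGadgetRun f ε μ₂ μ₃ K K' v R) {k : ℕ} (hk : k < K) : IsRate (R.d₃ k) :=
  hR.server₃.dep ⟨k, hk⟩

theorem isRate_d₄ (hR : IsGadgetRun f ε μ₂ μ₃ K K' v R) {k : ℕ} (hk : k < K + K') :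
    IsRate (R.d₄ k) :=
  hR.server₄.dep (Sum.inl ⟨k, hk⟩)

theorem isRate_rate (hR : IsGadgetRun f ε μ₂ μ₃ K K' v R) : IsRate R.rate :=
  hR.server₄.arr (Sum.inr ())

theorem isRate_dS (hR : IsGadgetRun f ε μ₂ μ₃ K K' v R) : IsRate R.dS :=
  hR.server₄.dep (Sum.inr ())

theorem cum_exit₄ (hR : IsGadgetRun f ε μ₂ μ₃ K K' v R) {k : ℕ} (hk : k < K + K') {t : ℝ}
    (ht : 0 ≤ t) : cum (R.d₄ k) (t + R.h₄ t) = cum (R.arrivalH₄ K k) t := by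
  have := hR.server₄.cum_dep_exit le_rfl (Sum.inl ⟨k, hk⟩) ht
  rwa [cum_zero, zero_add] at this

/-- The class `K - 1` has not reached `Q₄` yet as long as at most `K - 1` units of session `H` have
left `Q₃`. -/
theorem cum_d₃_last (hR : IsGadgetRun f ε μ₂ μ₃ K K' v R) (hK : 0 < K) {t : ℝ} (ht : 0 ≤ t)
    (hs : ∑ k ∈ Finset.range K, cum (R.d₃ k) t ≤ K - 1) : cum (R.d₃ (K - 1)) t = 0 := by
  obtain ⟨n, rfl⟩ : ∃ n, K = n + 1 := ⟨K - 1, by omega⟩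
  push_cast at hs
  exact last_eq_zero_of_sum_le (D := fun k => cum (R.d₃ k) t) (n := n)
    (fun k hk => (hR.isRate_d₃ (by omega)).cum_nonneg ht)
    (fun k hk hp => hR.inTurn₃ (by omega) (by omega) ((hR.in_turn k (by omega)).2 (by omega)) t ht hp)
    (by linarith)

theorem sum_arr₄ (t : ℝ) : ∑ i : Fin (K + K') ⊕ Unit,
    cum (Sum.elim (fun k : Fin (K + K') => R.arrivalH₄ K k) (fun _ => R.rate) i) t =
    ∑ k ∈ Finset.range (K + K'), cum (R.arrivalH₄ K k) t + cum R.rate t := by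
  rw [Fintype.sum_sum_type]
  simp [Finset.sum_range]

theorem sum_arrivalH₄ (t : ℝ) : ∑ k ∈ Finset.range (K + K'), cum (R.arrivalH₄ K k) t =
    ∑ k ∈ Finset.range K, cum (R.d₃ k) t + ∑ j ∈ Finset.range K', cum (R.d₄ (K + j - 1)) t := by
  rw [Finset.sum_range_add]
  congr 1
  · exact Finset.sum_congr rfl fun k hk => by rw [arrivalH₄_of_lt (Finset.mem_range.1 hk)]
  · exact Finset.sum_congr rfl fun k hk => by rw [arrivalH₄_add]

theorem stored_dS (hR : IsGadgetRun f ε μ₂ μ₃ K K' v R) {t : ℝ} (ht : 0 ≤ t) :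
    stored R.dS R.h₄ t = cum R.rate t - cum R.dS t := by
  have := hR.server₄.stored_eq le_rfl (Sum.inr ()) ht
  simpa [cum_zero] using this

/-- Fluid now at the exit of a nonempty queue arrived strictly earlier. If no S-fluid is stored,
none has arrived since, so by continuity the current rate is zero. -/
theorem rate_eq_zero (hR : IsGadgetRun f ε μ₂ μ₃ K K' v R) {t : ℝ} (ht : 0 < t)
    (hh : 0 < R.h₄ t) (hb : ¬ R.Blocked t) : R.rate t = 0 := by
  obtain ⟨x, hx, hxt, e⟩ := hR.server₄.exists_exit_eq le_rfl ht.le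
  have hlt : x < t := lt_of_le_of_ne hxt (by rintro rfl; linarith)
  have h1 := hR.server₄.cum_dep_exit le_rfl (Sum.inr ()) hx
  simp only [Sum.elim_inr, cum_zero, zero_add, e] at h1
  rw [GadgetTrajectory.Blocked, hR.stored_dS ht.le] at hb
  exact hR.isRate_rate.eq_zero_of_cum_sub_eq_zero hR.flow_control.cont hx hlt
    (le_antisymm (by linarith) (hR.isRate_rate.cum_mono hx hlt.le))

theorem continuousOn_stored_dS (hR : IsGadgetRun f ε μ₂ μ₃ K K' v R) :
    ContinuousOn (stored R.dS R.h₄) (Ici 0) :=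
  (hR.isRate_rate.continuousOn_cum.sub hR.isRate_dS.continuousOn_cum).congr
    fun _ ht => hR.stored_dS ht

theorem not_blocked_zero (hR : IsGadgetRun f ε μ₂ μ₃ K K' v R) : ¬ R.Blocked 0 := by
  rw [GadgetTrajectory.Blocked, hR.stored_dS le_rfl]
  simp [cum_zero]

/-- As long as `Q₄` has a queue, the rate of session `S` is that of a session that has been blocked
since time `0`. -/
theorem rate_eq (hR : IsGadgetRun f ε μ₂ μ₃ K K' v R) (hε : 0 < ε) (hf : f ε 0 = ε)
    (hfa : AntitoneOn (f ε) (Ici 0)) (hfn : ∀ t, 0 ≤ t → 0 ≤ f ε t) (hf0 : ∀ t, 0 ≤ t → f 0 t = 0)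
    {T : ℝ} (hp : ∀ x, 0 < x → x ≤ T → 0 < R.h₄ x) {t : ℝ} (ht : 0 ≤ t) (htT : t ≤ T) :
    R.rate t = f ε t := by
  have hcs : ∀ a b : ℝ, 0 ≤ a → ContinuousOn (stored R.dS R.h₄) (Icc a b) := fun a b ha =>
    hR.continuousOn_stored_dS.mono fun x hx => ha.trans hx.1
  -- once the session has ceased to be blocked, its rate is zero
  have hgone : ∀ a, 0 < a → a ≤ T → ¬ R.Blocked a → ∀ s, a ≤ s → f ε s = 0 := by
    intro a ha haT hba s has
    have hcr : ContinuousOn R.rate (Icc 0 a) := hR.flow_control.cont.mono Icc_subset_Ici_self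
    have hra := hR.rate_eq_zero ha (hp a ha haT) hba
    obtain ⟨r, hr0, hra', hr, hrp⟩ := exists_first_nonpos hcr ha.le (by rw [hR.rate_zero]; exact hε)
      hra.le
    have hblk : ∀ x, 0 < x → x < r → R.Blocked x := by
      intro x hx hxr
      by_contra hn
      have := hR.rate_eq_zero hx (hp x hx (hxr.le.trans (hra'.trans haT))) hn
      linarith [hrp x hx.le hxr]
    -- No S-fluid is stored at time 0, so the search for the first unblocking starts inside the
    -- blocked stretch, at `r / 2`.
    have hη := hblk (r / 2) (by linarith) (by linarith)
    obtain ⟨b, hb1, hb2, hb3, hb4⟩ := exists_first_nonpos (hcs (r / 2) a (by linarith)) (by linarith)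
      hη (not_lt.1 hba)
    have hb0 : 0 < b := by linarith
    have h1 := hR.flow_control.blocked 0 b le_rfl hb0 hR.not_blocked_zero (fun x hx => by
      rcases lt_or_ge x (r / 2) with h | h
      · exact hblk x hx.1 (by linarith)
      · exact hb4 x h hx.2) b ⟨hb0.le, le_rfl⟩
    rw [hR.rate_zero, sub_zero, hR.rate_eq_zero hb0 (hp b hb0 (hb2.trans haT))
      (by rw [GadgetTrajectory.Blocked, hb3]; exact lt_irrefl 0)] at h1
    refine le_antisymm ?_ (hfn s (by linarith))
    rw [h1]
    exact hfa hb0.le (by simp; linarith) (hb2.trans has)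
  rcases eq_or_lt_of_le ht with rfl | ht0
  · rw [hR.rate_zero, hf]
  by_cases hbt : R.Blocked t
  · obtain ⟨a, ha0, hat, ha, hab⟩ := exists_last_nonpos (hcs 0 t le_rfl) ht
      (not_lt.1 hR.not_blocked_zero) hbt
    have h1 := hR.flow_control.blocked a t ha0 hat (not_lt.2 ha)
      (fun x hx => hab x hx.1 hx.2.le) t ⟨hat.le, le_rfl⟩
    rcases eq_or_lt_of_le ha0 with rfl | ha0
    · rwa [hR.rate_zero, sub_zero] at h1
    -- A session that is blocked anew restarts from rate zero and stays there; the original decrease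
    -- function has reached zero by then as well.
    · rw [h1, hR.rate_eq_zero ha0 (hp a ha0 (hat.le.trans htT)) (not_lt.2 ha),
        hf0 _ (by linarith), hgone a ha0 (hat.le.trans htT) (not_lt.2 ha) t hat.le]
  · rw [hR.rate_eq_zero ht0 (hp t ht0 htT) hbt, hgone t ht0 htT hbt t le_rfl]

end IsGadgetRun

/-! ### Vertical arrivals as a flow -/

namespace IsVerticalArrivals

variable {L : ℕ} {B : ℝ} {v : Fin L → ℝ → ℝ}

theorem le_bound (hv : IsVerticalArrivals B v) (i : Fin L) {t : ℝ} (ht : 0 ≤ t) : v i t ≤ B :=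
  (Finset.single_le_sum (f := fun i => v i t) (fun j _ => hv.nonneg j t ht)
    (Finset.mem_univ i)).trans (hv.bound t ht)

theorem isRate (hv : IsVerticalArrivals B v) (i : Fin L) : IsRate (v i) where
  nonneg := hv.nonneg i
  int t ht := by
    refine (intervalIntegrable_const (c := B)).mono_fun (hv.meas i).aestronglyMeasurable ?_
    rw [uIoc_of_le ht]
    filter_upwards [ae_restrict_mem measurableSet_Ioc] with x hx
    rw [Real.norm_of_nonneg (hv.nonneg i x hx.1.le)]
    exact (hv.le_bound i hx.1.le).trans (le_abs_self B)

theorem isFlow (hv : IsVerticalArrivals B v) : IsFlow B fun t => ∑ i, cum (v i) t := by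
  refine ⟨fun s t hs hst => Finset.sum_le_sum fun i _ => (hv.isRate i).cum_mono hs hst,
    fun s t hs hst => ?_⟩
  rw [← IsRate.cum_sum (fun i _ => hv.isRate i) hs,
    ← IsRate.cum_sum (fun i _ => hv.isRate i) (hs.trans hst)]
  exact (IsRate.sum fun i _ => hv.isRate i).cum_sub_le hs hst
    fun x hx => hv.bound x (hs.trans hx.1.le)

end IsVerticalArrivals

/-! ### Closing the feedback loop during the big loops -/

namespace IsGadgetRun

variable {L : ℕ} {R : GadgetTrajectory L} {f : ℝ → ℝ → ℝ} {ε μ₂ μ₃ : ℝ} {K K' : ℕ}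
  {v : Fin L → ℝ → ℝ}

/-- `Q₄` is busy, and the rate of session `S` is known, as long as `Q₃` outputs at full rate. -/
theorem fourth_server_busy (hR : IsGadgetRun f ε μ₂ (2 * ε / 5) K K' v R) (hT : IsTuned K ε (f ε))
    (hf0 : ∀ t, 0 ≤ t → f 0 t = 0) {τ : ℝ} (hτ : τ ≤ K / (1 - 2 * ε / 5))
    (hd : ∀ t, 0 ≤ t → t ≤ τ →
      ∑ k ∈ Finset.range K, cum (R.d₃ k) t = (1 - 2 * ε / 5) * t) {t : ℝ} (ht : 0 < t)
    (htτ : t ≤ τ) : 0 < R.h₄ t := by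
  have hε := hT.pos
  have hlow : ∀ t, 0 ≤ t → t ≤ τ → cum R.rate t - 2 * ε / 5 * t ≤ R.h₄ t := by
    intro t ht htτ
    have h1 := hR.server₄.le_exit ht
    rw [sum_arr₄, sum_arrivalH₄, hd t ht htτ] at h1
    have h2 : 0 ≤ ∑ j ∈ Finset.range K', cum (R.d₄ (K + j - 1)) t :=
      Finset.sum_nonneg fun j hj => (hR.isRate_d₄ (by
        have := Finset.mem_range.1 hj
        omega)).cum_nonneg ht
    linarith
  have hrate : ∀ r, r ≤ τ → (∀ x, 0 < x → x < r → 0 < R.h₄ x) → ∀ x, 0 ≤ x → x < r →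
      R.rate x = f ε x := fun r hr hp x hx hxr =>
    hR.rate_eq hε hT.start hT.anti hT.nonneg hf0 (T := x)
      (fun y hy hyx => hp y hy (hyx.trans_lt hxr)) hx le_rfl
  by_contra hn
  have hcr : ContinuousWithinAt R.rate (Ici 0) 0 := hR.flow_control.cont 0 (mem_Ici.2 le_rfl)
  -- Near time 0 the rate is known only through its continuity. This provides an initial busy
  -- stretch; after it, the decrease function determines the rate up to the first time `r` at which
  -- Q₄ is empty, and 9ε/10 > 2ε/5 excludes such a time.
  have hev : ∀ᶠ x in nhdsWithin 0 (Ici (0 : ℝ)), 9 / 10 * ε < R.rate x :=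
    hcr.eventually (lt_mem_nhds (by rw [hR.rate_zero]; linarith))
  obtain ⟨u, hu, hux⟩ := (mem_nhdsGE_iff_exists_Ico_subset' (one_pos)).1 hev
  have hpos : ∀ x, 0 < x → x ≤ τ → x < u → 0 < R.h₄ x := by
    intro x hx hxτ hxu
    have h1 := hR.isRate_rate.le_cum_sub (C := 9 / 10 * ε) le_rfl hx.le fun y hy =>
      (hux ⟨hy.1.le, hy.2.trans hxu⟩ : 9 / 10 * ε < R.rate y).le
    rw [cum_zero] at h1
    have h2 := hlow x hx.le hxτ
    nlinarith
  have hut : u ≤ t := by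
    by_contra h
    exact hn (hpos t ht htτ (not_le.1 h))
  have hu0 : 0 < u := hu
  obtain ⟨r, hr1, hr2, hr3, hr4⟩ := exists_first_nonpos
    (hR.server₄.continuousOn_Icc (by linarith : 0 ≤ u / 2)) (by linarith : u / 2 ≤ t)
    (hpos (u / 2) (by linarith) (by linarith) (by linarith)) (not_lt.1 hn)
  have hrpos : ∀ x, 0 < x → x < r → 0 < R.h₄ x := by
    intro x hx hxr
    rcases lt_or_ge x (u / 2) with h | h
    · exact hpos x hx (by linarith) (by linarith)
    · exact hr4 x h hxr
  have h1 := hR.isRate_rate.le_cum_sub (C := 9 / 10 * ε) (s := 0) (t := r) le_rfl (by linarith)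
    fun y hy => by
      rw [hrate r (by linarith) hrpos y hy.1.le hy.2]
      exact hT.large y hy.1.le (by linarith [hy.2])
  rw [cum_zero] at h1
  have h2 := hlow r (by linarith) (by linarith)
  have h3 : 0 < ε * r := mul_pos hε (by linarith)
  linarith

/-- `Q₄` during the big loops. -/
theorem fourth_server (hR : IsGadgetRun f ε μ₂ (2 * ε / 5) K K' v R) (hT : IsTuned K ε (f ε))
    (hf0 : ∀ t, 0 ≤ t → f 0 t = 0) {τ : ℝ} (hτ0 : 0 ≤ τ) (hτ : τ ≤ K / (1 - 2 * ε / 5))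
    (hd : ∀ t, 0 ≤ t → t ≤ τ →
      ∑ k ∈ Finset.range K, cum (R.d₃ k) t = (1 - 2 * ε / 5) * t) :
    (∀ t, 0 ≤ t → t ≤ τ → R.rate t = f ε t) ∧
    (∀ t, 0 ≤ t → t ≤ τ → t + R.h₄ t = (1 - 2 * ε / 5) * t + cum (f ε) t) ∧
    (∀ k, K - 1 ≤ k → k < K + K' → cum (R.d₄ k) τ = 0) := by
  have hm := hT.service_pos
  have hbusy := fun {t} => hR.fourth_server_busy hT hf0 hτ hd (t := t)
  have hK : 0 < K := by have := hT.twenty_le; omega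
  have hrate : ∀ t, 0 ≤ t → t ≤ τ → R.rate t = f ε t := fun t ht htτ =>
    hR.rate_eq hT.pos hT.start hT.anti hT.nonneg hf0 (T := t)
      (fun y hy hyx => hbusy hy (hyx.trans htτ)) ht le_rfl
  have hcum : ∀ t, 0 ≤ t → t ≤ τ → cum R.rate t = cum (f ε) t := fun t ht htτ =>
    cum_congr ht fun s hs hst => hrate s hs (hst.trans htτ)
  have hlow : ∀ t, 0 ≤ t → t ≤ τ → (1 - 2 * ε / 5) * t + cum (f ε) t ≤ t + R.h₄ t := by
    intro t ht htτ
    have h1 := hR.server₄.le_exit ht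
    rw [sum_arr₄, sum_arrivalH₄, hd t ht htτ, hcum t ht htτ] at h1
    have h2 : 0 ≤ ∑ j ∈ Finset.range K', cum (R.d₄ (K + j - 1)) t :=
      Finset.sum_nonneg fun j hj => (hR.isRate_d₄ (by
        have := Finset.mem_range.1 hj
        omega)).cum_nonneg ht
    linarith
  have hzero : ∀ j, j ≤ K' → K - 1 + j < K + K' → cum (R.d₄ (K - 1 + j)) τ = 0 := by
    intro j
    induction j with
    | zero =>
      intro _ hjK
      rw [add_zero] at hjK ⊢
      -- The witness enters Q₄ no later than the tip does for visit K - 1, yet leaves no earlier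
      -- than `τ`. For `τ` beyond the entry time of the tip this is the tuning condition.
      have h1 : ∃ x, 0 ≤ x ∧ x ≤ τ ∧ x ≤ (K - 1) / (1 - 2 * ε / 5) ∧ τ ≤ x + R.h₄ x := by
        rcases le_total τ ((K - 1) / (1 - 2 * ε / 5)) with h | h
        · exact ⟨τ, hτ0, le_rfl, h, le_add_of_nonneg_right (hR.server₄.height_nonneg le_rfl hτ0)⟩
        · refine ⟨_, hT.entry_nonneg, h, le_rfl, ?_⟩
          have e1 := hlow _ hT.entry_nonneg h
          have e2 := hT.tuned
          have e3 : (1 - 2 * ε / 5) * ((K - 1) / (1 - 2 * ε / 5)) = K - 1 := by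
            rw [mul_comm]; exact div_mul_cancel₀ _ hm.ne'
          linarith
      obtain ⟨x, hx, hxτ, hxs, hxe⟩ := h1
      have h2 := hR.cum_exit₄ hjK hx
      rw [arrivalH₄_of_lt (by omega), hR.cum_d₃_last hK hx (by
        rw [hd x hx hxτ]
        rw [le_div_iff₀ hm] at hxs
        linarith)] at h2
      exact le_antisymm (h2 ▸ (hR.isRate_d₄ hjK).cum_mono hτ0 hxe)
        ((hR.isRate_d₄ hjK).cum_nonneg hτ0)
    | succ j ih =>
      intro hj hjK
      have h1 := ih (by omega) (by omega)
      have h2 := hR.cum_exit₄ hjK hτ0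
      rw [show K - 1 + (j + 1) = K + j by omega] at *
      rw [arrivalH₄_add, show K + j - 1 = K - 1 + j by omega, h1] at h2
      exact le_antisymm (h2 ▸ (hR.isRate_d₄ hjK).cum_mono hτ0
        (le_add_of_nonneg_right (hR.server₄.height_nonneg le_rfl hτ0)))
        ((hR.isRate_d₄ hjK).cum_nonneg hτ0)
  have hz : ∀ k, K - 1 ≤ k → k < K + K' → cum (R.d₄ k) τ = 0 := by
    intro k hk hk'
    have := hzero (k - (K - 1)) (by omega) (by omega)
    rwa [show K - 1 + (k - (K - 1)) = k by omega] at this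
  refine ⟨hrate, fun t ht htτ => ?_, hz⟩
  have h1 := hR.server₄.exit_eq_of_busy ht fun x hx hxt => hbusy hx (hxt.le.trans htτ)
  rw [sum_arr₄, sum_arrivalH₄, hd t ht htτ, hcum t ht htτ] at h1
  have h2 : ∑ j ∈ Finset.range K', cum (R.d₄ (K + j - 1)) t = 0 := by
    refine Finset.sum_eq_zero fun j hj => ?_
    have hj' := Finset.mem_range.1 hj
    refine le_antisymm ?_ ((hR.isRate_d₄ (by omega)).cum_nonneg ht)
    rw [← hz (K + j - 1) (by omega) (by omega)]
    exact (hR.isRate_d₄ (by omega)).cum_mono ht htτ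
  linarith

/-- Visit K - 1 is the last one preceded by Q₃; what leaves Q₄ after it goes on to the small loops,
and fresh fluid is never injected. -/
theorem sum_arrivalH₁ (hK : 0 < K) (t : ℝ) : ∑ k : Fin K, cum (R.arrivalH₁ k) t =
    ∑ k ∈ Finset.range (K - 1), cum (R.d₄ k) t := by
  obtain ⟨n, rfl⟩ : ∃ n, K = n + 1 := ⟨K - 1, by omega⟩
  rw [← Finset.sum_range (fun k => cum (R.arrivalH₁ k) t), Finset.sum_range_succ']
  simp [GadgetTrajectory.arrivalH₁, cum]

/-- The departures of session `H` from `Q₄` during the big loops. -/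
theorem sum_arrivalH₁_eq (hR : IsGadgetRun f ε μ₂ (2 * ε / 5) K K' v R) (hT : IsTuned K ε (f ε))
    (hf0 : ∀ t, 0 ≤ t → f 0 t = 0) {E : ℝ → ℝ}
    (hE : ∀ x, 0 ≤ x → x ≤ (K - 1) / (1 - 2 * ε / 5) →
      E ((1 - 2 * ε / 5) * x + cum (f ε) x) = (1 - 2 * ε / 5) * x)
    {τ : ℝ} (hτ : τ ≤ K / (1 - 2 * ε / 5))
    (hd : ∀ t, 0 ≤ t → t ≤ τ →
      ∑ k ∈ Finset.range K, cum (R.d₃ k) t = (1 - 2 * ε / 5) * t) {t : ℝ} (ht : 0 ≤ t)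
    (htτ : t ≤ τ) : ∑ k : Fin K, cum (R.arrivalH₁ k) t = E t := by
  have hm := hT.service_pos
  have hK : 0 < K := by have := hT.twenty_le; omega
  obtain ⟨-, hexit, -⟩ := hR.fourth_server hT hf0 (ht.trans htτ) hτ hd
  obtain ⟨x, hx, hxt, e⟩ := hR.server₄.exists_exit_eq le_rfl ht
  have hxe := hexit x hx (hxt.trans htτ)
  have e3 : (1 - 2 * ε / 5) * ((K - 1) / (1 - 2 * ε / 5)) = K - 1 := by
    rw [mul_comm]; exact div_mul_cancel₀ _ hm.ne'
  -- The tip exits at K/(1 - 2ε/5) by tuning, so fluid that exits by then entered no later than the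
  -- tip.
  have hxs : x ≤ (K - 1) / (1 - 2 * ε / 5) := by
    by_contra hn
    have h1 : (1 - 2 * ε / 5) * ((K - 1) / (1 - 2 * ε / 5)) < (1 - 2 * ε / 5) * x :=
      mul_lt_mul_of_pos_left (not_le.1 hn) hm
    have h2 := hT.isRate.cum_mono hT.entry_nonneg (not_le.1 hn).le
    linarith [hT.tuned]
  rw [sum_arrivalH₁ hK, ← e, hxe, hE x hx hxs, ← hxe, ← hd x hx (hxt.trans htτ)]
  have h1 := hR.cum_d₃_last hK hx (by
    rw [hd x hx (hxt.trans htτ)]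
    rw [le_div_iff₀ hm] at hxs
    linarith)
  obtain ⟨n, rfl⟩ : ∃ n, K = n + 1 := ⟨K - 1, by omega⟩
  simp only [Nat.add_sub_cancel] at h1 ⊢
  rw [Finset.sum_range_succ, h1, add_zero]
  refine Finset.sum_congr rfl fun k hk => ?_
  have hk' := Finset.mem_range.1 hk
  rw [hR.cum_exit₄ (by omega) hx, arrivalH₄_of_lt (by omega)]

theorem sum_d₁ (hR : IsGadgetRun f ε μ₂ μ₃ K K' v R) (hK : 0 < K) (u : ℝ) (hu : 0 ≤ u)
    (hu1 : u ≤ 1) : ∑ k : Fin K, cum (R.d₁ k) u = u := by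
  rw [← Finset.sum_range (fun k => cum (R.d₁ k) u)]
  rw [Finset.sum_congr rfl fun k hk => hR.cum_first (Finset.mem_range.1 hk) hu hu1]
  simp [hK]

end IsGadgetRun

/-- A busy, initially empty server has worked at full rate. -/
theorem IsFIFOServer.sum_cum_dep_of_busy {ι : Type} [Fintype ι] {μ : ℝ} {c a d : ι → ℝ → ℝ}
    {h : ℝ → ℝ} (S : IsFIFOServer μ 0 c a d h) (hμ : 0 < μ) {t : ℝ} (ht : 0 ≤ t)
    (hp : ∀ x, 0 < x → x < t → 0 < h x) : ∑ i, cum (d i) t = μ * t := by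
  obtain ⟨x, hx, hxt, rfl⟩ := S.exists_exit_eq le_rfl ht
  have h1 := S.exit_eq_of_busy hx fun y hy hyx => hp y hy (hyx.trans_le hxt)
  simp only [S.cum_dep_exit le_rfl _ hx, cum_zero, zero_add] at h1 ⊢
  rw [h1]
  field_simp

namespace IsGadgetRun

variable {L : ℕ} {R : GadgetTrajectory L} {f : ℝ → ℝ → ℝ} {ε μ₂ T₁ : ℝ} {K K' : ℕ}
  {v : Fin L → ℝ → ℝ} {E : ℝ → ℝ}

theorem second_server_height (hR : IsGadgetRun f ε μ₂ (2 * ε / 5) K K' v R)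
    (hv : IsVerticalArrivals (ε ^ 2) v) (hE : IsTipProfile K ε E T₁) (h0 : 0 < ε)
    (h1 : ε < 9 / 100) (hμ0 : 0 < μ₂) (hμ : μ₂ < 2 * ε / 5 - ε ^ 2) {τ : ℝ}
    (hτ : τ ≤ K / (1 - 2 * ε / 5))
    (hd : ∀ t, 0 ≤ t → t ≤ τ → ∑ k : Fin K, cum (R.d₁ k) t = tipDep E t) {t : ℝ} (ht : 0 ≤ t)
    (htτ : t ≤ τ) :
    R.h₂ t = max (tipExit (1 - μ₂) E (fun t => ∑ i, cum (v i) t) t - t) 0 := by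
  refine hR.server₂.second_server hE h0 h1 (hv.isFlow) (by simp [cum_zero])
    (by linarith) (by linarith) hτ (fun t ht htτ => ?_) ht htτ
  rw [Fintype.sum_sum_type]
  simp only [Sum.elim_inl, Sum.elim_inr]
  rw [hd t ht htτ]

theorem sum_d₂_exit (hR : IsGadgetRun f ε μ₂ (2 * ε / 5) K K' v R) {x : ℝ} (hx : 0 ≤ x) :
    ∑ k : Fin K, cum (R.d₂ k) (x + R.h₂ x) = ∑ k : Fin K, cum (R.d₁ k) x := by
  refine Finset.sum_congr rfl fun k _ => ?_
  have := hR.server₂.cum_dep_exit le_rfl (Sum.inl k) hx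
  simpa [cum_zero] using this

/-- The fluid leaving Q₂ at `t` entered it at some `x`, and by `service_mul_exit_lt` more H-fluid
has reached Q₃ than Q₃ can have served by `t`. Only knowledge of Q₁ up to time `τ` is used, which is
what makes the continuation argument possible. -/
theorem third_server_pos_of (hR : IsGadgetRun f ε μ₂ (2 * ε / 5) K K' v R)
    (hv : IsVerticalArrivals (ε ^ 2) v) (hE : IsTipProfile K ε E T₁) (h0 : 0 < ε)
    (h1 : ε < 9 / 100) (hμ0 : 0 < μ₂) (hμ : μ₂ < 2 * ε / 5 - ε ^ 2) {τ : ℝ}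
    (hτ : τ ≤ K / (1 - 2 * ε / 5))
    (hd : ∀ t, 0 ≤ t → t ≤ τ → ∑ k : Fin K, cum (R.d₁ k) t = tipDep E t) {t : ℝ} (ht : 0 < t)
    (htτ : t ≤ τ) (htT : t < K / (1 - 2 * ε / 5)) : 0 < R.h₃ t := by
  have hm : 0 < 1 - 2 * ε / 5 := by linarith
  obtain ⟨x, hx, hxt, e⟩ := hR.server₂.exists_exit_eq le_rfl ht.le
  have hx0 : 0 < x := by
    refine lt_of_le_of_ne hx fun h => ?_
    rw [← h, hR.server₂.height_zero] at e
    linarith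
  have e2 := hR.second_server_height hv hE h0 h1 hμ0 hμ hτ hd hx (hxt.trans htτ)
  have h2 := hE.service_mul_exit_lt h0 h1 (μ := 1 - μ₂) (hv.isFlow)
    (by simp [cum_zero]) (by linarith) hx0 (hxt.trans_lt htT)
  rw [← e2, e, ← hd x hx (hxt.trans htτ), ← hR.sum_d₂_exit hx, e] at h2
  have h3 := hR.server₃.sum_sub_le_height hm le_rfl ht.le
  have h4 := hR.server₃.cum_dep_sub_le hm le_rfl le_rfl ht.le
  simp only [cum_zero, zero_add, Finset.sum_sub_distrib, Finset.sum_const_zero, sub_zero] at h3 h4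
  have h5 : 0 < (1 - 2 * ε / 5) * R.h₃ t := by linarith
  exact pos_of_mul_pos_right h5 hm.le

/-- Up to the first time `r` at which Q₃ is empty it outputs at full rate. This determines Q₄ and Q₁
on [0, `r`], and thereby forces Q₃ to be nonempty at `r` itself. -/
theorem third_server_pos (hR : IsGadgetRun f ε μ₂ (2 * ε / 5) K K' v R) (hT : IsTuned K ε (f ε))
    (hf0 : ∀ t, 0 ≤ t → f 0 t = 0) (hE : IsTipProfile K ε E T₁)
    (hEφ : ∀ x, 0 ≤ x → x ≤ (K - 1) / (1 - 2 * ε / 5) →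
      E ((1 - 2 * ε / 5) * x + cum (f ε) x) = (1 - 2 * ε / 5) * x)
    (hv : IsVerticalArrivals (ε ^ 2) v) (hμ0 : 0 < μ₂) (hμ : μ₂ < 2 * ε / 5 - ε ^ 2)
    {t : ℝ} (ht : 0 < t) (htT : t < K / (1 - 2 * ε / 5)) : 0 < R.h₃ t := by
  have hm := hT.service_pos
  have hK : 0 < K := by have := hT.twenty_le; omega
  have hT1 := hE.one_le
  have hTlast := hE.lt_last
  -- During the first unit of time Q₁ emits its initial content, whatever the feedback is; this
  -- starts the continuation.
  have hsmall : ∀ x, 0 < x → x ≤ 1 → 0 < R.h₃ x := fun x hx hx1 =>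
    hR.third_server_pos_of hv hE hT.pos hT.lt hμ0 hμ (τ := 1) (by linarith)
      (fun t ht ht1 => by rw [hR.sum_d₁ hK t ht ht1, hE.tipDep_eq_self ht (by linarith)])
      hx hx1 (by linarith)
  by_contra hn
  have h1t : 1 < t := by
    by_contra h
    exact hn (hsmall t ht (not_lt.1 h))
  obtain ⟨r, hr1, hr2, hr3, hr4⟩ := exists_first_nonpos
    (hR.server₃.continuousOn_Icc zero_le_one) h1t.le (hsmall 1 one_pos le_rfl) (not_lt.1 hn)
  have hpos : ∀ x, 0 < x → x < r → 0 < R.h₃ x := by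
    intro x hx hxr
    rcases le_total x 1 with h | h
    · exact hsmall x hx h
    · exact hr4 x h hxr
  have hd : ∀ t, 0 ≤ t → t ≤ r →
      ∑ k ∈ Finset.range K, cum (R.d₃ k) t = (1 - 2 * ε / 5) * t := fun t ht htr => by
    rw [Finset.sum_range]
    exact hR.server₃.sum_cum_dep_of_busy hm ht fun x hx hxt => hpos x hx (hxt.trans_le htr)
  have hrT : r ≤ K / (1 - 2 * ε / 5) := by linarith
  have := hR.third_server_pos_of hv hE hT.pos hT.lt hμ0 hμ (τ := r) hrT
    (fun t ht htr => (hR.server₁.first_server hE hT.pos hT.lt (hR.sum_d₁ hK) hrT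
      (fun t ht htr => hR.sum_arrivalH₁_eq hT hf0 hEφ hrT hd ht htr) ht htr).2)
    (by linarith : 0 < r) le_rfl (by linarith)
  linarith

/-- `Q₃` outputs at full rate during the big loops. -/
theorem sum_d₃ (hR : IsGadgetRun f ε μ₂ (2 * ε / 5) K K' v R) (hT : IsTuned K ε (f ε))
    (hf0 : ∀ t, 0 ≤ t → f 0 t = 0) (hE : IsTipProfile K ε E T₁)
    (hEφ : ∀ x, 0 ≤ x → x ≤ (K - 1) / (1 - 2 * ε / 5) →
      E ((1 - 2 * ε / 5) * x + cum (f ε) x) = (1 - 2 * ε / 5) * x)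
    (hv : IsVerticalArrivals (ε ^ 2) v) (hμ0 : 0 < μ₂) (hμ : μ₂ < 2 * ε / 5 - ε ^ 2)
    (t : ℝ) (ht : 0 ≤ t) (htT : t ≤ K / (1 - 2 * ε / 5)) :
    ∑ k ∈ Finset.range K, cum (R.d₃ k) t = (1 - 2 * ε / 5) * t := by
  rw [Finset.sum_range]
  exact hR.server₃.sum_cum_dep_of_busy hT.service_pos ht fun x hx hxt =>
    hR.third_server_pos hT hf0 hE hEφ hv hμ0 hμ hx (hxt.trans_le htT)

end IsGadgetRun

/-! ### The small loops through Q₄ -/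

/-- The times at which the tip of session `H` arrives at `Q₄` for its visits from number `K` on. -/
noncomputable def tipArrival (K : ℕ) (ε : ℝ) (g : ℝ → ℝ) : ℕ → ℝ
  | 0 => (K - 1) / (1 - 2 * ε / 5)
  | j + 1 => K - 1 + j + cum g (tipArrival K ε g j)

namespace IsTuned

variable {K : ℕ} {ε : ℝ} {g : ℝ → ℝ}

theorem tipArrival_one (h : IsTuned K ε g) : tipArrival K ε g 1 = K / (1 - 2 * ε / 5) := by
  have := h.tuned
  simp only [tipArrival]
  push_cast
  linarith

theorem tipArrival_step (h : IsTuned K ε g) (j : ℕ) :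
    0 ≤ tipArrival K ε g j ∧ tipArrival K ε g j + 1 ≤ tipArrival K ε g (j + 1) := by
  induction j with
  | zero =>
    refine ⟨h.entry_nonneg, ?_⟩
    rw [zero_add, h.tipArrival_one]
    have h1 : (K : ℝ) / (1 - 2 * ε / 5) = (K - 1) / (1 - 2 * ε / 5) + 1 / (1 - 2 * ε / 5) := by ring
    have h2 : 1 ≤ 1 / (1 - 2 * ε / 5) := by
      rw [le_div_iff₀ h.service_pos]; linarith [h.pos]
    simp only [tipArrival]
    linarith
  | succ j ih =>
    refine ⟨by linarith [ih.1, ih.2], ?_⟩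
    have := h.isRate.cum_mono ih.1 (by linarith [ih.2] : _ ≤ tipArrival K ε g (j + 1))
    simp only [tipArrival] at this ⊢
    push_cast
    linarith

theorem tipArrival_mono (h : IsTuned K ε g) {i j : ℕ} (hij : i ≤ j) :
    tipArrival K ε g i ≤ tipArrival K ε g j := by
  induction hij with
  | refl => exact le_rfl
  | step _ ih => linarith [(h.tipArrival_step ‹_›).2]

theorem le_tipArrival (h : IsTuned K ε g) (j : ℕ) : (j : ℝ) ≤ tipArrival K ε g j := by
  induction j with
  | zero => exact_mod_cast (h.tipArrival_step 0).1
  | succ j ih => push_cast; linarith [(h.tipArrival_step j).2]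

end IsTuned

/-- The successive exit times of fluid that arrives at time `s` and goes through a server of height
`h` over and over again. -/
noncomputable def iterExit (h : ℝ → ℝ) (s : ℝ) : ℕ → ℝ
  | 0 => s
  | j + 1 => iterExit h s j + h (iterExit h s j)

theorem sum_range_sub_of_succ {A D : ℕ → ℝ} {n : ℕ} (h : ∀ j, j < n → A (j + 1) = D j) :
    ∑ j ∈ Finset.range (n + 1), (A j - D j) = A 0 - D n := by
  induction n with
  | zero => simp
  | succ n ih =>
    rw [Finset.sum_range_succ, ih fun j hj => h j (by omega), h n (by omega)]
    ring

theorem sum_range_ite_lt {n j : ℕ} (hj : j ≤ n) :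
    ∑ i ∈ Finset.range n, (if i < j then (1 : ℝ) else 0) = j := by
  rw [← Finset.sum_filter]
  have : (Finset.range n).filter (fun i => i < j) = Finset.range j := by
    ext i; simp; omega
  rw [this]
  simp

namespace IsGadgetRun

variable {L : ℕ} {R : GadgetTrajectory L} {f : ℝ → ℝ → ℝ} {ε μ₂ : ℝ} {K K' : ℕ}
  {v : Fin L → ℝ → ℝ}

theorem height₄_nonneg (hR : IsGadgetRun f ε μ₂ (2 * ε / 5) K K' v R) {t : ℝ} (ht : 0 ≤ t) :
    0 ≤ R.h₄ t := hR.server₄.height_nonneg le_rfl ht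

theorem iterExit_nonneg (hR : IsGadgetRun f ε μ₂ (2 * ε / 5) K K' v R) {s : ℝ} (hs : 0 ≤ s)
    (j : ℕ) : 0 ≤ iterExit R.h₄ s j := by
  induction j with
  | zero => exact hs
  | succ j ih => exact add_nonneg ih (hR.height₄_nonneg ih)

theorem iterExit_mono (hR : IsGadgetRun f ε μ₂ (2 * ε / 5) K K' v R) {s : ℝ} (hs : 0 ≤ s)
    {i j : ℕ} (hij : i ≤ j) : iterExit R.h₄ s i ≤ iterExit R.h₄ s j := by
  induction hij with
  | refl => exact le_rfl
  | step _ ih =>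
    exact ih.trans (le_add_of_nonneg_right (hR.height₄_nonneg (hR.iterExit_nonneg hs _)))

theorem iterExit_one (hR : IsGadgetRun f ε μ₂ (2 * ε / 5) K K' v R) (hT : IsTuned K ε (f ε))
    (hf0 : ∀ t, 0 ≤ t → f 0 t = 0)
    (hd : ∀ t, 0 ≤ t → t ≤ K / (1 - 2 * ε / 5) →
      ∑ k ∈ Finset.range K, cum (R.d₃ k) t = (1 - 2 * ε / 5) * t) :
    iterExit R.h₄ ((K - 1) / (1 - 2 * ε / 5)) 1 = K / (1 - 2 * ε / 5) := by
  obtain ⟨-, h1, -⟩ := hR.fourth_server hT hf0 (hT.entry_nonneg.trans hT.entry_le) le_rfl hd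
  have h2 := h1 _ hT.entry_nonneg hT.entry_le
  have e3 : (1 - 2 * ε / 5) * ((K - 1) / (1 - 2 * ε / 5)) = K - 1 := by
    rw [mul_comm]; exact div_mul_cancel₀ _ hT.service_pos.ne'
  have h3 := hT.tuned
  simp only [iterExit]
  linarith

/-- By time K/(1 - 2ε/5) Q₃ has put out K units, shared among K classes of at most one unit each. -/
theorem cum_d₃_eq_one (hR : IsGadgetRun f ε μ₂ (2 * ε / 5) K K' v R) (hT : IsTuned K ε (f ε))
    (hd : ∀ t, 0 ≤ t → t ≤ K / (1 - 2 * ε / 5) →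
      ∑ k ∈ Finset.range K, cum (R.d₃ k) t = (1 - 2 * ε / 5) * t) {k : ℕ} (hk : k < K) {t : ℝ}
    (ht : K / (1 - 2 * ε / 5) ≤ t) : cum (R.d₃ k) t = 1 := by
  have hT0 : 0 ≤ (K : ℝ) / (1 - 2 * ε / 5) := hT.entry_nonneg.trans hT.entry_le
  have hle : ∀ k, k < K → ∀ t, 0 ≤ t → cum (R.d₃ k) t ≤ 1 := fun k hk =>
    hR.le_one₃ hk (hR.in_turn k hk).1
  have h1 : cum (R.d₃ k) (K / (1 - 2 * ε / 5)) = 1 :=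
    eq_one_of_le_sum (D := fun k => cum (R.d₃ k) (K / (1 - 2 * ε / 5)))
      (fun k hk => hle k hk _ hT0)
      (by rw [hd _ hT0 le_rfl, mul_comm]; exact (div_mul_cancel₀ _ hT.service_pos.ne').ge) hk
  exact le_antisymm (hle k hk t (hT0.trans ht)) (h1 ▸ (hR.isRate_d₃ hk).cum_mono hT0 ht)

/-- During the small loops the fluid of session `H` circulates through `Q₄` class by class. -/
theorem cum_arrival_loop (hR : IsGadgetRun f ε μ₂ (2 * ε / 5) K K' v R) (hT : IsTuned K ε (f ε))
    (hf0 : ∀ t, 0 ≤ t → f 0 t = 0)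
    (hd : ∀ t, 0 ≤ t → t ≤ K / (1 - 2 * ε / 5) →
      ∑ k ∈ Finset.range K, cum (R.d₃ k) t = (1 - 2 * ε / 5) * t) (j : ℕ) (hj : j ≤ K') :
    (∀ t, 0 ≤ t → t ≤ iterExit R.h₄ ((K - 1) / (1 - 2 * ε / 5)) j →
      cum (R.arrivalH₄ K (K - 1 + j)) t = 0) ∧
    (∀ t, iterExit R.h₄ ((K - 1) / (1 - 2 * ε / 5)) (j + 1) ≤ t →
      cum (R.arrivalH₄ K (K - 1 + j)) t = 1) ∧
    ∀ t, 0 ≤ t → cum (R.arrivalH₄ K (K - 1 + j)) t ≤ 1 := by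
  have hK : 0 < K := by have := hT.twenty_le; omega
  induction j with
  | zero =>
    rw [add_zero, arrivalH₄_of_lt (by omega), hR.iterExit_one hT hf0 hd]
    refine ⟨fun t ht hts => hR.cum_d₃_last hK ht ?_,
      fun t ht => hR.cum_d₃_eq_one hT hd (by omega) ht,
      hR.le_one₃ (by omega) (hR.in_turn _ (by omega)).1⟩
    have hts' : t ≤ (K - 1) / (1 - 2 * ε / 5) := hts
    rw [hd t ht (hts'.trans hT.entry_le)]
    rw [le_div_iff₀ hT.service_pos] at hts'
    linarith
  | succ j ih =>
    obtain ⟨ih0, ih1, ih2⟩ := ih (by omega)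
    have hk : K - 1 + j < K + K' := by omega
    have hr := hR.isRate_d₄ hk
    rw [show K - 1 + (j + 1) = K + j by omega, arrivalH₄_add, show K + j - 1 = K - 1 + j by omega]
    have hle : ∀ t, 0 ≤ t → cum (R.d₄ (K - 1 + j)) t ≤ 1 := fun t ht =>
      (hR.server₄.cum_dep_le_cum_arr (Sum.inl (⟨K - 1 + j, hk⟩ : Fin (K + K'))) ht).trans (ih2 t ht)
    have hn := hR.iterExit_nonneg hT.entry_nonneg
    refine ⟨fun t ht hts => le_antisymm ?_ (hr.cum_nonneg ht), fun t ht =>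
      le_antisymm (hle t ((hn _).trans ht)) ?_, hle⟩
    -- Fluid that is at Q₄ when the tip arrives leaves before the tip does. The next bullet treats
    -- the end of the unit: once it has all arrived it has left one exit later.
    · have h1 := hR.cum_exit₄ hk (hn j)
      rw [ih0 _ (hn j) le_rfl] at h1
      exact h1 ▸ hr.cum_mono ht hts
    · have h1 := hR.cum_exit₄ hk (hn (j + 1))
      rw [ih1 _ le_rfl] at h1
      exact h1 ▸ hr.cum_mono (hn (j + 2)) ht

/-- Summing arrivals minus departures over the visits from K - 1 on telescopes, because the
departures of one visit are the arrivals of the next. The unit that completed its arrival for visit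
K - 1 is still in Q₄ until the tip finishes its last visit. -/
theorem one_le_height₄ (hR : IsGadgetRun f ε μ₂ (2 * ε / 5) K K' v R) (hT : IsTuned K ε (f ε))
    (hf0 : ∀ t, 0 ≤ t → f 0 t = 0)
    (hd : ∀ t, 0 ≤ t → t ≤ K / (1 - 2 * ε / 5) →
      ∑ k ∈ Finset.range K, cum (R.d₃ k) t = (1 - 2 * ε / 5) * t) {t : ℝ}
    (ht : K / (1 - 2 * ε / 5) ≤ t)
    (htP : t ≤ iterExit R.h₄ ((K - 1) / (1 - 2 * ε / 5)) (K' + 1)) : 1 ≤ R.h₄ t := by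
  have hK : 0 < K := by have := hT.twenty_le; omega
  have ht0 : 0 ≤ t := (hT.entry_nonneg.trans hT.entry_le).trans ht
  have h1 := hR.server₄.sum_sub_le_height one_pos le_rfl ht0
  rw [Fintype.sum_sum_type] at h1
  simp only [cum_zero, zero_add, Sum.elim_inl, Sum.elim_inr, Finset.univ_unique,
    Finset.sum_const, Finset.card_singleton, one_smul, one_mul] at h1
  rw [← Finset.sum_range (fun k => cum (R.arrivalH₄ K k) t - cum (R.d₄ k) t)] at h1
  have h2 := hR.server₄.cum_dep_le_cum_arr (Sum.inr ()) ht0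
  simp only [Sum.elim_inr] at h2
  have h3 : ∑ k ∈ Finset.range (K + K'), (cum (R.arrivalH₄ K k) t - cum (R.d₄ k) t) =
      ∑ k ∈ Finset.range (K - 1), (cum (R.arrivalH₄ K k) t - cum (R.d₄ k) t) +
      (cum (R.arrivalH₄ K (K - 1)) t - cum (R.d₄ (K - 1 + K')) t) := by
    rw [show K + K' = K - 1 + (K' + 1) by omega, Finset.sum_range_add,
      sum_range_sub_of_succ (A := fun j => cum (R.arrivalH₄ K (K - 1 + j)) t)
        (D := fun j => cum (R.d₄ (K - 1 + j)) t)]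
    · rfl
    · intro j _
      rw [show K - 1 + (j + 1) = K + j by omega, arrivalH₄_add,
        show K + j - 1 = K - 1 + j by omega]
  have h4 : 0 ≤ ∑ k ∈ Finset.range (K - 1), (cum (R.arrivalH₄ K k) t - cum (R.d₄ k) t) :=
    Finset.sum_nonneg fun k hk => sub_nonneg.2 (hR.server₄.cum_dep_le_cum_arr
      (Sum.inl (⟨k, by have := Finset.mem_range.1 hk; omega⟩ : Fin (K + K'))) ht0)
  have h5 : cum (R.arrivalH₄ K (K - 1)) t = 1 := by
    rw [arrivalH₄_of_lt (by omega)]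
    exact hR.cum_d₃_eq_one hT hd (by omega) ht
  have hk : K - 1 + K' < K + K' := by omega
  have h6 : cum (R.d₄ (K - 1 + K')) t = 0 := by
    have hn := hR.iterExit_nonneg hT.entry_nonneg K'
    have h7 := hR.cum_exit₄ hk hn
    rw [(hR.cum_arrival_loop hT hf0 hd K' le_rfl).1 _ hn le_rfl] at h7
    exact le_antisymm (h7 ▸ (hR.isRate_d₄ hk).cum_mono ht0 htP) ((hR.isRate_d₄ hk).cum_nonneg ht0)
  linarith

theorem height₄_pos (hR : IsGadgetRun f ε μ₂ (2 * ε / 5) K K' v R) (hT : IsTuned K ε (f ε))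
    (hf0 : ∀ t, 0 ≤ t → f 0 t = 0)
    (hd : ∀ t, 0 ≤ t → t ≤ K / (1 - 2 * ε / 5) →
      ∑ k ∈ Finset.range K, cum (R.d₃ k) t = (1 - 2 * ε / 5) * t) {t : ℝ} (ht : 0 < t)
    (htP : t ≤ iterExit R.h₄ ((K - 1) / (1 - 2 * ε / 5)) (K' + 1)) : 0 < R.h₄ t := by
  rcases le_total t (K / (1 - 2 * ε / 5)) with h | h
  · exact hR.fourth_server_busy hT hf0 le_rfl hd ht h
  · linarith [hR.one_le_height₄ hT hf0 hd h htP]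

theorem arrival_eq_one (hR : IsGadgetRun f ε μ₂ (2 * ε / 5) K K' v R) (hT : IsTuned K ε (f ε))
    (hf0 : ∀ t, 0 ≤ t → f 0 t = 0)
    (hd : ∀ t, 0 ≤ t → t ≤ K / (1 - 2 * ε / 5) →
      ∑ k ∈ Finset.range K, cum (R.d₃ k) t = (1 - 2 * ε / 5) * t) {j k : ℕ} (hj : 1 ≤ j)
    (hjK : j ≤ K' + 1) (hk : k < K - 1 + j) {t : ℝ}
    (ht : iterExit R.h₄ ((K - 1) / (1 - 2 * ε / 5)) j ≤ t) : cum (R.arrivalH₄ K k) t = 1 := by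
  rcases lt_or_ge k K with h | h
  · rw [arrivalH₄_of_lt h]
    refine hR.cum_d₃_eq_one hT hd h ?_
    rw [← hR.iterExit_one hT hf0 hd]
    exact (hR.iterExit_mono hT.entry_nonneg hj).trans ht
  · obtain ⟨i, rfl⟩ : ∃ i, k = K - 1 + i := ⟨k - (K - 1), by omega⟩
    exact (hR.cum_arrival_loop hT hf0 hd i (by omega)).2.1 t
      ((hR.iterExit_mono hT.entry_nonneg (by omega)).trans ht)

theorem rate_eq_tuned (hR : IsGadgetRun f ε μ₂ (2 * ε / 5) K K' v R) (hT : IsTuned K ε (f ε))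
    (hf0 : ∀ t, 0 ≤ t → f 0 t = 0)
    (hd : ∀ t, 0 ≤ t → t ≤ K / (1 - 2 * ε / 5) →
      ∑ k ∈ Finset.range K, cum (R.d₃ k) t = (1 - 2 * ε / 5) * t) {t : ℝ} (ht : 0 ≤ t)
    (htP : t ≤ iterExit R.h₄ ((K - 1) / (1 - 2 * ε / 5)) (K' + 1)) : R.rate t = f ε t :=
  hR.rate_eq hT.pos hT.start hT.anti hT.nonneg hf0
    (fun _ hx hxP => hR.height₄_pos hT hf0 hd hx hxP) ht htP

/-- When the tip arrives for visit K - 1 + j, with j ≥ 1, exactly K - 1 + j complete units of H have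
entered Q₄. As Q₄ has always been busy, the exit time is this number plus the total injection of S.
For j = 0 the formula is the tuning condition. -/
theorem exit_iterExit (hR : IsGadgetRun f ε μ₂ (2 * ε / 5) K K' v R) (hT : IsTuned K ε (f ε))
    (hf0 : ∀ t, 0 ≤ t → f 0 t = 0)
    (hd : ∀ t, 0 ≤ t → t ≤ K / (1 - 2 * ε / 5) →
      ∑ k ∈ Finset.range K, cum (R.d₃ k) t = (1 - 2 * ε / 5) * t) (j : ℕ) (hj : j ≤ K' + 1) :
    iterExit R.h₄ ((K - 1) / (1 - 2 * ε / 5)) (j + 1) =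
      K - 1 + j + cum (f ε) (iterExit R.h₄ ((K - 1) / (1 - 2 * ε / 5)) j) := by
  have hK : 0 < K := by have := hT.twenty_le; omega
  rcases Nat.eq_zero_or_pos j with rfl | hj0
  · rw [zero_add, hR.iterExit_one hT hf0 hd]
    simp only [iterExit]
    have := hT.tuned
    push_cast
    linarith
  have hn := hR.iterExit_nonneg hT.entry_nonneg j
  have hjP := hR.iterExit_mono hT.entry_nonneg hj
  have h1 := hR.server₄.exit_eq_of_busy hn fun x hx hxt =>
    hR.height₄_pos hT hf0 hd hx (hxt.le.trans hjP)
  rw [sum_arr₄, cum_congr hn fun s hs hst => hR.rate_eq_tuned hT hf0 hd hs (hst.trans hjP),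
    show K + K' = K - 1 + (K' + 1) by omega, Finset.sum_range_add,
    Finset.sum_congr rfl fun k hk => hR.arrival_eq_one hT hf0 hd hj0 hj
      (by have := Finset.mem_range.1 hk; omega) le_rfl] at h1
  have h2 : ∀ i ∈ Finset.range (K' + 1), cum (R.arrivalH₄ K (K - 1 + i))
      (iterExit R.h₄ ((K - 1) / (1 - 2 * ε / 5)) j) = if i < j then 1 else 0 := by
    intro i hi
    have hi' := Finset.mem_range.1 hi
    split_ifs with hij
    · exact hR.arrival_eq_one hT hf0 hd hj0 hj (by omega) le_rfl
    · exact (hR.cum_arrival_loop hT hf0 hd i (by omega)).1 _ hn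
        (hR.iterExit_mono hT.entry_nonneg (not_lt.1 hij))
  rw [Finset.sum_congr rfl h2, sum_range_ite_lt hj] at h1
  simp only [Finset.sum_const, Finset.card_range, nsmul_eq_mul, mul_one, zero_add, div_one] at h1
  rw [Nat.cast_sub (by omega), Nat.cast_one] at h1
  simp only [iterExit]
  linarith

theorem iterExit_eq_tipArrival (hR : IsGadgetRun f ε μ₂ (2 * ε / 5) K K' v R)
    (hT : IsTuned K ε (f ε)) (hf0 : ∀ t, 0 ≤ t → f 0 t = 0)
    (hd : ∀ t, 0 ≤ t → t ≤ K / (1 - 2 * ε / 5) →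
      ∑ k ∈ Finset.range K, cum (R.d₃ k) t = (1 - 2 * ε / 5) * t) (j : ℕ) (hj : j ≤ K' + 2) :
    iterExit R.h₄ ((K - 1) / (1 - 2 * ε / 5)) j = tipArrival K ε (f ε) j := by
  induction j with
  | zero => rfl
  | succ j ih =>
    rw [hR.exit_iterExit hT hf0 hd j (by omega), ih (by omega)]
    rfl

/-- The situation at the time `P` at which all fluid of session `H` is on its last visit. -/
theorem end_of_phase (hR : IsGadgetRun f ε μ₂ (2 * ε / 5) K K' v R)
    (hT : IsTuned K ε (f ε)) (hf0 : ∀ t, 0 ≤ t → f 0 t = 0)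
    (hd : ∀ t, 0 ≤ t → t ≤ K / (1 - 2 * ε / 5) →
      ∑ k ∈ Finset.range K, cum (R.d₃ k) t = (1 - 2 * ε / 5) * t) (hK' : 1 ≤ K')
    (hz : ∀ t, tipArrival K ε (f ε) K' ≤ t → f ε t = 0) :
    R.h₄ (tipArrival K ε (f ε) (K' + 1)) = 1 ∧
    stored (R.d₄ (K + K' - 1)) R.h₄ (tipArrival K ε (f ε) (K' + 1)) = 1 ∧
    (∀ k, k < K + K' - 1 → stored (R.d₄ k) R.h₄ (tipArrival K ε (f ε) (K' + 1)) = 0) ∧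
    stored R.dS R.h₄ (tipArrival K ε (f ε) (K' + 1)) = 0 ∧
    R.rate (tipArrival K ε (f ε) (K' + 1)) = 0 := by
  have hK : 0 < K := by have := hT.twenty_le; omega
  have hn := fun j => (hT.tipArrival_step j).1
  have hstep := (hT.tipArrival_step K').2
  have heq := hR.iterExit_eq_tipArrival hT hf0 hd
  -- From the moment the tip starts its last visit S injects nothing, so everything of S has left
  -- once the tip comes out again, and the spacing of the tip times has become exactly 1.
  have hF : cum (f ε) (tipArrival K ε (f ε) (K' + 1)) = cum (f ε) (tipArrival K ε (f ε) K') := by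
    refine le_antisymm ?_ (hT.isRate.cum_mono (hn _) (by linarith))
    have := hT.isRate.cum_sub_le (C := 0) (hn K') (by linarith : _ ≤ tipArrival K ε (f ε) (K' + 1))
      fun x hx => (hz x hx.1.le).le
    linarith
  have hexit : tipArrival K ε (f ε) K' + R.h₄ (tipArrival K ε (f ε) K') =
      tipArrival K ε (f ε) (K' + 1) := by
    rw [← heq K' (by omega), ← heq (K' + 1) (by omega)]; rfl
  have hrate : ∀ t, 0 ≤ t → t ≤ tipArrival K ε (f ε) (K' + 1) → R.rate t = f ε t :=
    fun t ht htP => hR.rate_eq_tuned hT hf0 hd ht (by rwa [heq _ (by omega)])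
  have hone : ∀ k, k < K + K' - 1 → ∀ t, tipArrival K ε (f ε) K' ≤ t →
      cum (R.arrivalH₄ K k) t = 1 := fun k hk t ht =>
    hR.arrival_eq_one hT hf0 hd hK' (by omega) (by omega) (by rwa [heq _ (by omega)])
  refine ⟨?_, ?_, fun k hk => ?_, ?_, ?_⟩
  · have h1 : iterExit R.h₄ ((K - 1) / (1 - 2 * ε / 5)) (K' + 2) =
      iterExit R.h₄ ((K - 1) / (1 - 2 * ε / 5)) (K' + 1) +
        R.h₄ (iterExit R.h₄ ((K - 1) / (1 - 2 * ε / 5)) (K' + 1)) := rfl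
    rw [heq _ le_rfl, heq _ (by omega)] at h1
    have h2 : tipArrival K ε (f ε) (K' + 2) =
      K - 1 + (K' + 1 : ℕ) + cum (f ε) (tipArrival K ε (f ε) (K' + 1)) := rfl
    have h3 : tipArrival K ε (f ε) (K' + 1) =
      K - 1 + K' + cum (f ε) (tipArrival K ε (f ε) K') := rfl
    push_cast at h2
    linarith
  · have h1 := hR.server₄.stored_eq le_rfl
      (Sum.inl (⟨K + K' - 1, by omega⟩ : Fin (K + K'))) (hn (K' + 1))
    have h2 := hR.cum_exit₄ (k := K + K' - 1) (by omega) (hn K')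
    rw [hexit] at h2
    simp only [Sum.elim_inl, cum_zero, zero_add] at h1
    rw [h1, h2]
    have h3 := hR.cum_arrival_loop hT hf0 hd K' le_rfl
    rw [heq _ (by omega), heq _ (by omega), show K - 1 + K' = K + K' - 1 by omega] at h3
    rw [h3.1 _ (hn K') le_rfl, h3.2.1 _ le_rfl, sub_zero]
  · have h1 := hR.server₄.stored_eq le_rfl
      (Sum.inl (⟨k, by omega⟩ : Fin (K + K'))) (hn (K' + 1))
    have h2 := hR.cum_exit₄ (k := k) (by omega) (hn K')
    rw [hexit] at h2
    simp only [Sum.elim_inl, cum_zero, zero_add] at h1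
    rw [h1, h2, hone k hk _ (by linarith), hone k hk _ le_rfl, sub_self]
  · have h2 := hR.server₄.cum_dep_exit le_rfl (Sum.inr ()) (hn K')
    simp only [Sum.elim_inr, cum_zero, zero_add] at h2
    rw [hexit] at h2
    rw [hR.stored_dS (hn _), h2, cum_congr (hn _) hrate, hF,
      cum_congr (hn _) fun s hs hst => hrate s hs (by linarith), sub_self]
  · rw [hrate _ (hn _) le_rfl, hz _ (by linarith)]

end IsGadgetRun

/-! ### The course of one phase -/

namespace IsGadgetRun

variable {L : ℕ} {R : GadgetTrajectory L} {f : ℝ → ℝ → ℝ} {ε μ₂ T₁ : ℝ} {K K' : ℕ}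
  {v : Fin L → ℝ → ℝ} {E : ℝ → ℝ}

/-- The empty servers `Q₁`, `Q₂`, `Q₃` after the big loops. -/
theorem after_big_loops (hR : IsGadgetRun f ε μ₂ (2 * ε / 5) K K' v R) (hK : 0 < K)
    (hv : IsVerticalArrivals (ε ^ 2) v) (hE : IsTipProfile K ε E T₁) (h0 : 0 < ε)
    (h1 : ε < 9 / 100) (hμ0 : 0 < μ₂) (hμ : μ₂ < 2 * ε / 5 - ε ^ 2)
    (hA : ∀ t, 0 ≤ t → t ≤ K / (1 - 2 * ε / 5) → ∑ k : Fin K, cum (R.arrivalH₁ k) t = E t)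
    (hd1 : ∀ t, 0 ≤ t → t ≤ K / (1 - 2 * ε / 5) → ∑ k : Fin K, cum (R.d₁ k) t = tipDep E t)
    (hp : ∀ t, 0 < t → t < K / (1 - 2 * ε / 5) → 0 < R.h₃ t) :
    ∀ t, K / (1 - 2 * ε / 5) ≤ t →
      ∑ k : Fin K, cum (R.d₁ k) t = K ∧ R.h₁ t = 0 ∧ R.h₂ t = 0 ∧ R.h₃ t = 0 := by
  have hm : 0 < 1 - 2 * ε / 5 := by linarith
  have hsq := sq_nonneg ε
  have hT1 := hE.one_le
  have hTl := hE.lt_last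
  obtain ⟨T, hTdef⟩ : ∃ T, T = (K : ℝ) / (1 - 2 * ε / 5) := ⟨_, rfl⟩
  have hmT : (1 - 2 * ε / 5) * T = K := by
    rw [hTdef, mul_comm]; exact div_mul_cancel₀ _ hm.ne'
  have hh1 := fun t ht htT => (hR.server₁.first_server hE h0 h1 (hR.sum_d₁ hK) le_rfl hA
    (t := t) ht htT).1
  have hh2 := fun t ht htT => hR.second_server_height hv hE h0 h1 hμ0 hμ le_rfl hd1 (t := t) ht htT
  have hV := hv.isFlow
  obtain ⟨T₂, h12, h23, -, -, hneg⟩ := hE.exists_end_of_backlog h0 h1 hV (by simp [cum_zero])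
    (μ := 1 - μ₂) (by linarith) (by linarith)
  rw [← hTdef] at hA hd1 hp hTl hh1 hh2 h23 hneg ⊢
  have hT0 : 0 < T := by linarith
  have hdT : tipDep E T = K := by have := hE.tipDep_last h0 h1; rwa [← hTdef] at this
  have hlast : E T = K - 1 := by have := hE.last; rwa [← hTdef] at this
  have hle : ∀ t, 0 ≤ t → ∑ k : Fin K, cum (R.d₁ k) t ≤ K := fun t ht => by
    refine (Finset.sum_le_sum fun (k : Fin K) _ => (hR.in_turn k k.2).1 t ht).trans ?_
    simp
  have hle2 : ∀ t, 0 ≤ t → ∑ k : Fin K, cum (R.d₂ k) t ≤ K := fun t ht => by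
    refine (Finset.sum_le_sum fun (k : Fin K) _ => hR.le_one₂ k.2 (hR.in_turn k k.2).1 t ht).trans ?_
    simp
  have hD1 : ∀ t, T ≤ t → ∑ k : Fin K, cum (R.d₁ k) t = K := fun t ht =>
    le_antisymm (hle t (by linarith)) (by
      rw [← hdT, ← hd1 T hT0.le le_rfl]
      exact Finset.sum_le_sum fun k _ => (hR.isRate_d₁ k.2).cum_mono hT0.le ht)
  -- Anything further entering Q₁ would later leave it and push its output above the K units allowed
  -- by the per-class bound.
  have hA1 : ∀ t, T ≤ t → ∑ k : Fin K, cum (R.arrivalH₁ k) t = K - 1 := by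
    intro t ht
    have ht0 : 0 ≤ t := by linarith
    refine le_antisymm ?_ ?_
    · have h2 := hle _ (add_nonneg ht0 (hR.server₁.height_nonneg zero_le_one ht0))
      have h3 : ∀ k : Fin K, cum (R.d₁ k) (t + R.h₁ t) =
          cum (R.d₁ k) 1 + cum (R.arrivalH₁ k) t := fun k =>
        hR.server₁.cum_dep_exit zero_le_one k ht0
      simp only [h3, Finset.sum_add_distrib, hR.sum_d₁ hK 1 zero_le_one le_rfl] at h2
      linarith
    · rw [← hlast, ← hA T hT0.le le_rfl]
      exact Finset.sum_le_sum fun k _ => (hR.server₁.arr k).cum_mono hT0.le ht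
  have hh1T : R.h₁ T = 0 := by
    rw [hh1 T hT0.le le_rfl, max_eq_right]
    have := hE.after h0 h1 hTl.le hTdef.le
    linarith
  have hh2T : R.h₂ T = 0 := by
    rw [hh2 T hT0.le le_rfl, max_eq_right (hneg T h23.le le_rfl)]
  have hD2 : ∀ t, T ≤ t → ∑ k : Fin K, cum (R.d₂ k) t = K := fun t ht =>
    le_antisymm (hle2 t (by linarith)) (by
      have h2 := hR.sum_d₂_exit hT0.le
      rw [hh2T, add_zero, hD1 T le_rfl] at h2
      rw [← h2]
      exact Finset.sum_le_sum fun k _ => (hR.isRate_d₂ k.2).cum_mono hT0.le ht)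
  have hh3T : R.h₃ T = 0 := by
    have h2 := hR.server₃.exit_eq_of_busy hT0.le fun x hx hxT => hp x hx hxT
    rw [hD2 T le_rfl, zero_add, ← hTdef] at h2
    linarith
  intro t ht
  refine ⟨hD1 t ht, ?_, ?_, ?_⟩
  · refine hR.server₁.eq_zero_of_arrivals_le one_pos zero_le_one hT0.le hh1T (t := t) ?_ t ht le_rfl
    intro x y hx hxy _
    rw [hA1 x hx, hA1 y (by linarith)]
    linarith
  · refine hR.server₂.eq_zero_of_arrivals_le (by linarith) le_rfl hT0.le hh2T (t := t) ?_ t ht le_rfl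
    intro x y hx hxy _
    simp only [Fintype.sum_sum_type, Sum.elim_inl, Sum.elim_inr]
    rw [hD1 x hx, hD1 y (by linarith)]
    have h2 := hV.sub_le x y (by linarith) hxy
    have h3 : ε ^ 2 * (y - x) ≤ (1 - μ₂) * (y - x) :=
      mul_le_mul_of_nonneg_right (by linarith) (by linarith)
    linarith
  · refine hR.server₃.eq_zero_of_arrivals_le hm le_rfl hT0.le hh3T (t := t) ?_ t ht le_rfl
    intro x y hx hxy _
    rw [hD2 x hx, hD2 y (by linarith), sub_self]
    exact mul_nonneg hm.le (by linarith)

/-- Assembles the formulas for the four heights. The value of `R.h₂ T₁` is kept separately, because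
the fine-tuning of μ₂ needs it. -/
theorem followsPhase (hR : IsGadgetRun f ε μ₂ (2 * ε / 5) K K' v R) (hT : IsTuned K ε (f ε))
    (hf0 : ∀ t, 0 ≤ t → f 0 t = 0) (hE : IsTipProfile K ε E T₁)
    (hEφ : ∀ x, 0 ≤ x → x ≤ (K - 1) / (1 - 2 * ε / 5) →
      E ((1 - 2 * ε / 5) * x + cum (f ε) x) = (1 - 2 * ε / 5) * x)
    (hv : IsVerticalArrivals (ε ^ 2) v) (hμ0 : 0 < μ₂) (hμ : μ₂ < 2 * ε / 5 - ε ^ 2)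
    (hK' : 1 ≤ K') (hz : ∀ t, tipArrival K ε (f ε) K' ≤ t → f ε t = 0) :
    R.h₂ T₁ = (T₁ + ∑ i, cum (v i) T₁) / (1 - μ₂) - T₁ ∧
    ∃ T₂, FollowsPhase ε (2 * ε / 5) K K' R T₁ T₂ (K / (1 - 2 * ε / 5))
        (tipArrival K ε (f ε) (K' + 1)) ∧
      (μ₂ < 2 * ε / 5 - (1 + 3 * ε / 5) * ε ^ 2 → StrictMonoOn R.h₃ (Icc T₁ T₂)) := by
  have h0 := hT.pos
  have h1 := hT.lt
  have hm := hT.service_pos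
  have hsq := sq_nonneg ε
  have hK : 0 < K := by have := hT.twenty_le; omega
  have hT1 := hE.one_le
  have hTl := hE.lt_last
  have hp := fun t ht htT => hR.third_server_pos hT hf0 hE hEφ hv hμ0 hμ (t := t) ht htT
  have hd := hR.sum_d₃ hT hf0 hE hEφ hv hμ0 hμ
  have hA := fun t ht htT => hR.sum_arrivalH₁_eq hT hf0 hEφ le_rfl hd (t := t) ht htT
  have hS1 := fun t ht htT => hR.server₁.first_server hE h0 h1 (hR.sum_d₁ hK) le_rfl hA
    (t := t) ht htT
  have hd1 := fun t ht htT => (hS1 t ht htT).2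
  have hh2 := fun t ht htT => hR.second_server_height hv hE h0 h1 hμ0 hμ le_rfl hd1 (t := t) ht htT
  have hV := hv.isFlow
  obtain ⟨V, hVdef⟩ : ∃ V : ℝ → ℝ, V = fun t => ∑ i, cum (v i) t := ⟨_, rfl⟩
  have hV0 : V 0 = 0 := by rw [hVdef]; simp [cum_zero]
  rw [← hVdef] at hV
  simp only [← hVdef] at hh2
  obtain ⟨T₂, h12, h23, hend, hpos, hneg⟩ := hE.exists_end_of_backlog h0 h1 hV hV0
    (μ := 1 - μ₂) (by linarith) (by linarith)
  have hafter := hR.after_big_loops hK hv hE h0 h1 hμ0 hμ hA hd1 hp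
  obtain ⟨hrate, hexit4, -⟩ := hR.fourth_server hT hf0 (hT.entry_nonneg.trans hT.entry_le) le_rfl hd
  -- the height of `Q₂`
  have hnn : ∀ x, 0 ≤ x → x ≤ T₂ → 0 ≤ tipExit (1 - μ₂) E V x - x := by
    intro x hx hxT
    rcases eq_or_lt_of_le hx with rfl | hx0
    · exact (hE.backlog_zero hV0).ge
    · rcases eq_or_lt_of_le hxT with rfl | hxT
      · exact hend.ge
      · exact (hpos x hx0 hxT).le
  have hh2a : ∀ x, 0 ≤ x → x ≤ T₂ → R.h₂ x = tipExit (1 - μ₂) E V x - x := fun x hx hxT => by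
    rw [hh2 x hx (by linarith), max_eq_left (hnn x hx hxT)]
  have hh2b : ∀ x, T₂ ≤ x → x ≤ K / (1 - 2 * ε / 5) → R.h₂ x = 0 := fun x hx hxT => by
    rw [hh2 x (by linarith) hxT, max_eq_right (hneg x hx hxT)]
  -- the height of `Q₃`
  have hh3 : ∀ t, 0 ≤ t → t ≤ K / (1 - 2 * ε / 5) →
      (1 - 2 * ε / 5) * (t + R.h₃ t) = ∑ k : Fin K, cum (R.d₂ k) t := fun t ht htT => by
    have := hR.server₃.exit_eq_of_busy ht fun x hx hxt => hp x hx (hxt.trans_le htT)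
    rw [this, zero_add, mul_comm]
    exact div_mul_cancel₀ _ hm.ne'
  -- Two times are pulled back to the times at which fluid leaving Q₂ then had entered it. The
  -- change of (1 - 2ε/5) `h₃` is the amount of H passed minus (1 - 2ε/5) times the change of the
  -- exit time, which is positive by `hgain`.
  have hrise : ∀ T', T' ≤ T₂ → (∀ x y, 0 ≤ x → x < y → y ≤ T' →
      (1 - 2 * ε / 5) * (tipExit (1 - μ₂) E V y - tipExit (1 - μ₂) E V x) <
        tipDep E y - tipDep E x) → StrictMonoOn R.h₃ (Icc 0 T') := by
    intro T' hT' hgain s hs t ht hst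
    obtain ⟨x, hx, hxs, ex⟩ := hR.server₂.exists_exit_eq le_rfl hs.1
    obtain ⟨y, hy, hyt, ey⟩ := hR.server₂.exists_exit_eq le_rfl ht.1
    have hxy : x < y := by
      by_contra hn
      have := hR.server₂.exit_mono (by linarith) hy (not_lt.1 hn)
      linarith
    have hyT : y ≤ T' := hyt.trans ht.2
    have g := hgain x y hx hxy hyT
    have e1 := hh2a x hx (by linarith)
    have e2 := hh2a y hy (by linarith)
    have e3 : tipExit (1 - μ₂) E V x = s := by linarith
    have e4 : tipExit (1 - μ₂) E V y = t := by linarith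
    have d1 := hR.sum_d₂_exit hx
    have d2 := hR.sum_d₂_exit hy
    rw [ex, hd1 x hx (by linarith [ht.2]), ← hh3 s hs.1 (by linarith [hs.2])] at d1
    rw [ey, hd1 y hy (by linarith [ht.2]), ← hh3 t ht.1 (by linarith [ht.2])] at d2
    rw [e3, e4, ← d1, ← d2] at g
    have : (1 - 2 * ε / 5) * R.h₃ s < (1 - 2 * ε / 5) * R.h₃ t := by linarith
    exact lt_of_mul_lt_mul_left this hm.le
  have hgain1 : ∀ x y, 0 ≤ x → x < y → y ≤ T₁ →
      (1 - 2 * ε / 5) * (tipExit (1 - μ₂) E V y - tipExit (1 - μ₂) E V x) <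
        tipDep E y - tipDep E x := fun x y hx hxy hy =>
    hE.gain_first h0 h1 hV (by linarith) hx hxy hy
  -- the height of `Q₄`
  have hh4 : StrictMonoOn R.h₄ (Icc 0 (K / (1 - 2 * ε / 5))) := by
    intro s hs t ht hst
    have e1 := hexit4 s hs.1 hs.2
    have e2 := hexit4 t ht.1 ht.2
    have e3 := hT.le_cum hs.1 hst.le ht.2
    have e4 : 0 < ε * (t - s) := mul_pos h0 (by linarith)
    linarith
  obtain ⟨hP1, hP2, hP3, hP4, hP5⟩ := hR.end_of_phase hT hf0 hd hK' hz
  have hTP : (K : ℝ) / (1 - 2 * ε / 5) < tipArrival K ε (f ε) (K' + 1) := by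
    rw [← hT.tipArrival_one]
    have e1 := hT.tipArrival_mono hK'
    have e2 := (hT.tipArrival_step K').2
    linarith
  refine ⟨?_, T₂, ?_, ?_⟩
  · rw [hh2a T₁ (by linarith) h12.le, tipExit, hE.tipDep_eq_self (by linarith) le_rfl, hVdef]
  · constructor
    case times => exact ⟨by linarith, h12, h23, hTP⟩
    case start_heights => exact ⟨hR.server₁.height_zero, hR.server₂.height_zero,
        hR.server₃.height_zero, hR.server₄.height_zero⟩
    case start_fresh =>
      have e : ∀ k, k < K → stored (R.d₁ k) R.h₁ 0 = if k = 0 then 1 else 0 := by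
        intro k hk
        rw [stored, zero_add, hR.server₁.height_zero]
        exact hR.cum_first hk zero_le_one le_rfl
      refine ⟨?_, fun k hk hkK => ?_⟩
      · rw [e 0 hK]; simp
      · rw [e k hkK, if_neg (by omega)]
    case start_rate => exact hR.rate_zero
    case fst_h₁ =>
      intro s hs t ht hst
      rw [(hS1 s hs.1 (by linarith [hs.2])).1, (hS1 t ht.1 (by linarith [ht.2])).1]
      have e1 : s < 1 + E s := hE.before s hs.1 (by linarith [ht.2])
      have e2 := hE.sub_lt_service h0 h1 hs.1 hst (by linarith [ht.2])
      have e3 : (1 - 2 * ε / 5) * (t - s) ≤ 1 * (t - s) :=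
        mul_le_mul_of_nonneg_right (by linarith) (by linarith)
      rw [max_eq_left (a := 1 + E s - s) (by linarith)]
      exact max_lt (by linarith) (by linarith)
    case fst_h₂ =>
      intro s hs t ht hst
      rw [hh2a s hs.1 (by linarith [hs.2]), hh2a t ht.1 (by linarith [ht.2])]
      exact hE.backlog_strictMonoOn hV (by linarith) (by linarith) hs.1 hst ht.2
    case fst_h₃ => exact hrise T₁ h12.le hgain1
    case fst_h₄ => exact hh4.mono (Icc_subset_Icc_right hTl.le)
    case snd_h₁ =>
      intro t ht
      rw [(hS1 t (by linarith [ht.1]) (by linarith [ht.2])).1, max_eq_right]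
      linarith [hE.after h0 h1 ht.1 (by linarith [ht.2])]
    case snd_h₂ =>
      intro s hs t ht hst
      rw [hh2a s (by linarith [hs.1]) hs.2, hh2a t (by linarith [ht.1]) ht.2]
      exact hE.backlog_strictAntiOn h0 h1 hV (by linarith) hs.1 hst (by linarith [ht.2])
    case h₃_pos => exact fun t ht => hp t ht.1 ht.2
    case snd_h₄ => exact hh4.mono (Icc_subset_Icc (by linarith) h23.le)
    case trd_h₁₂ =>
      intro t ht
      refine ⟨?_, hh2b t ht.1 ht.2⟩
      rw [(hS1 t (by linarith [ht.1]) ht.2).1, max_eq_right]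
      linarith [hE.after h0 h1 (by linarith [ht.1]) ht.2]
    case trd_h₃ =>
      intro s hs t ht hst
      have e : ∀ x ∈ Icc T₂ (K / (1 - 2 * ε / 5)),
          (1 - 2 * ε / 5) * (x + R.h₃ x) = 1 + E x := by
        intro x hx
        have e1 := hR.sum_d₂_exit (x := x) (by linarith [hx.1])
        rw [hh2b x hx.1 hx.2, add_zero, hd1 x (by linarith [hx.1]) hx.2,
          hE.tipDep_eq h0 h1 (by linarith [hx.1]) hx.2] at e1
        rw [hh3 x (by linarith [hx.1]) hx.2, e1]
      have e1 := e s hs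
      have e2 := e t ht
      have e3 := hE.sub_lt_service h0 h1 (by linarith [hs.1]) hst ht.2
      have : (1 - 2 * ε / 5) * R.h₃ t < (1 - 2 * ε / 5) * R.h₃ s := by linarith
      exact lt_of_mul_lt_mul_left this hm.le
    case trd_h₄ => exact hh4.mono (Icc_subset_Icc (by linarith) le_rfl)
    case time_T₃ => rfl
    case rate_T₃ =>
      rw [hrate _ (by linarith) le_rfl]
      have := hT.large _ (by linarith : 0 ≤ (K : ℝ) / (1 - 2 * ε / 5)) le_rfl
      linarith
    case fth =>
      intro t ht
      obtain ⟨-, e1, e2, e3⟩ := hafter t ht.1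
      refine ⟨e1, e2, e3, hR.one_le_height₄ hT hf0 hd ht.1 ?_⟩
      rw [hR.iterExit_eq_tipArrival hT hf0 hd _ (by omega)]
      exact ht.2
    case end_height => exact hP1
    case end_processed => exact ⟨hP2, hP3, hP4⟩
    case end_rate => exact hP5
    case arrivals₂ =>
      refine (IsRate.sum (u := Finset.univ) fun (k : Fin K) _ =>
        hR.isRate_d₁ k.2).ae_le_of_cum_sub_le (by linarith) hTl.le fun x y hx hxy hy => ?_
      rw [IsRate.cum_sum (fun k _ => hR.isRate_d₁ k.2) (by linarith),
        IsRate.cum_sum (fun k _ => hR.isRate_d₁ k.2) (by linarith),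
        hd1 x (by linarith) (by linarith), hd1 y (by linarith) hy,
        hE.tipDep_eq h0 h1 hx (by linarith), hE.tipDep_eq h0 h1 (by linarith) hy]
      have := hE.sub_le_service h0 h1 (by linarith) hxy hy
      linarith
    case no_arrivals₂ =>
      have hr := IsRate.sum (u := Finset.univ) fun (k : Fin K) _ => hR.isRate_d₁ k.2
      have := hr.ae_le_of_cum_sub_le (C := 0) (s := K / (1 - 2 * ε / 5)) (by linarith) hTP.le
        fun x y hx hxy hy => by
          rw [IsRate.cum_sum (fun k _ => hR.isRate_d₁ k.2) (by linarith),
            IsRate.cum_sum (fun k _ => hR.isRate_d₁ k.2) (by linarith),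
            (hafter x hx).1, (hafter y (by linarith)).1]
          linarith
      filter_upwards [this] with x hx hxI
      exact le_antisymm (hx hxI) (hr.nonneg x (by linarith [hxI.1]))
  · intro hμ'
    refine (hrise T₂ le_rfl fun x y hx hxy hy => ?_).mono (Icc_subset_Icc_left (by linarith))
    have g2 : ∀ x y, T₁ ≤ x → x < y → y ≤ T₂ →
        (1 - 2 * ε / 5) * (tipExit (1 - μ₂) E V y - tipExit (1 - μ₂) E V x) <
          tipDep E y - tipDep E x := fun x y hx hxy hy =>
      hE.gain_second h0 h1 hV (by linarith) hx hxy (by linarith)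
    rcases le_or_gt y T₁ with h | h
    · exact hgain1 x y hx hxy h
    · rcases le_or_gt T₁ x with h' | h'
      · exact g2 x y h' hxy hy
      · have a1 := hgain1 x T₁ hx h' le_rfl
        have a2 := g2 T₁ y le_rfl h hy
        linarith

end IsGadgetRun

/-! ### Existence: the circulation of H through Q₄ -/

/-- A continuous function that grows at least as fast as the identity has an inverse, which is a
flow. -/
theorem exists_flow_inverse {a : ℝ → ℝ} (hc : ContinuousOn a (Ici 0)) (h0 : a 0 = 0)
    (ha : ∀ x y, 0 ≤ x → x ≤ y → y - x ≤ a y - a x) :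
    ∃ B : ℝ → ℝ, IsFlow 1 B ∧ (∀ x, 0 ≤ x → B (a x) = x) ∧ ∀ t, 0 ≤ t → 0 ≤ B t ∧ a (B t) = t := by
  have hinv : ∀ t, ∃ x, 0 ≤ t → 0 ≤ x ∧ a x = t := by
    intro t
    by_cases ht : 0 ≤ t
    · obtain ⟨x, hx, e⟩ := intermediate_value_Icc ht (hc.mono Icc_subset_Ici_self)
        (show t ∈ Icc _ _ from ⟨by rwa [h0], by have := ha 0 t le_rfl ht; linarith⟩)
      exact ⟨x, fun _ => ⟨hx.1, e⟩⟩
    · exact ⟨0, fun h => absurd h ht⟩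
  choose B hB using hinv
  have hle : ∀ x y, 0 ≤ x → 0 ≤ y → a x ≤ a y → x ≤ y := by
    intro x y hx hy hxy
    by_contra hn
    have := ha y x hy (not_le.1 hn).le
    linarith [not_le.1 hn]
  have hmono : ∀ s t, 0 ≤ s → s ≤ t → B s ≤ B t := fun s t hs hst =>
    hle _ _ (hB s hs).1 (hB t (hs.trans hst)).1
      (by rwa [(hB s hs).2, (hB t (hs.trans hst)).2])
  refine ⟨B, ⟨hmono, fun s t hs hst => ?_⟩, fun x hx => ?_, fun t ht => hB t ht⟩
  · have := ha (B s) (B t) (hB s hs).1 (hmono s t hs hst)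
    rw [(hB s hs).2, (hB t (hs.trans hst)).2] at this
    linarith
  · have hax : 0 ≤ a x := by have := ha 0 x le_rfl hx; linarith
    exact le_antisymm (hle _ _ (hB _ hax).1 hx (hB _ hax).2.le)
      (hle _ _ hx (hB _ hax).1 (hB _ hax).2.ge)

/-- The time at which the fluid of session `H` that has got through `x` units of work arrives at
`Q₄`, as far as `n` small loops can tell. -/
noncomputable def arrivalTime (K : ℕ) (ε : ℝ) (g : ℝ → ℝ) : ℕ → ℝ → ℝ
  | 0 => fun x => x / (1 - 2 * ε / 5)
  -- For `x ≤ K` everything but the first quotient cancels by tuning; for `x ≥ K` the quotients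
  -- cancel and the delay recursion remains. Joining the branches by `min` and `max` makes
  -- continuity at `K` automatic.
  | n + 1 => fun x => min x K / (1 - 2 * ε / 5) +
      (max x K - 1 + cum g (arrivalTime K ε g n (max x K - 1))) - K / (1 - 2 * ε / 5)

/-- The cumulative arrivals `B` and departures `E` of session `H` at `Q₄`, if session `S` injects at
rate `g` and session `H` never leaves the gadget. -/
structure IsCirculation (K : ℕ) (ε : ℝ) (g B E : ℝ → ℝ) : Prop where
  arr : IsFlow 1 B
  dep : IsFlow 1 E
  arr_zero : B 0 = 0
  dep_zero : E 0 = 0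
  arr_eq : ∀ t, 0 ≤ t → t ≤ K / (1 - 2 * ε / 5) → B t = (1 - 2 * ε / 5) * t
  exit : ∀ t, 0 ≤ t → E (B t + cum g t) = B t
  dep_eq : ∀ t, K / (1 - 2 * ε / 5) ≤ t → E t = B t - 1
  surj : ∀ u, 0 ≤ u → ∃ t, 0 ≤ t ∧ B t + cum g t = u
  lt_exit : ∀ t, 0 < t → t < B t + cum g t
  arr_tip : ∀ j, B (tipArrival K ε g j) = K - 1 + j

namespace IsTuned

variable {K : ℕ} {ε : ℝ} {g : ℝ → ℝ}

theorem arrivalTime_of_le (h : IsTuned K ε g) (n : ℕ) {x : ℝ} (hx : x ≤ K) :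
    arrivalTime K ε g n x = x / (1 - 2 * ε / 5) := by
  induction n generalizing x with
  | zero => rfl
  | succ n ih =>
    simp only [arrivalTime]
    rw [min_eq_left hx, max_eq_right hx, ih (by linarith)]
    linarith [h.tuned]

theorem arrivalTime_sub (h : IsTuned K ε g) (n : ℕ) (x y : ℝ) (hx : 0 ≤ x) (hxy : x ≤ y) :
    y - x ≤ arrivalTime K ε g n y - arrivalTime K ε g n x := by
  have hm := h.service_pos
  have hdiv : ∀ x y : ℝ, x ≤ y → y - x ≤ y / (1 - 2 * ε / 5) - x / (1 - 2 * ε / 5) := by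
    intro x y hxy
    rw [← sub_div, le_div_iff₀ hm]
    nlinarith [h.pos]
  have hK := h.twenty_le_cast
  induction n generalizing x y with
  | zero => exact hdiv x y hxy
  | succ n ih =>
    simp only [arrivalTime]
    have e1 := hdiv _ _ (min_le_min_right (K : ℝ) hxy)
    have e2 : max x (K : ℝ) - 1 ≤ max y (K : ℝ) - 1 := by
      linarith [max_le_max_right (K : ℝ) hxy]
    have hx1 : 0 ≤ max x (K : ℝ) - 1 := by linarith [le_max_right x (K : ℝ)]
    have e3 := ih (max x K - 1) (max y K - 1) hx1 e2
    have e5 := ih 0 (max x K - 1) le_rfl hx1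
    have e6 : arrivalTime K ε g n 0 = 0 := by
      rw [h.arrivalTime_of_le n (by linarith), zero_div]
    have e4 := h.isRate.cum_mono (s := arrivalTime K ε g n (max x K - 1))
      (t := arrivalTime K ε g n (max y K - 1)) (by linarith) (by linarith)
    have e7 := min_add_max x (K : ℝ)
    have e8 := min_add_max y (K : ℝ)
    linarith

theorem arrivalTime_zero (h : IsTuned K ε g) (n : ℕ) : arrivalTime K ε g n 0 = 0 := by
  rw [h.arrivalTime_of_le n (by linarith [h.twenty_le_cast]), zero_div]

theorem le_arrivalTime (h : IsTuned K ε g) (n : ℕ) {x : ℝ} (hx : 0 ≤ x) :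
    x ≤ arrivalTime K ε g n x := by
  have := h.arrivalTime_sub n 0 x le_rfl hx
  rw [h.arrivalTime_zero] at this
  linarith

theorem continuousOn_arrivalTime (h : IsTuned K ε g) (n : ℕ) :
    ContinuousOn (arrivalTime K ε g n) (Ici 0) := by
  have hK := h.twenty_le_cast
  induction n with
  | zero => exact continuousOn_id.div_const _
  | succ n ih =>
    have hmax : Continuous fun x : ℝ => max x (K : ℝ) - 1 := by fun_prop
    have hnn : ∀ x : ℝ, 0 ≤ max x (K : ℝ) - 1 := fun x => by linarith [le_max_right x (K : ℝ)]
    have h1 : Continuous fun x : ℝ => arrivalTime K ε g n (max x K - 1) :=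
      ih.comp_continuous hmax hnn
    have h2 : Continuous fun x : ℝ => cum g (arrivalTime K ε g n (max x K - 1)) :=
      h.isRate.continuousOn_cum.comp_continuous h1 fun x =>
        (hnn x).trans (h.le_arrivalTime n (hnn x))
    have h3 : Continuous fun x : ℝ => min x (K : ℝ) / (1 - 2 * ε / 5) := by fun_prop
    exact ((h3.add (hmax.add h2)).sub continuous_const).continuousOn

theorem cum_eventually (h : IsTuned K ε g) {t₀ s t : ℝ} (h0 : 0 ≤ t₀) (hz : ∀ t, t₀ ≤ t → g t = 0)
    (hs : t₀ ≤ s) (ht : t₀ ≤ t) : cum g s = cum g t := by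
  wlog hst : s ≤ t generalizing s t
  · exact (this ht hs (not_le.1 hst).le).symm
  refine le_antisymm (h.isRate.cum_mono (h0.trans hs) hst) ?_
  have := h.isRate.cum_sub_le (C := 0) (h0.trans hs) hst fun x hx => (hz x (hs.trans hx.1.le)).le
  linarith

theorem arrivalTime_succ_of_ge (n : ℕ) {x : ℝ} (hx : K ≤ x) :
    arrivalTime K ε g (n + 1) x = x - 1 + cum g (arrivalTime K ε g n (x - 1)) := by
  simp only [arrivalTime]
  rw [min_eq_right hx, max_eq_left hx]
  ring

/-- The iterates `n` and `n + 1` agree up to `K + n`. Taking `n ≥ t₀`, both exceed `t₀` beyond that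
point, where the cumulative injection is constant, so iterate `n + 1` solves the delay equation
everywhere. -/
theorem exists_arrivalTime (h : IsTuned K ε g) : ∃ a : ℝ → ℝ, ContinuousOn a (Ici 0) ∧
    (∀ x : ℝ, x ≤ K → a x = x / (1 - 2 * ε / 5)) ∧ (∀ x y, 0 ≤ x → x ≤ y → y - x ≤ a y - a x) ∧
    ∀ x : ℝ, K ≤ x → a x = x - 1 + cum g (a (x - 1)) := by
  obtain ⟨t₀, h0, hz⟩ := h.to_zero
  have hK := h.twenty_le_cast
  have hstep : ∀ n : ℕ, ∀ x : ℝ, x ≤ K + n →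
      arrivalTime K ε g (n + 1) x = arrivalTime K ε g n x := by
    intro n
    induction n with
    | zero =>
      intro x hx
      have hx' : x ≤ K := by simpa using hx
      rw [h.arrivalTime_of_le _ hx', h.arrivalTime_of_le _ hx']
    | succ n ih =>
      intro x hx
      rcases le_total x K with hxK | hxK
      · rw [h.arrivalTime_of_le _ hxK, h.arrivalTime_of_le _ hxK]
      · push_cast at hx
        rw [arrivalTime_succ_of_ge _ hxK, arrivalTime_succ_of_ge _ hxK, ih (x - 1) (by linarith)]
  obtain ⟨n, hn⟩ := exists_nat_ge t₀
  refine ⟨arrivalTime K ε g (n + 1), h.continuousOn_arrivalTime _,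
    fun x hx => h.arrivalTime_of_le _ hx, h.arrivalTime_sub _, fun x hx => ?_⟩
  rw [arrivalTime_succ_of_ge _ hx]
  congr 1
  rcases le_total (x - 1) (K + n) with h1 | h1
  · rw [hstep n _ h1]
  · have hx1 : 0 ≤ x - 1 := by linarith
    exact h.cum_eventually h0.le hz (le_trans (by linarith) (h.le_arrivalTime n hx1))
      (le_trans (by linarith) (h.le_arrivalTime (n + 1) hx1))

/-- The arrivals invert `a`, the arrival time as a function of work; the departures invert the exit
time x + ∫₀^{a x} g. The delay equation states that exit with `x - 1` units is arrival with `x`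
units, which is the relation between arrivals and departures after the big loops. -/
theorem exists_isCirculation (h : IsTuned K ε g) : ∃ B E : ℝ → ℝ, IsCirculation K ε g B E := by
  have hK := h.twenty_le_cast
  have hm := h.service_pos
  obtain ⟨a, hac, hsmall, hsub, hbig⟩ := h.exists_arrivalTime
  have ha0 : a 0 = 0 := by rw [hsmall 0 (by linarith), zero_div]
  have hann : ∀ x, 0 ≤ x → 0 ≤ a x := fun x hx => by
    have := hsub 0 x le_rfl hx
    linarith
  obtain ⟨B, hB, hBa, haB⟩ := exists_flow_inverse hac ha0 hsub
  have hec : ContinuousOn (fun x => x + cum g (a x)) (Ici 0) :=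
    continuousOn_id.add (h.isRate.continuousOn_cum.comp hac fun x hx => hann x hx)
  obtain ⟨E, hE, hEe, heE⟩ := exists_flow_inverse (a := fun x => x + cum g (a x)) hec
    (by simp [ha0, cum_zero]) fun x y hx hxy => by
      have := h.isRate.cum_mono (s := a x) (t := a y) (hann x hx) (by linarith [hsub x y hx hxy])
      linarith
  have hEB : ∀ t, 0 ≤ t → E (B t + cum g t) = B t := fun t ht => by
    have := hEe (B t) (haB t ht).1
    rwa [(haB t ht).2] at this
  have hBT : ∀ t, K / (1 - 2 * ε / 5) ≤ t → K ≤ B t := fun t ht => by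
    have h0 := h.entry_nonneg.trans h.entry_le
    have := hB.mono _ t h0 ht
    rwa [← hsmall K le_rfl, hBa K (by linarith)] at this
  have hBsmall : ∀ t, 0 ≤ t → t ≤ K / (1 - 2 * ε / 5) → B t = (1 - 2 * ε / 5) * t := by
    intro t ht htT
    have h1 : (1 - 2 * ε / 5) * t ≤ K := by rw [le_div_iff₀ hm] at htT; linarith
    have h2 := hBa ((1 - 2 * ε / 5) * t) (mul_nonneg hm.le ht)
    rwa [hsmall _ h1, mul_div_cancel_left₀ _ hm.ne'] at h2
  refine ⟨B, E, hB, hE, ?_, ?_, hBsmall, hEB, ?_, ?_, ?_, ?_⟩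
  · have := hBa 0 le_rfl
    rwa [ha0] at this
  · have := hEe 0 le_rfl
    rwa [ha0, cum_zero, add_zero] at this
  · intro t ht
    have h0 : 0 ≤ t := (h.entry_nonneg.trans h.entry_le).trans ht
    have h1 := hBT t ht
    have h2 := hEe (B t - 1) (by linarith)
    rwa [← hbig (B t) h1, (haB t h0).2] at h2
  · intro u hu
    refine ⟨a (E u), hann _ (heE u hu).1, ?_⟩
    rw [hBa _ (heE u hu).1]
    exact (heE u hu).2
  · intro t ht
    rcases le_total t (K / (1 - 2 * ε / 5)) with h1 | h1
    · rw [hBsmall t ht.le h1]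
      have h2 := h.le_cum le_rfl ht.le h1
      rw [cum_zero] at h2
      have h3 := mul_pos h.pos ht
      linarith
    · have h2 := hBT t h1
      have h3 := hbig (B t + 1) (by linarith)
      have h4 := hsub (B t) (B t + 1) (by linarith) (by linarith)
      rw [add_sub_cancel_right, (haB t ht.le).2] at h3
      rw [(haB t ht.le).2] at h4
      linarith
  · intro j
    have key : ∀ j : ℕ, a (K - 1 + j) = tipArrival K ε g j := by
      intro j
      induction j with
      | zero =>
        rw [Nat.cast_zero, add_zero, hsmall _ (by linarith)]
        rfl
      | succ j ih =>
        have hj : (0 : ℝ) ≤ j := Nat.cast_nonneg j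
        push_cast
        rw [hbig _ (by linarith), show (K : ℝ) - 1 + (j + 1) - 1 = K - 1 + j by ring, ih]
        rfl
    rw [← key j]
    exact hBa _ (by have : (0 : ℝ) ≤ j := Nat.cast_nonneg j; linarith)

end IsTuned

/-! ### Cutting a flow into visits -/

/-- The part of the first `x` units of work that belongs to visit number `k`. -/
noncomputable def visitPart (k : ℕ) (x : ℝ) : ℝ := max 0 (min 1 (x - k))

theorem visitPart_mono (k : ℕ) {x y : ℝ} (h : x ≤ y) : visitPart k x ≤ visitPart k y :=
  max_le_max_left 0 (min_le_min_left 1 (by linarith))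

theorem visitPart_of_le {k : ℕ} {x : ℝ} (h : x ≤ k) : visitPart k x = 0 :=
  max_eq_left ((min_le_right _ _).trans (by linarith))

theorem visitPart_of_ge {k : ℕ} {x : ℝ} (h : (k : ℝ) + 1 ≤ x) : visitPart k x = 1 := by
  rw [visitPart, min_eq_left (by linarith), max_eq_right zero_le_one]

theorem visitPart_of_mem {k : ℕ} {x : ℝ} (h : (k : ℝ) ≤ x) (h' : x ≤ k + 1) :
    visitPart k x = x - k := by
  rw [visitPart, min_eq_right (by linarith), max_eq_right (by linarith)]

theorem visitPart_sub_le (k : ℕ) {x y : ℝ} (h : x ≤ y) : visitPart k y - visitPart k x ≤ y - x := by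
  simp only [visitPart]
  rcases max_cases 0 (min 1 (y - k)) with ⟨e, _⟩ | ⟨e, _⟩ <;>
    rcases max_cases 0 (min 1 (x - k)) with ⟨e', _⟩ | ⟨e', _⟩ <;>
      rcases min_cases 1 (x - (k : ℝ)) with ⟨e2, _⟩ | ⟨e2, _⟩ <;>
        rcases min_cases 1 (y - (k : ℝ)) with ⟨e3, _⟩ | ⟨e3, _⟩ <;> linarith

theorem visitPart_succ (k : ℕ) (x : ℝ) : visitPart (k + 1) x = visitPart k (x - 1) := by
  simp only [visitPart]
  push_cast
  congr 2
  ring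

theorem visitPart_min {k n : ℕ} (h : k < n) (x : ℝ) : visitPart k (min x n) = visitPart k x := by
  rcases le_total x n with h1 | h1
  · rw [min_eq_left h1]
  · have : (k : ℝ) + 1 ≤ n := by exact_mod_cast h
    rw [min_eq_right h1, visitPart_of_ge this, visitPart_of_ge (this.trans h1)]

theorem sum_visitPart (n : ℕ) {x : ℝ} (hx : 0 ≤ x) :
    ∑ k ∈ Finset.range n, visitPart k x = min x n := by
  induction n with
  | zero => simp [hx]
  | succ n ih =>
    rw [Finset.sum_range_succ, ih]
    push_cast
    rcases le_total x n with h | h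
    · rw [visitPart_of_le h, min_eq_left h, min_eq_left (by linarith), add_zero]
    · rcases le_total x (n + 1) with h' | h'
      · rw [visitPart_of_mem h h', min_eq_right h, min_eq_left h']
        ring
      · rw [visitPart_of_ge h', min_eq_right h, min_eq_right h']

/-- The rate of the fluid making visit number `k`, if `G` is the cumulative flow of all visits. -/
noncomputable def visitRate (G : ℝ → ℝ) (k : ℕ) : ℝ → ℝ := rateOf fun t => visitPart k (G t)

namespace IsFlow

variable {C : ℝ} {G : ℝ → ℝ}

theorem visitPart (hG : IsFlow C G) (k : ℕ) : IsFlow C fun t => visitPart k (G t) :=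
  ⟨fun s t hs hst => visitPart_mono k (hG.mono s t hs hst), fun s t hs hst =>
    (visitPart_sub_le k (hG.mono s t hs hst)).trans (hG.sub_le s t hs hst)⟩

theorem isRate_visitRate (hC : 0 ≤ C) (hG : IsFlow C G) (k : ℕ) : IsRate (visitRate G k) :=
  (hG.visitPart k).isRate hC

theorem cum_visitRate (hC : 0 ≤ C) (hG : IsFlow C G) (h0 : G 0 = 0) (k : ℕ) {t : ℝ} (ht : 0 ≤ t) :
    cum (visitRate G k) t = _root_.visitPart k (G t) := by
  rw [visitRate, (hG.visitPart k).cum_rateOf hC ht, h0, visitPart_of_le (Nat.cast_nonneg k),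
    sub_zero]

theorem min_const (hG : IsFlow C G) (hC : 0 ≤ C) (c : ℝ) : IsFlow C fun t => min (G t) c := by
  refine ⟨fun s t hs hst => min_le_min_right c (hG.mono s t hs hst), fun s t hs hst => ?_⟩
  have h1 := hG.sub_le s t hs hst
  have h2 : 0 ≤ C * (t - s) := mul_nonneg hC (by linarith)
  have h3 := min_le_left (G t) c
  have h4 := min_le_right (G t) c
  rcases min_cases (G s) c with ⟨e, _⟩ | ⟨e, _⟩ <;> linarith

end IsFlow

theorem IsTipProfile.congr {K : ℕ} {ε T₁ : ℝ} {E E' : ℝ → ℝ} (h : IsTipProfile K ε E T₁)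
    (he : ∀ t, 0 ≤ t → t ≤ K / (1 - 2 * ε / 5) → E' t = E t) : IsTipProfile K ε E' T₁ where
  zero := by rw [he 0 le_rfl (by linarith [h.one_le, h.lt_last]), h.zero]
  last := by rw [he _ (by linarith [h.one_le, h.lt_last]) le_rfl, h.last]
  sub_le s t hs hst ht := by
    rw [he t (hs.trans hst) ht, he s hs (hst.trans ht)]
    exact h.sub_le s t hs hst ht
  le_sub s t hs hst ht := by
    rw [he t (hs.trans hst) ht, he s hs (hst.trans ht)]
    exact h.le_sub s t hs hst ht
  lt_one_add t ht ht' := by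
    rw [he t ht ht'.le]
    exact h.lt_one_add t ht ht'
  one_le := h.one_le
  lt_last := h.lt_last
  before t ht ht' := by
    rw [he t ht (ht'.trans h.lt_last).le]
    exact h.before t ht ht'
  turn := by rw [he T₁ (by linarith [h.one_le]) h.lt_last.le, h.turn]
  lower := h.lower
  upper := h.upper

/-! ### Existence: verification of the servers and of the flow control -/

/-- The cumulative departures of session `H` from `Q₁`, at all times. -/
noncomputable def firstDep (K : ℕ) (E : ℝ → ℝ) (t : ℝ) : ℝ := min t (1 + min (E t) (K - 1))

namespace IsCirculation

variable {K : ℕ} {ε T₁ : ℝ} {g B E : ℝ → ℝ}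

theorem dep_eq_of_tip (h : IsCirculation K ε g B E) (hT : IsTuned K ε g) {E' : ℝ → ℝ}
    (hE' : ∀ x, 0 ≤ x → x ≤ (K - 1) / (1 - 2 * ε / 5) →
      E' ((1 - 2 * ε / 5) * x + cum g x) = (1 - 2 * ε / 5) * x) {t : ℝ} (ht : 0 ≤ t)
    (ht' : t ≤ K / (1 - 2 * ε / 5)) : E t = E' t := by
  obtain ⟨x, hx, rfl⟩ := h.surj t ht
  have hs := hT.entry_nonneg
  have hxs : x ≤ (K - 1) / (1 - 2 * ε / 5) := by
    by_contra hn
    push Not at hn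
    have e1 := h.arr.mono _ _ hs hn.le
    have e2 := hT.isRate.cum_mono hs hn.le
    have e3 := h.arr_eq _ hs hT.entry_le
    rw [mul_div_cancel₀ _ hT.service_pos.ne'] at e3
    have e4 := hT.tuned
    -- If `x` came after the tip, both would exit at K/(1 - 2ε/5) and hence have equal cumulative
    -- arrivals, but `B` increases strictly just after the tip.
    have e5 : B x + cum g x = B ((K - 1) / (1 - 2 * ε / 5)) + cum g ((K - 1) / (1 - 2 * ε / 5)) := by
      linarith
    have e6 := h.exit x hx
    rw [e5, h.exit _ hs, e3] at e6
    have e7 : (K - 1) / (1 - 2 * ε / 5) < min x (K / (1 - 2 * ε / 5)) := by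
      refine lt_min hn (div_lt_div_of_pos_right (by linarith) hT.service_pos)
    have e8 := h.arr.mono _ _ (by linarith) (min_le_left x (K / (1 - 2 * ε / 5)))
    rw [h.arr_eq _ (by linarith) (min_le_right _ _)] at e8
    have e9 := mul_lt_mul_of_pos_left e7 hT.service_pos
    rw [mul_div_cancel₀ _ hT.service_pos.ne'] at e9
    linarith
  have e := h.arr_eq x hx (hxs.trans hT.entry_le)
  rw [h.exit x hx, e, hE' x hx hxs]

theorem dep_nonneg (h : IsCirculation K ε g B E) {t : ℝ} (ht : 0 ≤ t) : 0 ≤ E t := by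
  have := h.dep.mono 0 t le_rfl ht
  rwa [h.dep_zero] at this

theorem arr_nonneg (h : IsCirculation K ε g B E) {t : ℝ} (ht : 0 ≤ t) : 0 ≤ B t := by
  have := h.arr.mono 0 t le_rfl ht
  rwa [h.arr_zero] at this

theorem dep_le (h : IsCirculation K ε g B E) (hE : IsTipProfile K ε E T₁) {t : ℝ} (ht : 0 ≤ t)
    (ht' : t ≤ K / (1 - 2 * ε / 5)) : E t ≤ K - 1 := by
  rw [← hE.last]
  exact h.dep.mono t _ ht ht'

theorem le_dep (h : IsCirculation K ε g B E) (hE : IsTipProfile K ε E T₁) {t : ℝ}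
    (ht : K / (1 - 2 * ε / 5) ≤ t) : K - 1 ≤ E t := by
  rw [← hE.last]
  exact h.dep.mono _ t (by linarith [hE.one_le, hE.lt_last]) ht

/-- Consistency of the small loops. After the big loops the two curves differ by exactly one unit,
which is one visit; before, neither the departures of visit k - 1 nor the arrivals of visit k have
begun. -/
theorem visitPart_dep (h : IsCirculation K ε g B E) (hT : IsTuned K ε g)
    (hE : IsTipProfile K ε E T₁) {k : ℕ} (hk : K ≤ k) {t : ℝ} (ht : 0 ≤ t) :
    visitPart (k - 1) (E t) = visitPart k (B t) := by
  have hK := hT.twenty_le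
  obtain ⟨j, rfl⟩ : ∃ j, k = j + 1 := ⟨k - 1, by omega⟩
  have hk' : (K : ℝ) ≤ j + 1 := by exact_mod_cast hk
  rw [Nat.add_sub_cancel, visitPart_succ]
  rcases le_total t (K / (1 - 2 * ε / 5)) with h1 | h1
  · have e1 := h.dep_le hE ht h1
    have e2 := h.arr_eq t ht h1
    rw [le_div_iff₀ hT.service_pos] at h1
    rw [visitPart_of_le (by linarith), visitPart_of_le (by linarith)]
  · rw [h.dep_eq t h1]

theorem isFlow_firstDep (h : IsCirculation K ε g B E) : IsFlow 1 (firstDep K E) := by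
  have hm := h.dep.min_const zero_le_one ((K : ℝ) - 1)
  refine ⟨fun s t hs hst => min_le_min hst (by linarith [hm.mono s t hs hst]),
    fun s t hs hst => ?_⟩
  have h1 := hm.sub_le s t hs hst
  have h2 := min_le_left t (1 + min (E t) (K - 1))
  have h3 := min_le_right t (1 + min (E t) (K - 1))
  simp only [firstDep]
  rcases min_cases s (1 + min (E s) (K - 1)) with ⟨e, _⟩ | ⟨e, _⟩ <;> linarith

theorem firstDep_zero (h : IsCirculation K ε g B E) (hT : IsTuned K ε g) : firstDep K E 0 = 0 := by
  rw [firstDep, h.dep_zero, min_eq_left (by linarith [hT.twenty_le_cast] : (0 : ℝ) ≤ K - 1)]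
  norm_num

theorem firstDep_le (K : ℕ) (E : ℝ → ℝ) (t : ℝ) : firstDep K E t ≤ K := by
  have h1 := min_le_right t (1 + min (E t) ((K : ℝ) - 1))
  have h2 := min_le_right (E t) ((K : ℝ) - 1)
  rw [firstDep]
  linarith

theorem firstDep_eq (h : IsCirculation K ε g B E) (hE : IsTipProfile K ε E T₁) {t : ℝ} (ht : 0 ≤ t)
    (ht' : t ≤ K / (1 - 2 * ε / 5)) : firstDep K E t = tipDep E t := by
  rw [firstDep, min_eq_left (h.dep_le hE ht ht'), tipDep]

theorem firstDep_of_ge (h : IsCirculation K ε g B E) (hT : IsTuned K ε g)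
    (hE : IsTipProfile K ε E T₁) {t : ℝ} (ht : K / (1 - 2 * ε / 5) ≤ t) : firstDep K E t = K := by
  have h1 : (K : ℝ) ≤ K / (1 - 2 * ε / 5) := by
    rw [le_div_iff₀ hT.service_pos]
    nlinarith [hT.pos, hT.twenty_le_cast]
  rw [firstDep, min_eq_right (h.le_dep hE ht), min_eq_right (by linarith)]
  ring

theorem firstDep_sub_le (h : IsCirculation K ε g B E) (hT : IsTuned K ε g)
    (hE : IsTipProfile K ε E T₁) {x y : ℝ} (hx : T₁ ≤ x) (hxy : x ≤ y) :
    firstDep K E y - firstDep K E x ≤ (1 - 2 * ε / 5) * (y - x) := by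
  have h0 : 0 ≤ x := by linarith [hE.one_le]
  have hm := hT.service_pos
  have hle : ∀ y, x ≤ y → y ≤ K / (1 - 2 * ε / 5) →
      firstDep K E y - firstDep K E x ≤ (1 - 2 * ε / 5) * (y - x) := fun y hxy hy => by
    rw [h.firstDep_eq hE (h0.trans hxy) hy, h.firstDep_eq hE h0 (hxy.trans hy),
      hE.tipDep_eq hT.pos hT.lt (hx.trans hxy) hy, hE.tipDep_eq hT.pos hT.lt hx (hxy.trans hy)]
    linarith [hE.sub_le_service hT.pos hT.lt h0 hxy hy]
  rcases le_total y (K / (1 - 2 * ε / 5)) with h1 | h1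
  · exact hle y hxy h1
  · rcases le_total x (K / (1 - 2 * ε / 5)) with h2 | h2
    · have e1 := hle _ h2 le_rfl
      rw [h.firstDep_of_ge hT hE le_rfl] at e1
      rw [h.firstDep_of_ge hT hE h1]
      have := mul_le_mul_of_nonneg_left h1 hm.le
      linarith
    · rw [h.firstDep_of_ge hT hE h1, h.firstDep_of_ge hT hE h2, sub_self]
      exact mul_nonneg hm.le (by linarith)

end IsCirculation

namespace IsCirculation

variable {K : ℕ} {ε T₁ μ₂ : ℝ} {g B E : ℝ → ℝ} {L : ℕ} {v : Fin L → ℝ → ℝ}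

theorem cum_arrivalH₁_succ (h : IsCirculation K ε g B E) {R : GadgetTrajectory L}
    (hd₄ : ∀ k, R.d₄ k = visitRate E k) (k : ℕ) {t : ℝ} (ht : 0 ≤ t) :
    cum (R.arrivalH₁ (k + 1)) t = visitPart k (E t) := by
  rw [← h.dep.cum_visitRate zero_le_one h.dep_zero k ht, ← hd₄ k]
  rfl

theorem sum_cum_arrivalH₁ (h : IsCirculation K ε g B E) (hT : IsTuned K ε g)
    {R : GadgetTrajectory L} (hd₄ : ∀ k, R.d₄ k = visitRate E k) {t : ℝ} (ht : 0 ≤ t) :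
    ∑ k : Fin K, cum (R.arrivalH₁ k) t = min (E t) (K - 1) := by
  have hK : 0 < K := by have := hT.twenty_le; omega
  rw [IsGadgetRun.sum_arrivalH₁ hK, ← Nat.cast_pred hK, ← sum_visitPart _ (h.dep_nonneg ht)]
  refine Finset.sum_congr rfl fun k _ => ?_
  rw [hd₄, h.dep.cum_visitRate zero_le_one h.dep_zero k ht]

theorem first_server (h : IsCirculation K ε g B E) (hT : IsTuned K ε g)
    (hE : IsTipProfile K ε E T₁) {R : GadgetTrajectory L} (hd₄ : ∀ k, R.d₄ k = visitRate E k)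
    (hd₁ : ∀ k, R.d₁ k = visitRate (firstDep K E) k)
    (hh : R.h₁ = fun t => max (workload 1 1 (fun k : Fin K => R.arrivalH₁ k) t) 0) :
    IsFIFOServer (ι := Fin K) 1 1 (fun k _ => if (k : ℕ) = 0 then 1 else 0)
      (fun k => R.arrivalH₁ k) (fun k => R.d₁ k) R.h₁ := by
  have hK := hT.twenty_le_cast
  have hD := h.isFlow_firstDep
  have hm := h.dep.min_const zero_le_one ((K : ℝ) - 1)
  have hw : ∀ t, 0 ≤ t → workload 1 1 (fun k : Fin K => R.arrivalH₁ k) t =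
      1 + min (E t) (K - 1) - t := fun t ht => by
    rw [workload, h.sum_cum_arrivalH₁ hT hd₄ ht, div_one]
  rw [hh]
  refine .of_busy_period one_pos zero_le_one (T := T₁) (by linarith [hE.one_le]) ?_ ?_ ?_ ?_ ?_ ?_ ?_
  · rintro ⟨_ | k, hk⟩
    · exact .zero
    · change IsRate (R.d₄ k)
      rw [hd₄]
      exact h.dep.isRate_visitRate zero_le_one k
  · intro k
    rw [hd₁]
    exact hD.isRate_visitRate zero_le_one _
  · intro t ht htT
    rw [hw t ht.le, min_eq_left (h.dep_le hE ht.le (htT.trans hE.lt_last).le)]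
    linarith [hE.before t ht.le htT]
  · have h1 : 0 ≤ T₁ := by linarith [hE.one_le]
    rw [hw _ h1, min_eq_left (h.dep_le hE h1 hE.lt_last.le)]
    linarith [hE.turn]
  · intro x y hx hxy
    have hx0 : 0 ≤ x := by linarith [hE.one_le]
    rw [h.sum_cum_arrivalH₁ hT hd₄ hx0, h.sum_cum_arrivalH₁ hT hd₄ (hx0.trans hxy)]
    exact hm.sub_le x y hx0 hxy
  · intro k
    have hne : ∀ᵐ t : ℝ, t ≠ 0 := by simp [ae_iff, measure_singleton]
    filter_upwards [hne] with t ht0 ht ht1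
    have ht' : t ∈ Ioo (0 : ℝ) 1 := ⟨lt_of_le_of_ne ht ht0.symm, ht1⟩
    -- On (0, 1) the output of Q₁ is the identity, so the derivative defining its rate is 1 for
    -- visit 0 and 0 for the others, as the initial content demands.
    have hev : (fun s => visitPart k (firstDep K E (max s 0))) =ᶠ[nhds t]
        fun s => if (k : ℕ) = 0 then s else 0 := by
      filter_upwards [isOpen_Ioo.mem_nhds ht'] with s hs
      have h1 : 0 ≤ min (E s) ((K : ℝ) - 1) := le_min (h.dep_nonneg hs.1.le) (by linarith)
      rw [max_eq_left hs.1.le, firstDep, min_eq_left (by linarith [hs.2])]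
      split_ifs with hk
      · rw [hk, visitPart_of_mem (by simpa using hs.1.le) (by simpa using hs.2.le)]
        simp
      · have : (1 : ℝ) ≤ (k : ℕ) := by exact_mod_cast Nat.one_le_iff_ne_zero.2 hk
        exact visitPart_of_le (by linarith [hs.2])
    rw [hd₁, visitRate, rateOf, hev.deriv_eq]
    split_ifs <;> simp
  · intro k t ht
    have hu : firstDep K E (t + max (workload 1 1 (fun k : Fin K => R.arrivalH₁ k) t) 0) =
        1 + min (E t) (K - 1) := by
      rw [hw t ht]
      rcases le_total t (1 + min (E t) (K - 1)) with h1 | h1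
      · rw [max_eq_left (by linarith), add_sub_cancel, firstDep]
        exact min_eq_left (by linarith [hm.mono t _ ht h1])
      · rw [max_eq_right (by linarith), add_zero, firstDep]
        exact min_eq_right h1
    have h1 : firstDep K E 1 = 1 := by
      rw [firstDep, min_eq_left]
      have : 0 ≤ min (E 1) ((K : ℝ) - 1) := le_min (h.dep_nonneg zero_le_one) (by linarith)
      linarith
    rw [hd₁, hD.cum_visitRate zero_le_one (h.firstDep_zero hT) _
        (add_nonneg ht (le_max_right _ _)),
      hD.cum_visitRate zero_le_one (h.firstDep_zero hT) _ zero_le_one, hu, h1]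
    obtain ⟨_ | k, hk⟩ := k
    · have : 0 ≤ min (E t) ((K : ℝ) - 1) := le_min (h.dep_nonneg ht) (by linarith)
      rw [visitPart_of_ge (by simpa using this), visitPart_of_ge (by simp)]
      simp [GadgetTrajectory.arrivalH₁, cum]
    · rw [h.cum_arrivalH₁_succ hd₄ k ht, visitPart_succ, add_sub_cancel_left,
        visitPart_of_le (k := k + 1) (x := 1) (by push_cast; linarith [k.cast_nonneg (α := ℝ)]),
        zero_add]
      have := visitPart_min (k := k) (n := K - 1) (by omega) (E t)
      rwa [Nat.cast_pred (by omega)] at this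

theorem sum_cum_arrivals₂ (h : IsCirculation K ε g B E) (hT : IsTuned K ε g) {t : ℝ} (ht : 0 ≤ t) :
    ∑ i, cum (Sum.elim (fun k : Fin K => visitRate (firstDep K E) k) v i) t =
      firstDep K E t + ∑ i, cum (v i) t := by
  have hD := h.isFlow_firstDep
  have h0 : 0 ≤ firstDep K E t := by
    rw [← h.firstDep_zero hT]
    exact hD.mono 0 t le_rfl ht
  rw [Fintype.sum_sum_type]
  simp only [Sum.elim_inl, Sum.elim_inr, hD.cum_visitRate zero_le_one (h.firstDep_zero hT) _ ht]
  rw [← Finset.sum_range (fun k => visitPart k (firstDep K E t)), sum_visitPart _ h0,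
    min_eq_left (firstDep_le K E t)]

theorem arrivals₂_sub_le (h : IsCirculation K ε g B E) (hT : IsTuned K ε g)
    (hE : IsTipProfile K ε E T₁) (hv : IsVerticalArrivals (ε ^ 2) v)
    (hμ : μ₂ < 2 * ε / 5 - ε ^ 2) {x y : ℝ} (hx : T₁ ≤ x) (hxy : x ≤ y) :
    ∑ i, cum (Sum.elim (fun k : Fin K => visitRate (firstDep K E) k) v i) y -
      ∑ i, cum (Sum.elim (fun k : Fin K => visitRate (firstDep K E) k) v i) x ≤
      (1 - μ₂) * (y - x) := by
  have hx0 : 0 ≤ x := by linarith [hE.one_le]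
  rw [h.sum_cum_arrivals₂ hT hx0, h.sum_cum_arrivals₂ hT (hx0.trans hxy)]
  have h1 := h.firstDep_sub_le hT hE hx hxy
  have h2 := hv.isFlow.sub_le x y hx0 hxy
  have h3 : (1 - 2 * ε / 5 + ε ^ 2) * (y - x) ≤ (1 - μ₂) * (y - x) :=
    mul_le_mul_of_nonneg_right (by linarith) (by linarith)
  linarith

theorem exists_second_server (h : IsCirculation K ε g B E) (hT : IsTuned K ε g)
    (hE : IsTipProfile K ε E T₁) (hv : IsVerticalArrivals (ε ^ 2) v) (hμ0 : 0 < μ₂)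
    (hμ : μ₂ < 2 * ε / 5 - ε ^ 2) : ∃ d h₂, IsFIFOServer (1 - μ₂) 0 (fun _ _ => 0)
      (Sum.elim (fun k : Fin K => visitRate (firstDep K E) k) v) d h₂ := by
  have hm := hT.service_pos
  have hε := sq_nonneg ε
  obtain ⟨T₂, h12, h23, hz, hp, -⟩ := hE.exists_end_of_backlog hT.pos hT.lt hv.isFlow
    (by simp [cum_zero]) (by linarith : 1 - 2 * ε / 5 + ε ^ 2 < 1 - μ₂) (by linarith)
  have h1 := hE.one_le
  have hw : ∀ t, 0 ≤ t → t ≤ T₂ →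
      workload (1 - μ₂) 0 (Sum.elim (fun k : Fin K => visitRate (firstDep K E) k) v) t =
      tipExit (1 - μ₂) E (fun t => ∑ i, cum (v i) t) t - t := fun t ht ht' => by
    rw [workload, h.sum_cum_arrivals₂ hT ht, h.firstDep_eq hE ht (ht'.trans h23.le), zero_add,
      tipExit]
  refine ⟨_, _, (IsFIFOServer.exists_of_busy_period (T := T₂) (by linarith) (by linarith) ?_ ?_ ?_
    ?_).choose_spec⟩
  · rintro (k | i)
    · exact h.isFlow_firstDep.isRate_visitRate zero_le_one _
    · exact hv.isRate i
  · intro t ht htT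
    rw [hw t ht.le htT.le]
    exact hp t ht htT
  · rw [hw T₂ (by linarith) le_rfl, hz]
  · exact fun x y hx hxy => h.arrivals₂_sub_le hT hE hv hμ (h12.le.trans hx) hxy

/-- The output of Q₃ does not depend on the vertical arrivals: it works at full rate until K/(1 -
2ε/5), and by then all K units have passed. That is why one curve `B`, fixed in advance, suits every
Q₂. -/
theorem third_server (h : IsCirculation K ε g B E) (hT : IsTuned K ε g)
    (hE : IsTipProfile K ε E T₁) (hv : IsVerticalArrivals (ε ^ 2) v) (hμ0 : 0 < μ₂)
    (hμ : μ₂ < 2 * ε / 5 - ε ^ 2) {d : Fin K ⊕ Fin L → ℝ → ℝ} {h₂ : ℝ → ℝ}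
    (S : IsFIFOServer (1 - μ₂) 0 (fun _ _ => 0)
      (Sum.elim (fun k : Fin K => visitRate (firstDep K E) k) v) d h₂) :
    IsFIFOServer (1 - 2 * ε / 5) 0 (fun _ _ => 0) (fun k => d (Sum.inl k))
      (fun k : Fin K => visitRate B k)
      fun t => max (workload (1 - 2 * ε / 5) 0 (fun k => d (Sum.inl k)) t) 0 := by
  have hm := hT.service_pos
  have hε := sq_nonneg ε
  have hD := h.isFlow_firstDep
  have h1 := hE.one_le
  have hT0 : 0 < (K : ℝ) / (1 - 2 * ε / 5) := by linarith [hE.lt_last]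
  have hV0 : ∑ i, cum (v i) 0 = 0 := by simp [cum_zero]
  have hμ' : 1 - 2 * ε / 5 + ε ^ 2 < 1 - μ₂ := by linarith
  have hh : ∀ t, 0 ≤ t → t ≤ K / (1 - 2 * ε / 5) → h₂ t =
      max (tipExit (1 - μ₂) E (fun t => ∑ i, cum (v i) t) t - t) 0 := fun t ht ht' =>
    S.second_server hE hT.pos hT.lt hv.isFlow hV0 hμ' (by linarith) le_rfl
      (fun x hx hx' => by rw [h.sum_cum_arrivals₂ hT hx, h.firstDep_eq hE hx hx']) ht ht'
  have hh' : ∀ t, K / (1 - 2 * ε / 5) ≤ t → h₂ t = 0 := by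
    intro t ht
    refine S.eq_zero_of_arrivals_le (s := K / (1 - 2 * ε / 5)) (t := t) (by linarith) le_rfl
      hT0.le ?_ (fun x y hx hxy _ => h.arrivals₂_sub_le hT hE hv hμ (by linarith [hE.lt_last]) hxy)
      t ht le_rfl
    obtain ⟨T₂, -, h23, -, -, hn⟩ := hE.exists_end_of_backlog hT.pos hT.lt hv.isFlow hV0 hμ'
      (by linarith)
    rw [hh _ hT0.le le_rfl, max_eq_right (hn _ h23.le le_rfl)]
  have hdep : ∀ (k : Fin K) x, 0 ≤ x → cum (d (Sum.inl k)) (x + h₂ x) =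
      visitPart k (firstDep K E x) := fun k x hx => by
    rw [S.cum_dep_exit le_rfl _ hx, cum_zero, zero_add, Sum.elim_inl,
      hD.cum_visitRate zero_le_one (h.firstDep_zero hT) _ hx]
  have hsum : ∀ x, 0 ≤ x → ∑ k, cum (d (Sum.inl k)) (x + h₂ x) = firstDep K E x := fun x hx => by
    have h0 : 0 ≤ firstDep K E x := by
      rw [← h.firstDep_zero hT]
      exact hD.mono 0 x le_rfl hx
    rw [Finset.sum_congr rfl fun k _ => hdep k x hx,
      ← Finset.sum_range (fun k => visitPart k (firstDep K E x)), sum_visitPart _ h0,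
      min_eq_left (firstDep_le K E x)]
  have hlate : ∀ (k : Fin K) t, K / (1 - 2 * ε / 5) ≤ t → cum (d (Sum.inl k)) t = 1 :=
    fun k t ht => by
      have := hdep k t (hT0.le.trans ht)
      rwa [hh' t ht, add_zero, h.firstDep_of_ge hT hE ht,
        visitPart_of_ge (by exact_mod_cast k.2)] at this
  have hcard : ∀ t, K / (1 - 2 * ε / 5) ≤ t → ∑ k, cum (d (Sum.inl k)) t = K := fun t ht => by
    rw [Finset.sum_congr rfl fun k _ => hlate k t ht]
    simp
  refine .of_busy_period hm le_rfl hT0.le (fun k => S.dep _)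
    (fun k => h.arr.isRate_visitRate zero_le_one _) ?_ ?_ ?_
    (fun i => Filter.Eventually.of_forall fun t h1 h2 => absurd h1 (not_le.2 h2)) ?_
  · intro t ht htT
    obtain ⟨x, hx, hxt, rfl⟩ := S.exists_exit_eq le_rfl ht.le
    have hx0 : 0 < x := by
      refine lt_of_le_of_ne hx ?_
      rintro rfl
      rw [S.height_zero] at ht
      linarith
    have hxT := hxt.trans_lt htT
    have h2 := hE.service_mul_exit_lt hT.pos hT.lt hv.isFlow hV0 hμ' hx0 hxT
    rw [← hh x hx hxT.le, mul_comm, ← lt_div_iff₀ hm, ← h.firstDep_eq hE hx hxT.le] at h2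
    rw [workload, hsum x hx]
    linarith
  · rw [workload, hcard _ le_rfl]
    ring
  · intro x y hx hxy
    rw [hcard x hx, hcard y (hx.trans hxy), sub_self]
    exact mul_nonneg hm.le (by linarith)
  · intro k t ht
    rw [h.arr.cum_visitRate zero_le_one h.arr_zero _ (add_nonneg ht (le_max_right _ _)), cum_zero,
      zero_add]
    rcases le_total t (K / (1 - 2 * ε / 5)) with htT | htT
    · obtain ⟨x, hx, hxt, rfl⟩ := S.exists_exit_eq le_rfl ht
      have hexit : x + h₂ x + max (workload (1 - 2 * ε / 5) 0 (fun k => d (Sum.inl k))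
          (x + h₂ x)) 0 = firstDep K E x / (1 - 2 * ε / 5) := by
        rw [workload, hsum x hx]
        have : x + h₂ x ≤ firstDep K E x / (1 - 2 * ε / 5) := by
          rw [h.firstDep_eq hE hx (hxt.trans htT), le_div_iff₀ hm, mul_comm,
            hh x hx (hxt.trans htT)]
          rcases eq_or_lt_of_le hx with rfl | hx0
          · simp [hE.tipDep_zero, tipExit, cum_zero]
          · rcases eq_or_lt_of_le (hxt.trans htT) with rfl | hxT
            · rw [← hh _ hx le_rfl, hh' _ le_rfl, hE.tipDep_last hT.pos hT.lt, add_zero,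
                mul_div_cancel₀ _ hm.ne']
            · exact (hE.service_mul_exit_lt hT.pos hT.lt hv.isFlow hV0 hμ' hx0 hxT).le
        rw [max_eq_left (by linarith)]
        ring
      have h0 : 0 ≤ firstDep K E x := by
        rw [← h.firstDep_zero hT]
        exact hD.mono 0 x le_rfl hx
      rw [hexit, h.arr_eq _ (div_nonneg h0 hm.le)
        (div_le_div_of_nonneg_right (firstDep_le K E x) hm.le), mul_div_cancel₀ _ hm.ne',
        hdep k x hx]
    · rw [hlate k t htT]
      refine visitPart_of_ge ?_
      have e := h.arr.mono _ _ hT0.le (htT.trans (le_add_of_nonneg_right (le_max_right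
        (workload (1 - 2 * ε / 5) 0 (fun k => d (Sum.inl k)) t) 0)))
      rw [h.arr_eq _ hT0.le le_rfl, mul_div_cancel₀ _ hm.ne'] at e
      have : (k : ℝ) + 1 ≤ K := by exact_mod_cast k.2
      linarith

end IsCirculation

/-- The time at which session `H` leaves the gadget, if it makes `K'` small loops. -/
theorem IsTuned.tipArrival_add_one {K K' : ℕ} {ε : ℝ} {g : ℝ → ℝ} (hT : IsTuned K ε g)
    (hz : ∀ t, tipArrival K ε g K' ≤ t → g t = 0) {t : ℝ} (ht : tipArrival K ε g (K' + 1) ≤ t) :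
    tipArrival K ε g (K' + 1) + 1 = K + K' + cum g t := by
  have h1 := hT.tipArrival_step K'
  rw [hT.cum_eventually h1.1 hz (by linarith : _ ≤ t) le_rfl]
  simp only [tipArrival]
  ring

namespace IsCirculation

variable {K K' : ℕ} {ε T₁ μ₂ : ℝ} {g B E : ℝ → ℝ} {L : ℕ} {v : Fin L → ℝ → ℝ}

theorem arr_le (h : IsCirculation K ε g B E) {t : ℝ} (ht : 0 ≤ t)
    (htP : t ≤ tipArrival K ε g (K' + 1)) : B t ≤ K + K' := by
  have := h.arr.mono t _ ht htP
  rw [h.arr_tip] at this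
  push_cast at this
  linarith

theorem le_arr (h : IsCirculation K ε g B E) (hT : IsTuned K ε g) {t : ℝ}
    (htP : tipArrival K ε g (K' + 1) ≤ t) : K + K' ≤ B t := by
  have := h.arr.mono _ t (hT.tipArrival_step _).1 htP
  rw [h.arr_tip] at this
  push_cast at this
  linarith

/-- The cumulative departures of session `S` from `Q₄`. -/
theorem isFlow_rest (h : IsCirculation K ε g B E) : IsFlow 1 fun t => t - E t :=
  ⟨fun s t hs hst => by linarith [h.dep.sub_le s t hs hst],
    fun s t hs hst => by linarith [h.dep.mono s t hs hst]⟩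

theorem cum_rest (h : IsCirculation K ε g B E) {t : ℝ} (ht : 0 ≤ t) :
    cum (rateOf fun t => t - E t) t = t - E t := by
  rw [h.isFlow_rest.cum_rateOf zero_le_one ht, h.dep_zero]
  ring

theorem cum_arrivalH₄ (h : IsCirculation K ε g B E) (hT : IsTuned K ε g)
    (hE : IsTipProfile K ε E T₁) {R : GadgetTrajectory L} (hd₃ : ∀ k, R.d₃ k = visitRate B k)
    (hd₄ : ∀ k, R.d₄ k = visitRate E k) (k : ℕ) {t : ℝ} (ht : 0 ≤ t) :
    cum (R.arrivalH₄ K k) t = visitPart k (B t) := by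
  rw [GadgetTrajectory.arrivalH₄]
  split_ifs with hk
  · rw [hd₃, h.arr.cum_visitRate zero_le_one h.arr_zero k ht]
  · rw [hd₄, h.dep.cum_visitRate zero_le_one h.dep_zero _ ht, h.visitPart_dep hT hE (by omega) ht]

theorem sum_cum_arrivals₄ (h : IsCirculation K ε g B E) (hT : IsTuned K ε g)
    (hE : IsTipProfile K ε E T₁) {R : GadgetTrajectory L} (hd₃ : ∀ k, R.d₃ k = visitRate B k)
    (hd₄ : ∀ k, R.d₄ k = visitRate E k) (hg : R.rate = g) {t : ℝ} (ht : 0 ≤ t) :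
    ∑ i : Fin (K + K') ⊕ Unit,
      cum (Sum.elim (fun k : Fin (K + K') => R.arrivalH₄ K k) (fun _ => R.rate) i) t =
      min (B t) (K + K') + cum g t := by
  rw [IsGadgetRun.sum_arr₄, hg,
    Finset.sum_congr rfl fun k _ => h.cum_arrivalH₄ hT hE hd₃ hd₄ k ht,
    sum_visitPart _ (h.arr_nonneg ht)]
  push_cast
  rfl

theorem rest_eq (h : IsCirculation K ε g B E) (hT : IsTuned K ε g)
    (hz : ∀ t, tipArrival K ε g K' ≤ t → g t = 0) {u : ℝ} (hu : tipArrival K ε g (K' + 1) + 1 ≤ u) :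
    K + K' ≤ E u ∧ u - E u = tipArrival K ε g (K' + 1) + 1 - (K + K') := by
  have hP := (hT.tipArrival_step (K' + 1)).1
  have hPe := hT.tipArrival_add_one hz le_rfl
  obtain ⟨s, hs, rfl⟩ := h.surj u (by linarith)
  rw [h.exit s hs]
  rcases le_total s (tipArrival K ε g (K' + 1)) with h1 | h1
  · have e1 := h.arr_le hs h1
    have e2 := hT.isRate.cum_mono hs h1
    constructor <;> linarith
  · have e1 := hT.tipArrival_add_one hz h1
    exact ⟨h.le_arr hT h1, by linarith⟩

/-- The circulation never ends, whereas in the gadget H leaves after K + K' visits, so arrivals are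
cut off at that amount. The cut takes effect only when the tip finishes its last visit, and one time
unit later Q₄ is empty for good. -/
theorem fourth_server (h : IsCirculation K ε g B E) (hT : IsTuned K ε g)
    (hE : IsTipProfile K ε E T₁) (hz : ∀ t, tipArrival K ε g K' ≤ t → g t = 0)
    {R : GadgetTrajectory L} (hd₃ : ∀ k, R.d₃ k = visitRate B k)
    (hd₄ : ∀ k, R.d₄ k = visitRate E k) (hg : R.rate = g) (hS : R.dS = rateOf fun t => t - E t)
    (hh : R.h₄ = fun t => max (workload 1 0
      (Sum.elim (fun k : Fin (K + K') => R.arrivalH₄ K k) (fun _ : Unit => R.rate)) t) 0) :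
    IsFIFOServer (ι := Fin (K + K') ⊕ Unit) 1 0 (fun _ _ => 0)
      (Sum.elim (fun k => R.arrivalH₄ K k) (fun _ => R.rate))
      (Sum.elim (fun k => R.d₄ k) (fun _ => R.dS)) R.h₄ := by
  have hP := (hT.tipArrival_step (K' + 1)).1
  have hw : ∀ t, 0 ≤ t → workload 1 0
      (Sum.elim (fun k : Fin (K + K') => R.arrivalH₄ K k) (fun _ : Unit => R.rate)) t =
      min (B t) (K + K') + cum g t - t := fun t ht => by
    rw [workload, h.sum_cum_arrivals₄ hT hE hd₃ hd₄ hg ht, div_one, zero_add]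
  have hlate : ∀ t, tipArrival K ε g (K' + 1) ≤ t →
      min (B t) (K + K') + cum g t = tipArrival K ε g (K' + 1) + 1 := fun t ht => by
    rw [min_eq_right (h.le_arr hT ht), hT.tipArrival_add_one hz ht]
  rw [hh]
  refine .of_busy_period (T := tipArrival K ε g (K' + 1) + 1) one_pos le_rfl (by linarith) ?_ ?_ ?_
    ?_ ?_ (fun i => Filter.Eventually.of_forall fun t h1 h2 => absurd h1 (not_le.2 h2)) ?_
  · rintro (k | i)
    · simp only [Sum.elim_inl, GadgetTrajectory.arrivalH₄]
      split_ifs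
      · rw [hd₃]
        exact h.arr.isRate_visitRate zero_le_one _
      · rw [hd₄]
        exact h.dep.isRate_visitRate zero_le_one _
    · simpa only [Sum.elim_inr, hg] using hT.isRate
  · rintro (k | i)
    · simp only [Sum.elim_inl, hd₄]
      exact h.dep.isRate_visitRate zero_le_one _
    · simp only [Sum.elim_inr, hS]
      exact h.isFlow_rest.isRate zero_le_one
  · intro t ht htT
    rw [hw t ht.le]
    rcases le_total t (tipArrival K ε g (K' + 1)) with h1 | h1
    · rw [min_eq_left (h.arr_le ht.le h1)]
      linarith [h.lt_exit t ht]
    · rw [hlate t h1]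
      linarith
  · rw [hw _ (by linarith), hlate _ (by linarith)]
    ring
  · intro x y hx hxy
    rw [h.sum_cum_arrivals₄ hT hE hd₃ hd₄ hg (t := x) (by linarith), hlate x (by linarith),
      h.sum_cum_arrivals₄ hT hE hd₃ hd₄ hg (t := y) (by linarith), hlate y (by linarith)]
    linarith
  · intro i t ht
    have hu : 0 ≤ t + max (workload 1 0 (Sum.elim (fun k : Fin (K + K') => R.arrivalH₄ K k)
      (fun _ : Unit => R.rate)) t) 0 := add_nonneg ht (le_max_right _ _)
    revert hu
    rw [cum_zero, zero_add, hw t ht]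
    rcases le_total t (tipArrival K ε g (K' + 1)) with h1 | h1
    · have e1 : t ≤ B t + cum g t := by
        rcases eq_or_lt_of_le ht with rfl | h0
        · simp [h.arr_zero, cum_zero]
        · exact (h.lt_exit t h0).le
      rw [min_eq_left (h.arr_le ht h1), max_eq_left (by linarith), add_sub_cancel]
      intro hu
      rcases i with k | i
      · simp only [Sum.elim_inl]
        rw [hd₄, h.dep.cum_visitRate zero_le_one h.dep_zero _ hu, h.exit t ht,
          h.cum_arrivalH₄ hT hE hd₃ hd₄ _ ht]
      · simp only [Sum.elim_inr]
        rw [hS, hg, h.cum_rest hu, h.exit t ht]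
        ring
    · rw [hlate t h1]
      intro hu
      obtain ⟨e1, e2⟩ := h.rest_eq hT hz (u := t + max (tipArrival K ε g (K' + 1) + 1 - t) 0)
        (by linarith [le_max_left (tipArrival K ε g (K' + 1) + 1 - t) 0])
      rcases i with k | i
      · have hk : ((k : ℕ) : ℝ) + 1 ≤ K + K' := by exact_mod_cast k.2
        simp only [Sum.elim_inl]
        rw [hd₄, h.dep.cum_visitRate zero_le_one h.dep_zero _ hu,
          h.cum_arrivalH₄ hT hE hd₃ hd₄ _ ht, visitPart_of_ge (hk.trans e1),
          visitPart_of_ge (hk.trans (h.le_arr hT h1))]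
      · simp only [Sum.elim_inr]
        rw [hS, hg, h.cum_rest hu, e2, hT.tipArrival_add_one hz h1]
        ring

/-- The S-fluid stored at `a > 0` is what was injected since the entry time of the fluid now
leaving. If there is none, the nonincreasing rate is zero at `a` and ever after, so all the rules
hold trivially for intervals starting there; a blocked interval starting at 0 gives the decrease
function itself. -/
theorem obeysFlowControl {f : ℝ → ℝ → ℝ} (h : IsCirculation K ε (f ε) B E)
    (hT : IsTuned K ε (f ε)) (hf0 : ∀ t, 0 ≤ t → f 0 t = 0) {R : GadgetTrajectory L}
    (hg : R.rate = f ε) (hS : R.dS = rateOf fun t => t - E t)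
    (S : IsFIFOServer (ι := Fin (K + K') ⊕ Unit) 1 0 (fun _ _ => 0)
      (Sum.elim (fun k => R.arrivalH₄ K k) (fun _ => R.rate))
      (Sum.elim (fun k => R.d₄ k) (fun _ => R.dS)) R.h₄) :
    ObeysFlowControl f ε K K' R := by
  have hzero : ∀ a, 0 < a → ¬ R.Blocked a → f ε a = 0 := by
    intro a ha hb
    have e := S.stored_eq le_rfl (Sum.inr ()) ha.le
    simp only [Sum.elim_inr, cum_zero, zero_add] at e
    rw [GadgetTrajectory.Blocked, e, hg, hS, h.cum_rest ha.le] at hb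
    obtain ⟨s, hs, rfl⟩ := h.surj a ha.le
    rw [h.exit s hs] at hb
    have hlt : s < B s + cum (f ε) s := by
      rcases eq_or_lt_of_le hs with rfl | h0
      · exact ha
      · exact h.lt_exit s h0
    have e2 := hT.isRate.le_cum_sub hs hlt.le fun x hx =>
      hT.anti (mem_Ici.2 (hs.trans hx.1.le)) (mem_Ici.2 ha.le) hx.2.le
    refine le_antisymm ?_ (hT.nonneg _ ha.le)
    by_contra hn
    have := mul_pos (not_le.1 hn) (sub_pos.2 hlt)
    linarith
  have hconst : ∀ a b, 0 ≤ a → a < b → (∀ t ∈ Ioo a b, ¬ R.Blocked t) →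
      ∀ t ∈ Icc a b, R.rate t = 0 := by
    intro a b ha hab hb
    have heq : EqOn (f ε) (fun _ => 0) (Ioo a b) := fun t ht =>
      hzero t (ha.trans_lt ht.1) (hb t ht)
    rw [hg]
    exact heq.of_subset_closure (hT.cont.mono fun x hx => ha.trans hx.1) continuousOn_const
      Ioo_subset_Icc_self (closure_Ioo hab.ne).ge
  refine ⟨hg ▸ hT.cont, hg ▸ hT.nonneg, fun t ht => hg ▸ hT.le_max ht, ?_, ?_, ?_⟩
  · intro a b ha hab hb _ t ht
    rw [hg]
    rcases eq_or_lt_of_le ha with rfl | h0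
    · rw [hT.start, sub_zero]
    · rw [hzero a h0 hb, hf0 _ (by linarith [ht.1])]
      refine le_antisymm ?_ (hT.nonneg _ (ha.trans ht.1))
      rw [← hzero a h0 hb]
      exact hT.anti (mem_Ici.2 ha) (mem_Ici.2 (ha.trans ht.1)) ht.1
  · intro a b ha hab hb t ht
    have := hconst a b ha hab fun t ht => (hb t ht).1
    rw [this t ht, this a (left_mem_Icc.2 hab.le)]
  · intro a b ha hab hb s hs t ht _
    have := hconst a b ha hab fun t ht => (hb t ht).1.not_gt
    rw [this s hs, this t ht]

end IsCirculation

/-- The gadget has a run. -/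
theorem IsTuned.exists_isGadgetRun {K K' L : ℕ} {ε T₁ μ₂ : ℝ} {f : ℝ → ℝ → ℝ}
    (hT : IsTuned K ε (f ε)) (hf0 : ∀ t, 0 ≤ t → f 0 t = 0) {E : ℝ → ℝ}
    (hE : IsTipProfile K ε E T₁)
    (hEφ : ∀ x, 0 ≤ x → x ≤ (K - 1) / (1 - 2 * ε / 5) →
      E ((1 - 2 * ε / 5) * x + cum (f ε) x) = (1 - 2 * ε / 5) * x) {v : Fin L → ℝ → ℝ}
    (hv : IsVerticalArrivals (ε ^ 2) v) (hμ0 : 0 < μ₂) (hμ : μ₂ < 2 * ε / 5 - ε ^ 2)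
    (hz : ∀ t, tipArrival K ε (f ε) K' ≤ t → f ε t = 0) :
    ∃ R : GadgetTrajectory L, IsGadgetRun f ε μ₂ (2 * ε / 5) K K' v R := by
  obtain ⟨B, E₁, h⟩ := hT.exists_isCirculation
  have hE₁ := hE.congr fun t ht ht' => h.dep_eq_of_tip hT hEφ ht ht'
  obtain ⟨d, h₂, S₂⟩ := h.exists_second_server hT hE₁ hv hμ0 hμ
  let R₀ : GadgetTrajectory L :=
    { h₁ := 0
      h₂ := h₂
      h₃ := fun t => max (workload (1 - 2 * ε / 5) 0 (fun k => d (Sum.inl k)) t) 0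
      h₄ := 0
      d₁ := visitRate (firstDep K E₁)
      d₂ := fun k => if hk : k < K then d (Sum.inl ⟨k, hk⟩) else 0
      d₃ := visitRate B
      d₄ := visitRate E₁
      dV := fun i => d (Sum.inr i)
      dS := rateOf fun t => t - E₁ t
      rate := f ε }
  let R : GadgetTrajectory L :=
    { R₀ with
      h₁ := fun t => max (workload 1 1 (fun k : Fin K => R₀.arrivalH₁ k) t) 0
      h₄ := fun t => max (workload 1 0
        (Sum.elim (fun k : Fin (K + K') => R₀.arrivalH₄ K k) (fun _ : Unit => R₀.rate)) t) 0 }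
  have hd₂ : (fun k : Fin K => R.d₂ k) = fun k => d (Sum.inl k) := by
    funext k
    simp [R, R₀]
  have S₄ := h.fourth_server (R := R) hT hE₁ hz (fun _ => rfl) (fun _ => rfl) rfl rfl rfl
  refine ⟨R, h.first_server hT hE₁ (fun _ => rfl) (fun _ => rfl) ?_, ?_, ?_, S₄, hT.start,
    h.obeysFlowControl hT hf0 rfl rfl S₄⟩
  · rfl
  · rw [hd₂]
    convert S₂ using 1
    funext i
    rcases i with k | i <;> rfl
  · rw [hd₂]
    exact h.third_server hT hE₁ hv hμ0 hμ S₂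

/-! ### Fine-tuning of μ₂ and conclusion -/

theorem FollowsPhase.isGreatest_height₂ {L K K' : ℕ} {ε μ₃ T₁ T₂ T₃ P : ℝ} {R : GadgetTrajectory L}
    (h : FollowsPhase ε μ₃ K K' R T₁ T₂ T₃ P) : IsGreatest (R.h₂ '' Icc 0 P) (R.h₂ T₁) := by
  obtain ⟨h1, h2, h3, h4⟩ := h.times
  have h0 : 0 ≤ R.h₂ T₁ := by
    rw [← h.start_heights.2.1]
    exact (h.fst_h₂ (left_mem_Icc.2 h1.le) (right_mem_Icc.2 h1.le) h1).le
  refine ⟨⟨T₁, ⟨h1.le, by linarith⟩, rfl⟩, ?_⟩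
  rintro _ ⟨t, ht, rfl⟩
  rcases le_total t T₁ with h5 | h5
  · exact h.fst_h₂.monotoneOn ⟨ht.1, h5⟩ (right_mem_Icc.2 h1.le) h5
  rcases le_total t T₂ with h6 | h6
  · exact h.snd_h₂.antitoneOn (left_mem_Icc.2 h2.le) ⟨h5, h6⟩ h5
  rcases le_total t T₃ with h7 | h7
  · rwa [(h.trd_h₁₂ t ⟨h6, h7⟩).2]
  · rwa [(h.fth t ⟨h7, ht.2⟩).2.1]

/-- The maximal height of `Q₂` takes all values close to `1 / 5` when `μ₂` varies. -/
theorem exists_height₂_eq {K L : ℕ} {ε T₁ y : ℝ} {E : ℝ → ℝ} (hE : IsTipProfile K ε E T₁)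
    (h0 : 0 < ε) (h1 : ε < 9 / 500) (v : ℝ → Fin L → ℝ → ℝ)
    (hv : ∀ μ₂ ∈ Icc (ε / 60) (ε / 5), IsVerticalArrivals (ε ^ 2) (v μ₂))
    (hc : ContinuousOn (fun μ₂ => ∫ t in (0 : ℝ)..T₁, ∑ i, v μ₂ i t) (Icc (ε / 60) (ε / 5)))
    (hy : 1 / 10 ≤ y) (hy' : y ≤ 1 / 5) :
    ∃ μ₂ ∈ Icc (ε / 60) (ε / 5), (T₁ + ∑ i, cum (v μ₂ i) T₁) / (1 - μ₂) - T₁ = y := by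
  have hT := hE.one_le
  have hle : ε / 60 ≤ ε / 5 := by linarith
  have hsum : ∀ μ₂ ∈ Icc (ε / 60) (ε / 5),
      ∫ t in (0 : ℝ)..T₁, ∑ i, v μ₂ i t = ∑ i, cum (v μ₂ i) T₁ := fun μ₂ hμ =>
    IsRate.cum_sum (fun i _ => (hv μ₂ hμ).isRate i) (by linarith)
  have hcont : ContinuousOn (fun μ₂ => (T₁ + ∑ i, cum (v μ₂ i) T₁) / (1 - μ₂) - T₁)
      (Icc (ε / 60) (ε / 5)) :=
    ((continuousOn_const.add (hc.congr fun μ₂ hμ => (hsum μ₂ hμ).symm)).div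
      (continuousOn_const.sub continuousOn_id) fun μ₂ hμ => by
        have h2 : 0 < 1 - μ₂ := by linarith [hμ.2]
        exact h2.ne').sub continuousOn_const
  -- At μ₂ = ε/60 the bound ε T₁ ≤ 10/9 + ε keeps the height below 1/10 even with full vertical
  -- traffic; at μ₂ = ε/5 the bound ε T₁ ≥ 1 lifts it to 1/5 even without any.
  refine intermediate_value_Icc hle hcont ⟨?_, ?_⟩
  · have e1 := (hv _ (left_mem_Icc.2 hle)).isFlow.sub_le 0 T₁ le_rfl (by linarith)
    simp only [cum_zero, Finset.sum_const_zero, sub_zero] at e1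
    have e2 := hE.upper
    rw [sub_le_iff_le_add, div_le_iff₀ (by linarith)]
    have e3 : ε * (ε * T₁) ≤ 9 / 500 * (ε * T₁) := by
      have := hE.lower
      exact mul_le_mul_of_nonneg_right h1.le (by linarith)
    nlinarith
  · have e1 := (hv _ (right_mem_Icc.2 hle)).isFlow.mono 0 T₁ le_rfl (by linarith)
    simp only [cum_zero, Finset.sum_const_zero] at e1
    have e2 := hE.lower
    rw [le_sub_iff_add_le, le_div_iff₀ (by linarith)]
    nlinarith

/-- For P ≥ 1 one has 5P ≤ ⌈5P⌉ < 5P + 1 ≤ 10P. -/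
theorem div_ceil_bounds {P : ℝ} (hP : 1 ≤ P) :
    1 / 10 ≤ P / (⌈5 * P⌉ : ℝ) ∧ P / (⌈5 * P⌉ : ℝ) ≤ 1 / 5 := by
  have h1 := Int.le_ceil (5 * P)
  have h2 := Int.ceil_lt_add_one (5 * P)
  constructor
  · rw [div_le_div_iff₀ (by norm_num) (by linarith)]
    linarith
  · rw [div_le_div_iff₀ (by linarith) (by norm_num)]
    linarith

theorem mainTheorem4 (S : Set ℝ) (f : ℝ → ℝ → ℝ → ℝ) (hf : IsFlowDecrease S f)
    (K : ℕ) (hK : 20 ≤ K) :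
    ∃ (ε δ μ₃ : ℝ) (K' : ℕ) (T₁ T₃ P : ℝ),
      5 / (3 * (K : ℝ)) < ε ∧ ε < 20 / (K : ℝ) ∧ δ ∈ S ∧ μ₃ = 2 * ε / 5 ∧
      0 < μ₃ - (1 + 3 * ε / 5) * ε ^ 2 ∧
      -- one choice of parameters works for all admissible `μ₂` and all vertical arrivals
      (∀ (L : ℕ) (μ₂ : ℝ) (v : Fin L → ℝ → ℝ), 0 < μ₂ → μ₂ < μ₃ - ε ^ 2 →
        IsVerticalArrivals (ε ^ 2) v →
        (∃ R : GadgetTrajectory L, IsGadgetRun (f δ) ε μ₂ μ₃ K K' v R) ∧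
        ∀ R : GadgetTrajectory L, IsGadgetRun (f δ) ε μ₂ μ₃ K K' v R →
          ∃ T₂ : ℝ, FollowsPhase ε μ₃ K K' R T₁ T₂ T₃ P ∧
            (μ₂ < μ₃ - (1 + 3 * ε / 5) * ε ^ 2 → StrictMonoOn R.h₃ (Set.Icc T₁ T₂))) ∧
      -- fine-tuning of `μ₂`, for vertical arrivals that may depend on `μ₂`
      (100 ≤ K → ∀ (L : ℕ) (v : ℝ → Fin L → ℝ → ℝ),
        (∀ μ₂ ∈ Set.Icc (ε / 60) (ε / 5), IsVerticalArrivals (ε ^ 2) (v μ₂)) →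
        (∀ T : ℝ, 0 ≤ T → ContinuousOn (fun μ₂ => ∫ t in (0 : ℝ)..T, ∑ i, v μ₂ i t)
          (Set.Icc (ε / 60) (ε / 5))) →
        ∃ μ₂ ∈ Set.Icc (ε / 60) (ε / 5), μ₂ < μ₃ - (1 + 3 * ε / 5) * ε ^ 2 ∧
          ∀ R : GadgetTrajectory L, IsGadgetRun (f δ) ε μ₂ μ₃ K K' (v μ₂) R →
            IsGreatest (R.h₂ '' Set.Icc 0 P) (P / (⌈5 * P⌉ : ℝ))) := by
  obtain ⟨ε, δ, hδ, hT⟩ := hf.exists_isTuned hK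
  obtain ⟨E, T₁, hE, hEφ⟩ := hT.exists_tipProfile
  obtain ⟨t₀, ht₀, hz₀⟩ := hT.to_zero
  obtain ⟨n, hn⟩ := exists_nat_ge t₀
  have h0 := hT.pos
  have h1 := hT.lt
  have hKp : (0 : ℝ) < K := by linarith [hT.twenty_le_cast]
  have hf0 : ∀ t, 0 ≤ t → f δ 0 t = 0 := fun t ht => hf.zero_rate hδ ht
  -- With K' = n + 1 the tip starts its last visit no earlier than time n + 1 ≥ t₀, when S has
  -- stopped injecting; moreover K' ≥ 1, as required at the end of the phase.
  have hz : ∀ t, tipArrival K ε (f δ ε) (n + 1) ≤ t → f δ ε t = 0 := fun t ht => by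
    have := hT.le_tipArrival (n + 1)
    push_cast at this
    exact hz₀ t (by linarith)
  -- As ε < 9/100, the threshold for μ₂ is at least 3ε/10, which leaves room for the whole interval
  -- up to ε/5.
  have hsq : (1 + 3 * ε / 5) * ε ^ 2 ≤ ε / 10 := by nlinarith [mul_pos h0 h0]
  have hsq' : ε ^ 2 ≤ (1 + 3 * ε / 5) * ε ^ 2 := by nlinarith [mul_pos h0 h0]
  refine ⟨ε, δ, 2 * ε / 5, n + 1, T₁, K / (1 - 2 * ε / 5), tipArrival K ε (f δ ε) (n + 1 + 1),
    hT.lower, hT.upper.trans ?_, hδ, rfl, by linarith, ?_, ?_⟩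
  · rw [div_lt_div_iff₀ (by linarith) hKp]
    linarith
  · intro L μ₂ v hμ0 hμ hv
    exact ⟨hT.exists_isGadgetRun hf0 hE hEφ hv hμ0 hμ hz, fun R hR =>
      (hR.followsPhase hT hf0 hE hEφ hv hμ0 hμ (by omega) hz).2⟩
  · intro hK' L v hv hc
    have hK'' : (100 : ℝ) ≤ K := by exact_mod_cast hK'
    have hε : ε < 9 / 500 := by
      have := hT.mul_bounds.2
      nlinarith
    have hP : 1 ≤ tipArrival K ε (f δ ε) (n + 1 + 1) := by
      have := hT.tipArrival_step (n + 1)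
      linarith
    obtain ⟨hy, hy'⟩ := div_ceil_bounds hP
    obtain ⟨μ₂, hμ, e⟩ := exists_height₂_eq hE h0 hε v hv (hc T₁ (by linarith [hE.one_le])) hy hy'
    refine ⟨μ₂, hμ, by linarith [hμ.2], fun R hR => ?_⟩
    obtain ⟨e2, T₂, hph, -⟩ := hR.followsPhase hT hf0 hE hEφ (hv μ₂ hμ) (by linarith [hμ.1])
      (by linarith [hμ.2]) (by omega) hz
    rw [← e, ← e2]
    exact hph.isGreatest_height₂
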